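/- **Setting.** Let $M$ be a three-dimensional unimodular Lie group with a left invariant Riemannian metric, and let $E_1,E_2,E_3$ be an orthonormal basis of its Lie algebra with $[E_2,E_3]=c_1E_1$, $[E_3,E_1]=c_2E_2$, $[E_1,E_2]=c_3E_3$; orient $M$ so that this basis is positive. The same letters denote the left invariant frame. Put $\mu_1=\frac{-c_1+c_2+c_3}{2}$, $\mu_2=\frac{c_1-c_2+c_3}{2}$, $\mu_3=\frac{c_1+c_2-c_3}{2}$, let $\nabla$ be the Levi-Civita connection and $\nabla_{E_i}E_j=\sum_k\Gamma_{ij}^kE_k$. Assume $\mu_1=\mu_2$. For a unit vector $(N_1,N_2,N_3)$ with $N_3\neq1$ put $g=\frac{N_1+iN_2}{1-N_3}$. With $B=1+|g|^2$, $P_{(m_0,\dots,m_4)}=\sum_{i=0}^4m_i|g|^{2i}$ and $Q=P_{(\mu_1,\,4\mu_3-2\mu_1,\,\mu_1,\,0,\,0)}$ define, for $x>0$, $$\Delta=B^3\Big(B^4x^2+\mu_1^2\big((B-2)^2\mu_1+4|g|^2\mu_3\big)^2+2x\big(P_{(1,0,6,0,1)}\mu_1^2+P_{(0,4,-8,4,0)}\mu_1\mu_3+8|g|^4\mu_3^2\big)\Big),$$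 $$\begin{aligned}G_1(x)=\frac{2\bar g}{\Delta}\Big[&B^6x^2+2B^2x\big(P_{(0,4,2,1,1)}\mu_1^2+P_{(1,-5,1,3,0)}\mu_1\mu_3+P_{(0,5,3,0,0)}\mu_3^2\big)+16|g|^4(B-2)\mu_1\mu_3^3\\&-\mu_1\big((1+6|g|^2-|g|^4P_{(13,-10,3,0,1)})\mu_1^3-2(B-2)P_{(-1,-6,18,2,3)}\mu_1^2\mu_3-P_{(0,2,66,-18,14)}\mu_1\mu_3^2\big)\Big],\end{aligned}$$ $$G_2(x)=\frac{2ig(B-2)(\mu_3-\mu_1)\big(2B^4x^2+B^4x\mu_1^2-iB^2\sqrt x\,(x+\mu_1^2)P_{(\mu_1,2\mu_3,\mu_1,0,0)}-\mu_1^2Q^2\big)}{B^3\sqrt x\,(x+\mu_1^2)(B^4x+Q^2)},$$ $$G_3(x)=\frac{2ig(B-2)(\mu_1-\mu_3)\big(2B^4x^2+B^4x\mu_1^2+iB^2\sqrt x\,(x+\mu_1^2)P_{(\mu_1,2\mu_3,\mu_1,0,0)}-\mu_1^2Q^2\big)}{B^3\sqrt x\,(x+\mu_1^2)(B^4x+Q^2)},$$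 $$G_4(x)=-\frac{4g^3(B-2)(\mu_1-\mu_3)^2\big(-3B^2x+P_{(\mu_1^2,\,8\mu_1\mu_3-6\mu_1^2,\,\mu_1^2,\,0,\,0)}\big)}{B^3(x+\mu_1^2)(B^4x+Q^2)},$$ $$G_5(x)=\overline{G_7(x)}=\frac{B^2x+\mu_1Q}{4x(\sqrt x+i\mu_1)(B^2\sqrt x+iQ)},$$ $$G_6(x)=-\frac{ig^2(\mu_1-\mu_3)}{\sqrt x(\sqrt x+i\mu_1)(B^2\sqrt x+iQ)},\qquad G_8(x)=\frac{ig^2(\mu_1-\mu_3)}{\sqrt x(\sqrt x-i\mu_1)(B^2\sqrt x-iQ)}.$$ **Theorem.** (1) Let $\varphi:\Sigma\to M$ be a smooth isometric immersion of a Riemannian surface with positive extrinsic curvature $K$ (the determinant of the shape operator), $N$ a smooth unit normal field, and $z$ a local parameter of $\Sigma$ in which the second fundamental form $\langle-\nabla N,d\varphi\rangle$ equals $2\rho\,|dz|^2$ with $\rho>0$, and which is positive for the orientation of $\Sigma$ defined by $N$. Let $N_k=\langle N,E_k(\varphi)\rangle$ and let $g$ be the Gauss map defined from $(N_1,N_2,N_3)$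 as above. Then at every point of the domain of $z$ where $g\neq\infty$ (i.e. $N_3\ne1$) $$g_{z\bar z}=G_1g_zg_{\bar z}+G_2g_z\bar g_{\bar z}+G_3\bar g_zg_{\bar z}+G_4\bar g_z\bar g_{\bar z}+G_5K_zg_{\bar z}+G_6K_z\bar g_{\bar z}+G_7K_{\bar z}g_z+G_8K_{\bar z}\bar g_z,\qquad G_i=G_i(K).\tag{$*$}$$ (2) Let $U\subset\mathbb C$ be open, $N=(N_1,N_2,N_3):U\to\mathbb S^2$ and $K:U\to(0,\infty)$ smooth, and let $a=(a_1,a_2,a_3):U\to\mathbb C^3$ satisfy on $U$ $$a=\tfrac{i}{\sqrt K}\,N\times\nabla_{\partial_z}N,$$ where, for $W:U\to\mathbb C^3$, $(\nabla_{\partial_z}W)_k=(W_k)_z+\sum_{i,j}a_iW_j\Gamma_{ij}^k$ and $(\nabla_{\partial_{\bar z}}W)_k=(W_k)_{\bar z}+\sum_{i,j}\overline{a_i}W_j\Gamma_{ij}^k$. Then, at every point of $U$ with $N_3\neq1$, the integrability equation $$N\times\Big(\nabla_{\partial_z}\big(\tfrac1{\sqrt K}\nabla_{\partial_{\bar z}}N\big)+\nabla_{\partial_{\bar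 z}}\big(\tfrac1{\sqrt K}\nabla_{\partial_z}N\big)\Big)=0$$ holds if and only if $g=\frac{N_1+iN_2}{1-N_3}$ and $K$ satisfy $(*)$. -/

import Mathlib

open scoped Manifold ContDiff Matrix
open Bundle

noncomputable section

namespace LieGauss

/-- The model space of a three-dimensional Lie group. -/
abbrev R3 : Type := EuclideanSpace ℝ (Fin 3)

/-! ## Riemannian Lie groups of dimension three -/

/-- The Riemannian metric of the Lie group `M` is left invariant: all left translations are
isometries. -/
def IsLeftInvariantMetric (M : Type*) [TopologicalSpace M] [ChartedSpace R3 M] [Group M]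
    [RiemannianBundle (fun q : M ↦ TangentSpace (𝓡 3) q)] : Prop :=
  ∀ (a b : M) (u v : TangentSpace (𝓡 3) b),
    inner ℝ (mfderiv (𝓡 3) (𝓡 3) (fun x : M ↦ a * x) b u)
      (mfderiv (𝓡 3) (𝓡 3) (fun x : M ↦ a * x) b v) = inner ℝ u v

section Group

variable {M : Type*} [TopologicalSpace M] [ChartedSpace R3 M] [Group M]
  [RiemannianBundle (fun q : M ↦ TangentSpace (𝓡 3) q)]

/-- The inner product of the Lie algebra, the metric of `M` at the identity. -/
def lieInner (u v : GroupLieAlgebra (𝓡 3) M) : ℝ :=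
  @inner ℝ (TangentSpace (𝓡 3) (1 : M)) _ u v

/-- `e = (E₁, E₂, E₃)` is an orthonormal basis of the Lie algebra with
`[E₂, E₃] = c₁ E₁`, `[E₃, E₁] = c₂ E₂`, `[E₁, E₂] = c₃ E₃`. For the orientation in which `e` is
positive, it consists of eigenvectors of the endomorphism `L` given by `L (X × Y) = [X, Y]`;
such a basis exists exactly when `L` is self-adjoint, that is, when the group is unimodular. -/
structure IsUnimodularFrame (e : Fin 3 → GroupLieAlgebra (𝓡 3) M) (c : Fin 3 → ℝ) : Prop where
  orthonormal : ∀ i j, lieInner (e i) (e j) = if i = j then (1 : ℝ) else 0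
  lie_two_three : ⁅e 1, e 2⁆ = c 0 • e 0
  lie_three_one : ⁅e 2, e 0⁆ = c 1 • e 1
  lie_one_two : ⁅e 0, e 1⁆ = c 2 • e 2

/-- `μ₁ = (-c₁ + c₂ + c₃) / 2`, `μ₂ = (c₁ - c₂ + c₃) / 2`, `μ₃ = (c₁ + c₂ - c₃) / 2`. -/
def mu (c : Fin 3 → ℝ) : Fin 3 → ℝ :=
  ![(-c 0 + c 1 + c 2) / 2, (c 0 - c 1 + c 2) / 2, (c 0 + c 1 - c 2) / 2]

/-- The left invariant frame `Eᵢ(q)`, i.e. the left translate of `Eᵢ` to the point `q`. -/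
def frame (e : Fin 3 → GroupLieAlgebra (𝓡 3) M) (i : Fin 3) (q : M) : TangentSpace (𝓡 3) q :=
  mulInvariantVectorField (e i) q

/-- The Christoffel symbols `Γᵢⱼᵏ` of the Levi-Civita connection of a left invariant metric in a
left invariant orthonormal frame, `∇_{Eᵢ} Eⱼ = ∑ₖ Γᵢⱼᵏ Eₖ`. The inner products of left invariant
fields being constant, Koszul's formula reads
`2 ⟨∇_{Eᵢ} Eⱼ, Eₖ⟩ = ⟨[Eᵢ, Eⱼ], Eₖ⟩ - ⟨[Eⱼ, Eₖ], Eᵢ⟩ + ⟨[Eₖ, Eᵢ], Eⱼ⟩`. -/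
def christoffel (e : Fin 3 → GroupLieAlgebra (𝓡 3) M) (i j k : Fin 3) : ℝ :=
  (lieInner ⁅e i, e j⁆ (e k) - lieInner ⁅e j, e k⁆ (e i) + lieInner ⁅e k, e i⁆ (e j)) / 2

/-! ## Maps from a parameter domain into the group -/

/-- The coordinates `⟨W, Eₖ(ψ)⟩` of a vector field `W` along `ψ`, that is, the left translate
`ψ⁻¹ W` to the identity written in the basis `e`. -/
def frameCoord (e : Fin 3 → GroupLieAlgebra (𝓡 3) M) (ψ : ℂ → M)
    (W : ∀ w : ℂ, TangentSpace (𝓡 3) (ψ w)) (w : ℂ) (k : Fin 3) : ℝ :=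
  inner ℝ (W w) (frame e k (ψ w))

/-- The vector field `dψ(v)` along `ψ`, for a constant direction `v` of the parameter plane. -/
def pushVec (ψ : ℂ → M) (v w : ℂ) : TangentSpace (𝓡 3) (ψ w) :=
  mfderiv 𝓘(ℝ, ℂ) (𝓡 3) ψ w v

/-- The Levi-Civita covariant derivative `∇_v W` of a vector field `W` along `ψ`. -/
def covDerivAlong (e : Fin 3 → GroupLieAlgebra (𝓡 3) M) (ψ : ℂ → M)
    (W : ∀ w : ℂ, TangentSpace (𝓡 3) (ψ w)) (v w : ℂ) : TangentSpace (𝓡 3) (ψ w) :=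
  ∑ k, (fderiv ℝ (fun ζ ↦ frameCoord e ψ W ζ k) w v +
    ∑ i, ∑ j, frameCoord e ψ (pushVec ψ v) w i * frameCoord e ψ W w j * christoffel e i j k) •
      frame e k (ψ w)

/-- The first fundamental form `I = ⟨dψ, dψ⟩`. -/
def firstForm (ψ : ℂ → M) (w v v' : ℂ) : ℝ :=
  inner ℝ (pushVec ψ v w) (pushVec ψ v' w)

/-- The second fundamental form `II = ⟨-∇N, dψ⟩`. -/
def secondForm (e : Fin 3 → GroupLieAlgebra (𝓡 3) M) (ψ : ℂ → M)
    (N : ∀ w : ℂ, TangentSpace (𝓡 3) (ψ w)) (w v v' : ℂ) : ℝ :=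
  inner ℝ (-covDerivAlong e ψ N v w) (pushVec ψ v' w)

/-- The extrinsic curvature, the determinant of the shape operator: `det II / det I`. -/
def extrinsicCurvature (e : Fin 3 → GroupLieAlgebra (𝓡 3) M) (ψ : ℂ → M)
    (N : ∀ w : ℂ, TangentSpace (𝓡 3) (ψ w)) (w : ℂ) : ℝ :=
  (secondForm e ψ N w 1 1 * secondForm e ψ N w Complex.I Complex.I -
      secondForm e ψ N w 1 Complex.I * secondForm e ψ N w Complex.I 1) /
    (firstForm ψ w 1 1 * firstForm ψ w Complex.I Complex.I -
      firstForm ψ w 1 Complex.I * firstForm ψ w Complex.I 1)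

/-- At the point `w` the parameter is conformal for a positive definite second fundamental form:
`II = 2 ρ |dz|²` with `ρ > 0`, as bilinear forms. -/
def IsConformalAt (e : Fin 3 → GroupLieAlgebra (𝓡 3) M) (ψ : ℂ → M)
    (N : ∀ w : ℂ, TangentSpace (𝓡 3) (ψ w)) (w : ℂ) : Prop :=
  ∃ ρ : ℝ, 0 < ρ ∧ ∀ v v' : ℂ, secondForm e ψ N w v v' = 2 * ρ * (v * star v').re

/-- At the point `w` the parameter `x + i y` is compatible with the orientation defined by `N`:
`(ψ_x, ψ_y, N)` is a positive basis, `M` being oriented by the frame `e`. -/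
def IsPositiveAt (e : Fin 3 → GroupLieAlgebra (𝓡 3) M) (ψ : ℂ → M)
    (N : ∀ w : ℂ, TangentSpace (𝓡 3) (ψ w)) (w : ℂ) : Prop :=
  0 < (Matrix.of ![frameCoord e ψ (pushVec ψ 1) w, frameCoord e ψ (pushVec ψ Complex.I) w,
    frameCoord e ψ N w]).det

end Group

/-! ## Complex derivatives and the stereographic projection -/

/-- `f_z = (f_x - i f_y) / 2`. -/
def dz (f : ℂ → ℂ) (w : ℂ) : ℂ :=
  (fderiv ℝ f w 1 - Complex.I * fderiv ℝ f w Complex.I) / 2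

/-- `f_{z̄} = (f_x + i f_y) / 2`. -/
def dzbar (f : ℂ → ℂ) (w : ℂ) : ℂ :=
  (fderiv ℝ f w 1 + Complex.I * fderiv ℝ f w Complex.I) / 2

/-- The stereographic projection from the north pole, for points other than the pole. -/
def stereo (n : Fin 3 → ℝ) : ℂ :=
  (n 0 + Complex.I * n 1) / (1 - n 2)

/-! ## The formal equations for a map into the unit sphere and a positive function

`Γ` are real constants, `N : ℂ → ℝ³`, `K : ℂ → ℝ`, and `a = (a₁, a₂, a₃)` stands for the
coordinates of `φ⁻¹ φ_z`. -/

/-- `∇_{∂_z} W` in the frame: `(W_k)_z + ∑ aᵢ Wⱼ Γᵢⱼᵏ`. -/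
def nablaZ (Γ : Fin 3 → Fin 3 → Fin 3 → ℝ) (a W : ℂ → Fin 3 → ℂ) (w : ℂ) (k : Fin 3) : ℂ :=
  dz (fun ζ ↦ W ζ k) w + ∑ i, ∑ j, a w i * W w j * Γ i j k

/-- `∇_{∂_z̄} W` in the frame: `(W_k)_z̄ + ∑ āᵢ Wⱼ Γᵢⱼᵏ`. -/
def nablaZbar (Γ : Fin 3 → Fin 3 → Fin 3 → ℝ) (a W : ℂ → Fin 3 → ℂ) (w : ℂ) (k : Fin 3) : ℂ :=
  dzbar (fun ζ ↦ W ζ k) w + ∑ i, ∑ j, star (a w i) * W w j * Γ i j k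

/-- A real vector regarded as a complex one. -/
def toC (N : ℂ → Fin 3 → ℝ) (w : ℂ) (k : Fin 3) : ℂ := (N w k : ℂ)

/-- The linear system `a = (i / √K) N × ∇_{∂_z} N` for the coordinates `a` of `φ⁻¹ φ_z`. -/
def StructureEq (Γ : Fin 3 → Fin 3 → Fin 3 → ℝ) (N : ℂ → Fin 3 → ℝ) (K : ℂ → ℝ)
    (a : ℂ → Fin 3 → ℂ) (w : ℂ) : Prop :=
  a w = (Complex.I / (√(K w) : ℂ)) • (toC N w ⨯₃ nablaZ Γ a (toC N) w)

/-- The integrability equation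
`N × (∇_{∂_z} (K^{-1/2} ∇_{∂_z̄} N) + ∇_{∂_z̄} (K^{-1/2} ∇_{∂_z} N)) = 0`. -/
def IntegrabilityEq (Γ : Fin 3 → Fin 3 → Fin 3 → ℝ) (N : ℂ → Fin 3 → ℝ) (K : ℂ → ℝ)
    (a : ℂ → Fin 3 → ℂ) (w : ℂ) : Prop :=
  toC N w ⨯₃
    (nablaZ Γ a (fun ζ ↦ (1 / (√(K ζ) : ℂ)) • nablaZbar Γ a (toC N) ζ) w +
      nablaZbar Γ a (fun ζ ↦ (1 / (√(K ζ) : ℂ)) • nablaZ Γ a (toC N) ζ) w) = 0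

/-! ## The coefficients of the Gauss map equation

Below `m₁ = μ₁ = μ₂`, `m₃ = μ₃`, `g` is the value of the Gauss map and `x` the value of `K`. -/

/-- `B = 1 + |g|²`. -/
def coefB (g : ℂ) : ℂ := 1 + (Complex.normSq g : ℂ)

/-- `P_{(k₀, k₁, k₂, k₃, k₄)} = ∑ kᵢ |g|^{2 i}`. -/
def coefP (g : ℂ) (k₀ k₁ k₂ k₃ k₄ : ℝ) : ℂ :=
  ((k₀ + k₁ * Complex.normSq g + k₂ * Complex.normSq g ^ 2 + k₃ * Complex.normSq g ^ 3 +
    k₄ * Complex.normSq g ^ 4 : ℝ) : ℂ)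

/-- `P_{(μ₁, 4 μ₃ - 2 μ₁, μ₁, 0, 0)}`. -/
def coefQ (m₁ m₃ : ℝ) (g : ℂ) : ℂ := coefP g m₁ (4 * m₃ - 2 * m₁) m₁ 0 0

/-- The coefficient of `g_z g_z̄`. -/
def coefG1 (m₁ m₃ : ℝ) (g : ℂ) (x : ℝ) : ℂ :=
  let B := coefB g
  let P := coefP g
  let r : ℂ := (Complex.normSq g : ℂ)
  let D : ℂ := B ^ 3 * (B ^ 4 * x ^ 2 + m₁ ^ 2 * ((B - 2) ^ 2 * m₁ + 4 * r * m₃) ^ 2 +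
    2 * x * (P 1 0 6 0 1 * m₁ ^ 2 + P 0 4 (-8) 4 0 * m₁ * m₃ + 8 * r ^ 2 * m₃ ^ 2))
  2 * star g * (B ^ 6 * x ^ 2 +
      2 * B ^ 2 * x * (P 0 4 2 1 1 * m₁ ^ 2 + P 1 (-5) 1 3 0 * m₁ * m₃ + P 0 5 3 0 0 * m₃ ^ 2) +
      16 * r ^ 2 * (B - 2) * m₁ * m₃ ^ 3) / D -
    2 * star g * m₁ * ((1 + 6 * r - r ^ 2 * P 13 (-10) 3 0 1) * m₁ ^ 3 -
      2 * (B - 2) * P (-1) (-6) 18 2 3 * m₁ ^ 2 * m₃ - P 0 2 66 (-18) 14 * m₁ * m₃ ^ 2) / D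

/-- The coefficient of `g_z ḡ_z̄`. -/
def coefG2 (m₁ m₃ : ℝ) (g : ℂ) (x : ℝ) : ℂ :=
  let B := coefB g
  let Q := coefQ m₁ m₃ g
  let s : ℂ := (√x : ℂ)
  2 * Complex.I * g * (B - 2) * (m₃ - m₁) *
      (2 * B ^ 4 * x ^ 2 + B ^ 4 * x * m₁ ^ 2 -
        Complex.I * B ^ 2 * s * (x + m₁ ^ 2) * coefP g m₁ (2 * m₃) m₁ 0 0 - m₁ ^ 2 * Q ^ 2) /
    (B ^ 3 * s * (x + m₁ ^ 2) * (B ^ 4 * x + Q ^ 2))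

/-- The coefficient of `ḡ_z g_z̄`. -/
def coefG3 (m₁ m₃ : ℝ) (g : ℂ) (x : ℝ) : ℂ :=
  let B := coefB g
  let Q := coefQ m₁ m₃ g
  let s : ℂ := (√x : ℂ)
  2 * Complex.I * g * (B - 2) * (m₁ - m₃) *
      (2 * B ^ 4 * x ^ 2 + B ^ 4 * x * m₁ ^ 2 +
        Complex.I * s * B ^ 2 * (x + m₁ ^ 2) * coefP g m₁ (2 * m₃) m₁ 0 0 - m₁ ^ 2 * Q ^ 2) /
    (B ^ 3 * s * (x + m₁ ^ 2) * (B ^ 4 * x + Q ^ 2))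

/-- The coefficient of `ḡ_z ḡ_z̄`. -/
def coefG4 (m₁ m₃ : ℝ) (g : ℂ) (x : ℝ) : ℂ :=
  let B := coefB g
  let Q := coefQ m₁ m₃ g
  (-4) * g ^ 3 * (B - 2) * (m₁ - m₃) ^ 2 *
      (-3 * B ^ 2 * x + coefP g (m₁ ^ 2) (8 * m₁ * m₃ - 6 * m₁ ^ 2) (m₁ ^ 2) 0 0) /
    (B ^ 3 * (x + m₁ ^ 2) * (B ^ 4 * x + Q ^ 2))

/-- The coefficient of `K_z g_z̄`. -/
def coefG5 (m₁ m₃ : ℝ) (g : ℂ) (x : ℝ) : ℂ :=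
  let B := coefB g
  let Q := coefQ m₁ m₃ g
  let s : ℂ := (√x : ℂ)
  (B ^ 2 * x + m₁ * Q) /
    (4 * x * (s + Complex.I * m₁) * (B ^ 2 * s + Complex.I * Q))

/-- The coefficient of `K_z ḡ_z̄`. -/
def coefG6 (m₁ m₃ : ℝ) (g : ℂ) (x : ℝ) : ℂ :=
  let B := coefB g
  let Q := coefQ m₁ m₃ g
  let s : ℂ := (√x : ℂ)
  (-Complex.I) * g ^ 2 * (m₁ - m₃) /
    (s * (s + Complex.I * m₁) * (B ^ 2 * s + Complex.I * Q))

/-- The coefficient of `K_z̄ g_z`, the complex conjugate of `coefG5`. -/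
def coefG7 (m₁ m₃ : ℝ) (g : ℂ) (x : ℝ) : ℂ := star (coefG5 m₁ m₃ g x)

/-- The coefficient of `K_z̄ ḡ_z`: the factor `g ^ 2` of `coefG6` is kept and the other factors
are conjugated. -/
def coefG8 (m₁ m₃ : ℝ) (g : ℂ) (x : ℝ) : ℂ :=
  let B := coefB g
  let Q := coefQ m₁ m₃ g
  let s : ℂ := (√x : ℂ)
  Complex.I * g ^ 2 * (m₁ - m₃) /
    (s * (s - Complex.I * m₁) * (B ^ 2 * s - Complex.I * Q))

/-- The second order equation for the Gauss map `g` and the extrinsic curvature `K`. -/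
def GaussMapEq (m₁ m₃ : ℝ) (g : ℂ → ℂ) (K : ℂ → ℝ) (w : ℂ) : Prop :=
  let gbar : ℂ → ℂ := fun ζ ↦ star (g ζ)
  let Kc : ℂ → ℂ := fun ζ ↦ (K ζ : ℂ)
  dzbar (dz g) w =
    coefG1 m₁ m₃ (g w) (K w) * dz g w * dzbar g w +
    coefG2 m₁ m₃ (g w) (K w) * dz g w * dzbar gbar w +
    coefG3 m₁ m₃ (g w) (K w) * dz gbar w * dzbar g w +
    coefG4 m₁ m₃ (g w) (K w) * dz gbar w * dzbar gbar w +
    coefG5 m₁ m₃ (g w) (K w) * dz Kc w * dzbar g w +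
    coefG6 m₁ m₃ (g w) (K w) * dz Kc w * dzbar gbar w +
    coefG7 m₁ m₃ (g w) (K w) * dzbar Kc w * dz g w +
    coefG8 m₁ m₃ (g w) (K w) * dzbar Kc w * dz gbar w

end LieGauss

end

/-! Let a be the frame coordinates of φ_z, s = √K, n₁ = iμ₁, n₃ = iμ₃. Since μ₁ = μ₂, the connection
term of ∇_z W is (μa) × W with μ = μ₁ Id + (μ₃ - μ₁) e₃e₃ᵀ. The operator iN× acts on the
complexified tangent plane as +1 on ∂N/∂g and as -1 on ∂N/∂ḡ. So, if α, β are the coefficients of a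
in this basis and t = a₃, the structure equation sa = iN × ∇_z N reads (s - n₁)α = g_z + (n₃ - n₁)gt
and (s - n₁)β = -ḡ_z + (n₃ - n₁)ḡt. As t = 2(ḡα + gβ)/B², this gives (B²s - iQ)t = 2(ḡg_z - gḡ_z).
All divisors have positive real part, so a is an explicit function of g, K and the first derivatives
of g (`StructureOn.solve`).

Both halves of the theorem are statements about ∇_z̄ a - ∇_z ā, whose ∂N/∂g coefficient is
`torsion`. For an immersion this field vanishes by the Maurer-Cartan equation
(`IsUnimodularFrame.maurerCartan`), and the structure equation follows from conformality and
orientation (`derivative_eq_cross`). In the formal setting s⁻¹∇_z N = iN × a, and the products ∇_z̄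
N × a, ∇_z N × ā are normal. Hence the tangential part of the integrability expression is iN×
applied to the torsion field (`StructureOn.integrabilityEq_iff`).

It remains to see that the torsion vanishes exactly when (*) holds. Differentiating the solved
system gives torsion = X R + Y R̄, where R is g_{zz̄} minus the right hand side of (*)
(`torsion_eq_residual`). This equation and its conjugate form a linear system for R, R̄ with
determinant |X|² - |Y|² = 4KB⁴ / (|s - n₁|² |B²s - iQ|²), which is not zero
(`normSq_ratX_sub_normSq_ratY`), so the torsion vanishes only if R = 0. -/

noncomputable section

namespace LieGauss

/-! ## The coefficients as rational functions

With `n₁ = i μ₁`, `n₃ = i μ₃`, `s = √K` and `h = ḡ` the coefficients are rational functions of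
`g, h, s, n₁, n₃` over the rationals; conjugation exchanges `g` and `h` and changes the signs of
`n₁` and `n₃`. -/

/-- The polynomial `∑ kᵢ r ^ i`. -/
def ratP (r k₀ k₁ k₂ k₃ k₄ : ℂ) : ℂ := k₀ + k₁ * r + k₂ * r ^ 2 + k₃ * r ^ 3 + k₄ * r ^ 4

/-- `i Q`. -/
def ratQ (n₁ n₃ r : ℂ) : ℂ := n₁ * (1 - r) ^ 2 + 4 * n₃ * r

def ratG1 (n₁ n₃ g h s : ℂ) : ℂ :=
  2 * h * ((1 + g * h) ^ 6 * s ^ 4 -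
      2 * (1 + g * h) ^ 2 * s ^ 2 * (ratP (g * h) 0 4 2 1 1 * n₁ ^ 2 +
        ratP (g * h) 1 (-5) 1 3 0 * n₁ * n₃ + ratP (g * h) 0 5 3 0 0 * n₃ ^ 2) +
      16 * (g * h) ^ 2 * (g * h - 1) * n₁ * n₃ ^ 3 -
      n₁ * ((1 + 6 * (g * h) - (g * h) ^ 2 * ratP (g * h) 13 (-10) 3 0 1) * n₁ ^ 3 -
        2 * (g * h - 1) * ratP (g * h) (-1) (-6) 18 2 3 * n₁ ^ 2 * n₃ -
        ratP (g * h) 0 2 66 (-18) 14 * n₁ * n₃ ^ 2)) /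
    ((1 + g * h) ^ 3 * (s - n₁) * (s + n₁) * ((1 + g * h) ^ 2 * s - ratQ n₁ n₃ (g * h)) *
      ((1 + g * h) ^ 2 * s + ratQ n₁ n₃ (g * h)))

def ratG2 (n₁ n₃ g h s : ℂ) : ℂ :=
  2 * g * (g * h - 1) * (n₃ - n₁) *
      (2 * (1 + g * h) ^ 4 * s ^ 4 - (1 + g * h) ^ 4 * s ^ 2 * n₁ ^ 2 -
        (1 + g * h) ^ 2 * s * (s ^ 2 - n₁ ^ 2) * (n₁ + 2 * n₃ * (g * h) + n₁ * (g * h) ^ 2) -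
        n₁ ^ 2 * ratQ n₁ n₃ (g * h) ^ 2) /
    ((1 + g * h) ^ 3 * s * (s - n₁) * (s + n₁) * ((1 + g * h) ^ 2 * s - ratQ n₁ n₃ (g * h)) *
      ((1 + g * h) ^ 2 * s + ratQ n₁ n₃ (g * h)))

def ratG3 (n₁ n₃ g h s : ℂ) : ℂ :=
  2 * g * (g * h - 1) * (n₁ - n₃) *
      (2 * (1 + g * h) ^ 4 * s ^ 4 - (1 + g * h) ^ 4 * s ^ 2 * n₁ ^ 2 +
        (1 + g * h) ^ 2 * s * (s ^ 2 - n₁ ^ 2) * (n₁ + 2 * n₃ * (g * h) + n₁ * (g * h) ^ 2) -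
        n₁ ^ 2 * ratQ n₁ n₃ (g * h) ^ 2) /
    ((1 + g * h) ^ 3 * s * (s - n₁) * (s + n₁) * ((1 + g * h) ^ 2 * s - ratQ n₁ n₃ (g * h)) *
      ((1 + g * h) ^ 2 * s + ratQ n₁ n₃ (g * h)))

def ratG4 (n₁ n₃ g h s : ℂ) : ℂ :=
  -4 * g ^ 3 * (g * h - 1) * (n₁ - n₃) ^ 2 *
      (3 * (1 + g * h) ^ 2 * s ^ 2 +
        (n₁ ^ 2 + (8 * n₁ * n₃ - 6 * n₁ ^ 2) * (g * h) + n₁ ^ 2 * (g * h) ^ 2)) /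
    ((1 + g * h) ^ 3 * (s - n₁) * (s + n₁) * ((1 + g * h) ^ 2 * s - ratQ n₁ n₃ (g * h)) *
      ((1 + g * h) ^ 2 * s + ratQ n₁ n₃ (g * h)))

def ratG5 (n₁ n₃ g h s : ℂ) : ℂ :=
  ((1 + g * h) ^ 2 * s ^ 2 - n₁ * ratQ n₁ n₃ (g * h)) /
    (4 * s ^ 2 * (s + n₁) * ((1 + g * h) ^ 2 * s + ratQ n₁ n₃ (g * h)))

def ratG6 (n₁ n₃ g h s : ℂ) : ℂ :=
  -(g ^ 2 * (n₁ - n₃)) / (s * (s + n₁) * ((1 + g * h) ^ 2 * s + ratQ n₁ n₃ (g * h)))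

def ratG7 (n₁ n₃ g h s : ℂ) : ℂ :=
  ((1 + g * h) ^ 2 * s ^ 2 - n₁ * ratQ n₁ n₃ (g * h)) /
    (4 * s ^ 2 * (s - n₁) * ((1 + g * h) ^ 2 * s - ratQ n₁ n₃ (g * h)))

def ratG8 (n₁ n₃ g h s : ℂ) : ℂ :=
  g ^ 2 * (n₁ - n₃) / (s * (s - n₁) * ((1 + g * h) ^ 2 * s - ratQ n₁ n₃ (g * h)))

/-- The coefficient of `g_{z z̄}` in the integrability condition. -/
def ratX (n₁ n₃ g h s : ℂ) : ℂ :=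
  (2 * s * ((1 + g * h) ^ 4 * s ^ 2 - ratQ n₁ n₃ (g * h) ^ 2) +
      4 * (n₃ - n₁) * g * h * s * (ratQ n₁ n₃ (g * h) + n₁ * (1 + g * h) ^ 2)) /
    ((s - n₁) * (s + n₁) * ((1 + g * h) ^ 2 * s - ratQ n₁ n₃ (g * h)) *
      ((1 + g * h) ^ 2 * s + ratQ n₁ n₃ (g * h)))

/-- The coefficient of `ḡ_{z z̄}` in the integrability condition. -/
def ratY (n₁ n₃ g h s : ℂ) : ℂ :=
  -(4 * (n₃ - n₁) * g ^ 2 * s * (ratQ n₁ n₃ (g * h) + n₁ * (1 + g * h) ^ 2)) /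
    ((s - n₁) * (s + n₁) * ((1 + g * h) ^ 2 * s - ratQ n₁ n₃ (g * h)) *
      ((1 + g * h) ^ 2 * s + ratQ n₁ n₃ (g * h)))

/-! ### Coefficients of the torsion, one identity per monomial. -/

section Identities

set_option linter.unusedSimpArgs false

/-- The denominators that occur in the coefficients. -/
structure Denoms (n₁ n₃ g h s b u₁ v₁ u₂ v₂ : ℂ) : Prop where
  eq_b : b = 1 + g * h
  eq_u₁ : u₁ = s - n₁
  eq_v₁ : v₁ = s + n₁
  eq_u₂ : u₂ = b ^ 2 * s - ratQ n₁ n₃ (g * h)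
  eq_v₂ : v₂ = b ^ 2 * s + ratQ n₁ n₃ (g * h)
  s_ne : s ≠ 0
  b_ne : b ≠ 0
  u₁_ne : u₁ ≠ 0
  v₁_ne : v₁ ≠ 0
  u₂_ne : u₂ ≠ 0
  v₂_ne : v₂ ≠ 0

variable {n₁ n₃ g h s b u₁ v₁ u₂ v₂ : ℂ}

/-- This is complex conjugation: g and h are exchanged, the imaginary n₁, n₃ change sign, and each u
becomes the corresponding v. -/
theorem Denoms.conj (H : Denoms n₁ n₃ g h s b u₁ v₁ u₂ v₂) :
    Denoms (-n₁) (-n₃) h g s b v₁ u₁ v₂ u₂ where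
  eq_b := by rw [H.eq_b]; ring
  eq_u₁ := by rw [H.eq_v₁]; ring
  eq_v₁ := by rw [H.eq_u₁]; ring
  eq_u₂ := by rw [H.eq_v₂]; unfold ratQ; ring
  eq_v₂ := by rw [H.eq_u₂]; unfold ratQ; ring
  s_ne := H.s_ne
  b_ne := H.b_ne
  u₁_ne := H.v₁_ne
  v₁_ne := H.u₁_ne
  u₂_ne := H.v₂_ne
  v₂_ne := H.u₂_ne

/-- This and the nine identities after it compare the coefficients of one monomial each (S, S', pq,
pq', p'q, p'q', kq, kq', k'p, k'p') in `torsion_eq_residual`. The left sides are what elimination of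
the unknowns produces. -/
theorem coef_second (H : Denoms n₁ n₃ g h s b u₁ v₁ u₂ v₂) :
    (u₁⁻¹ * (1 + 2 * (n₃ - n₁) * g * h * u₂⁻¹)) - (-v₁⁻¹ * (1 - 2 * (n₃ - n₁) * g * h * v₂⁻¹)) =
    ratX n₁ n₃ g h s := by
  have H' := H.conj
  unfold ratX
  -- The denominators are folded into the atoms b, u₁, v₁, u₂, v₂, so that `field_simp` clears them
  -- unexpanded; they are expanded only in the resulting polynomial identity.
  simp only [← H.eq_b, ← H'.eq_b]
  simp only [← H.eq_u₁, ← H.eq_v₁, ← H.eq_u₂, ← H.eq_v₂, ← H'.eq_u₁, ← H'.eq_v₁, ← H'.eq_u₂,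
    ← H'.eq_v₂]
  have := H.s_ne
  have := H.b_ne
  have := H.u₁_ne
  have := H.v₁_ne
  have := H.u₂_ne
  have := H.v₂_ne
  field_simp
  rw [H.eq_u₁, H.eq_v₁, H.eq_u₂, H.eq_v₂, H.eq_b]
  unfold ratQ
  ring

theorem coef_second_conj (H : Denoms n₁ n₃ g h s b u₁ v₁ u₂ v₂) :
    (-2 * (n₃ - n₁) * g ^ 2 * u₂⁻¹ * u₁⁻¹) - (-2 * (n₃ - n₁) * g ^ 2 * v₂⁻¹ * v₁⁻¹) =
    ratY n₁ n₃ g h s := by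
  have H' := H.conj
  unfold ratY
  simp only [← H.eq_b, ← H'.eq_b]
  simp only [← H.eq_u₁, ← H.eq_v₁, ← H.eq_u₂, ← H.eq_v₂, ← H'.eq_u₁, ← H'.eq_v₁, ← H'.eq_u₂,
    ← H'.eq_v₂]
  have := H.s_ne
  have := H.b_ne
  have := H.u₁_ne
  have := H.v₁_ne
  have := H.u₂_ne
  have := H.v₂_ne
  field_simp
  rw [H.eq_u₁, H.eq_v₁, H.eq_u₂, H.eq_v₂, H.eq_b]
  unfold ratQ
  ring

/-- In the conjugate equation p and q' are exchanged, as are q and p'. Thus pq occurs there in the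
term of `ratG4`, which pairs `ratG1` with the conjugate of `ratG4`; `ratG2` and `ratG3` pair with
their own conjugates. -/
theorem coef_pq (H : Denoms n₁ n₃ g h s b u₁ v₁ u₂ v₂) :
    (2 * (n₃ - n₁) * u₁⁻¹ * (h * u₂⁻¹ - g * h * (2 * b * h * (s - n₁) - 4 * (n₃ - n₁) * h) * u₂⁻¹ ^ 2)) - (2 * (n₃ - n₁) * v₁⁻¹ * (h * v₂⁻¹ - g * h * (2 * b * h * (s + n₁) + 4 * (n₃ - n₁) * h) * v₂⁻¹ ^ 2)) -
    2 * h * b⁻¹ * ((u₁⁻¹ * (1 + 2 * (n₃ - n₁) * g * h * u₂⁻¹)) - (-v₁⁻¹ * (1 - 2 * (n₃ - n₁) * g * h * v₂⁻¹))) +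
    2 * (n₃ - n₁) * g * (b - 2) * b⁻¹ ^ 3 *
      ((2 * (n₃ - n₁) * h ^ 2 * u₂⁻¹ * u₁⁻¹) * (-v₁⁻¹ * (1 - 2 * (n₃ - n₁) * g * h * v₂⁻¹)) -
       (u₁⁻¹ * (1 + 2 * (n₃ - n₁) * g * h * u₂⁻¹)) * (2 * (n₃ - n₁) * h ^ 2 * v₂⁻¹ * v₁⁻¹)) =
    -(ratX n₁ n₃ g h s * ratG1 n₁ n₃ g h s + ratY n₁ n₃ g h s * ratG4 (-n₁) (-n₃) h g s) := by
  have H' := H.conj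
  unfold ratX ratY ratG1 ratG4 ratP
  simp only [← H.eq_b, ← H'.eq_b]
  simp only [← H.eq_u₁, ← H.eq_v₁, ← H.eq_u₂, ← H.eq_v₂, ← H'.eq_u₁, ← H'.eq_v₁, ← H'.eq_u₂,
    ← H'.eq_v₂]
  have := H.s_ne
  have := H.b_ne
  have := H.u₁_ne
  have := H.v₁_ne
  have := H.u₂_ne
  have := H.v₂_ne
  field_simp
  rw [H.eq_u₁, H.eq_v₁, H.eq_u₂, H.eq_v₂, H.eq_b]
  unfold ratQ
  ring

theorem coef_pq_bar (H : Denoms n₁ n₃ g h s b u₁ v₁ u₂ v₂) :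
    (2 * (n₃ - n₁) * u₁⁻¹ * (g * u₂⁻¹ - g * h * (2 * b * g * (s - n₁) - 4 * (n₃ - n₁) * g) * u₂⁻¹ ^ 2)) - (-2 * (n₃ - n₁) * v₁⁻¹ * (2 * g * v₂⁻¹ - g ^ 2 * (2 * b * h * (s + n₁) + 4 * (n₃ - n₁) * h) * v₂⁻¹ ^ 2)) +
    2 * h * b⁻¹ * (-2 * (n₃ - n₁) * g ^ 2 * v₂⁻¹ * v₁⁻¹) +
    2 * (n₃ - n₁) * g * (b - 2) * b⁻¹ ^ 3 *
      ((2 * (n₃ - n₁) * h ^ 2 * u₂⁻¹ * u₁⁻¹) * (-2 * (n₃ - n₁) * g ^ 2 * v₂⁻¹ * v₁⁻¹) -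
       (u₁⁻¹ * (1 + 2 * (n₃ - n₁) * g * h * u₂⁻¹)) * (-(-v₁⁻¹ * (1 - 2 * (n₃ - n₁) * g * h * v₂⁻¹)))) =
    -(ratX n₁ n₃ g h s * ratG2 n₁ n₃ g h s + ratY n₁ n₃ g h s * ratG2 (-n₁) (-n₃) h g s) := by
  have H' := H.conj
  unfold ratX ratY ratG2
  simp only [← H.eq_b, ← H'.eq_b]
  simp only [← H.eq_u₁, ← H.eq_v₁, ← H.eq_u₂, ← H.eq_v₂, ← H'.eq_u₁, ← H'.eq_v₁, ← H'.eq_u₂,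
    ← H'.eq_v₂]
  have := H.s_ne
  have := H.b_ne
  have := H.u₁_ne
  have := H.v₁_ne
  have := H.u₂_ne
  have := H.v₂_ne
  field_simp
  rw [H.eq_u₁, H.eq_v₁, H.eq_u₂, H.eq_v₂, H.eq_b]
  unfold ratQ
  ring

theorem coef_p_bar_q (H : Denoms n₁ n₃ g h s b u₁ v₁ u₂ v₂) :
    (-2 * (n₃ - n₁) * u₁⁻¹ * (2 * g * u₂⁻¹ - g ^ 2 * (2 * b * h * (s - n₁) - 4 * (n₃ - n₁) * h) * u₂⁻¹ ^ 2)) - (2 * (n₃ - n₁) * v₁⁻¹ * (g * v₂⁻¹ - g * h * (2 * b * g * (s + n₁) + 4 * (n₃ - n₁) * g) * v₂⁻¹ ^ 2)) -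
    2 * h * b⁻¹ * (-2 * (n₃ - n₁) * g ^ 2 * u₂⁻¹ * u₁⁻¹) +
    2 * (n₃ - n₁) * g * (b - 2) * b⁻¹ ^ 3 *
      ((-(u₁⁻¹ * (1 + 2 * (n₃ - n₁) * g * h * u₂⁻¹))) * (-v₁⁻¹ * (1 - 2 * (n₃ - n₁) * g * h * v₂⁻¹)) -
       (-2 * (n₃ - n₁) * g ^ 2 * u₂⁻¹ * u₁⁻¹) * (2 * (n₃ - n₁) * h ^ 2 * v₂⁻¹ * v₁⁻¹)) =
    -(ratX n₁ n₃ g h s * ratG3 n₁ n₃ g h s + ratY n₁ n₃ g h s * ratG3 (-n₁) (-n₃) h g s) := by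
  have H' := H.conj
  unfold ratX ratY ratG3
  simp only [← H.eq_b, ← H'.eq_b]
  simp only [← H.eq_u₁, ← H.eq_v₁, ← H.eq_u₂, ← H.eq_v₂, ← H'.eq_u₁, ← H'.eq_v₁, ← H'.eq_u₂,
    ← H'.eq_v₂]
  have := H.s_ne
  have := H.b_ne
  have := H.u₁_ne
  have := H.v₁_ne
  have := H.u₂_ne
  have := H.v₂_ne
  field_simp
  rw [H.eq_u₁, H.eq_v₁, H.eq_u₂, H.eq_v₂, H.eq_b]
  unfold ratQ
  ring

theorem coef_p_bar_q_bar (H : Denoms n₁ n₃ g h s b u₁ v₁ u₂ v₂) :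
    (2 * (n₃ - n₁) * u₁⁻¹ * g ^ 2 * (2 * b * g * (s - n₁) - 4 * (n₃ - n₁) * g) * u₂⁻¹ ^ 2) - (2 * (n₃ - n₁) * v₁⁻¹ * g ^ 2 * (2 * b * g * (s + n₁) + 4 * (n₃ - n₁) * g) * v₂⁻¹ ^ 2) +
    2 * (n₃ - n₁) * g * (b - 2) * b⁻¹ ^ 3 *
      ((-(u₁⁻¹ * (1 + 2 * (n₃ - n₁) * g * h * u₂⁻¹))) * (-2 * (n₃ - n₁) * g ^ 2 * v₂⁻¹ * v₁⁻¹) -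
       (-2 * (n₃ - n₁) * g ^ 2 * u₂⁻¹ * u₁⁻¹) * (-(-v₁⁻¹ * (1 - 2 * (n₃ - n₁) * g * h * v₂⁻¹)))) =
    -(ratX n₁ n₃ g h s * ratG4 n₁ n₃ g h s + ratY n₁ n₃ g h s * ratG1 (-n₁) (-n₃) h g s) := by
  have H' := H.conj
  unfold ratX ratY ratG1 ratG4 ratP
  simp only [← H.eq_b, ← H'.eq_b]
  simp only [← H.eq_u₁, ← H.eq_v₁, ← H.eq_u₂, ← H.eq_v₂, ← H'.eq_u₁, ← H'.eq_v₁, ← H'.eq_u₂,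
    ← H'.eq_v₂]
  have := H.s_ne
  have := H.b_ne
  have := H.u₁_ne
  have := H.v₁_ne
  have := H.u₂_ne
  have := H.v₂_ne
  field_simp
  rw [H.eq_u₁, H.eq_v₁, H.eq_u₂, H.eq_v₂, H.eq_b]
  unfold ratQ
  ring

/-- The factor 2s comes from K = s², that is K_z = 2s k. Conjugation exchanges k and k' as well,
which pairs `ratG5` with `ratG8` and `ratG6` with `ratG7`. -/
theorem coef_kq (H : Denoms n₁ n₃ g h s b u₁ v₁ u₂ v₂) :
    -(v₁⁻¹ ^ 2 * (1 - 2 * (n₃ - n₁) * g * h * v₂⁻¹) - 2 * (n₃ - n₁) * v₁⁻¹ * g * h * b ^ 2 * v₂⁻¹ ^ 2) =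
    -2 * s * (ratX n₁ n₃ g h s * ratG5 n₁ n₃ g h s + ratY n₁ n₃ g h s * ratG8 (-n₁) (-n₃) h g s) := by
  have H' := H.conj
  unfold ratX ratY ratG5 ratG8
  simp only [← H.eq_b, ← H'.eq_b]
  simp only [← H.eq_u₁, ← H.eq_v₁, ← H.eq_u₂, ← H.eq_v₂, ← H'.eq_u₁, ← H'.eq_v₁, ← H'.eq_u₂,
    ← H'.eq_v₂]
  have := H.s_ne
  have := H.b_ne
  have := H.u₁_ne
  have := H.v₁_ne
  have := H.u₂_ne
  have := H.v₂_ne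
  field_simp
  rw [H.eq_u₁, H.eq_v₁, H.eq_u₂, H.eq_v₂, H.eq_b]
  unfold ratQ
  ring

theorem coef_kq_bar (H : Denoms n₁ n₃ g h s b u₁ v₁ u₂ v₂) :
    -(2 * (n₃ - n₁) * g ^ 2 * (v₂⁻¹ * v₁⁻¹ ^ 2 + b ^ 2 * v₂⁻¹ ^ 2 * v₁⁻¹)) =
    -2 * s * (ratX n₁ n₃ g h s * ratG6 n₁ n₃ g h s + ratY n₁ n₃ g h s * ratG7 (-n₁) (-n₃) h g s) := by
  have H' := H.conj
  unfold ratX ratY ratG6 ratG7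
  simp only [← H.eq_b, ← H'.eq_b]
  simp only [← H.eq_u₁, ← H.eq_v₁, ← H.eq_u₂, ← H.eq_v₂, ← H'.eq_u₁, ← H'.eq_v₁, ← H'.eq_u₂,
    ← H'.eq_v₂]
  have := H.s_ne
  have := H.b_ne
  have := H.u₁_ne
  have := H.v₁_ne
  have := H.u₂_ne
  have := H.v₂_ne
  field_simp
  rw [H.eq_u₁, H.eq_v₁, H.eq_u₂, H.eq_v₂, H.eq_b]
  unfold ratQ
  ring

theorem coef_k_bar_p (H : Denoms n₁ n₃ g h s b u₁ v₁ u₂ v₂) :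
    (-(u₁⁻¹ ^ 2) * (1 + 2 * (n₃ - n₁) * g * h * u₂⁻¹) - 2 * (n₃ - n₁) * u₁⁻¹ * g * h * b ^ 2 * u₂⁻¹ ^ 2) =
    -2 * s * (ratX n₁ n₃ g h s * ratG7 n₁ n₃ g h s + ratY n₁ n₃ g h s * ratG6 (-n₁) (-n₃) h g s) := by
  have H' := H.conj
  unfold ratX ratY ratG7 ratG6
  simp only [← H.eq_b, ← H'.eq_b]
  simp only [← H.eq_u₁, ← H.eq_v₁, ← H.eq_u₂, ← H.eq_v₂, ← H'.eq_u₁, ← H'.eq_v₁, ← H'.eq_u₂,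
    ← H'.eq_v₂]
  have := H.s_ne
  have := H.b_ne
  have := H.u₁_ne
  have := H.v₁_ne
  have := H.u₂_ne
  have := H.v₂_ne
  field_simp
  rw [H.eq_u₁, H.eq_v₁, H.eq_u₂, H.eq_v₂, H.eq_b]
  unfold ratQ
  ring

theorem coef_k_bar_p_bar (H : Denoms n₁ n₃ g h s b u₁ v₁ u₂ v₂) :
    (2 * (n₃ - n₁) * g ^ 2 * (u₂⁻¹ * u₁⁻¹ ^ 2 + b ^ 2 * u₂⁻¹ ^ 2 * u₁⁻¹)) =
    -2 * s * (ratX n₁ n₃ g h s * ratG8 n₁ n₃ g h s + ratY n₁ n₃ g h s * ratG5 (-n₁) (-n₃) h g s) := by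
  have H' := H.conj
  unfold ratX ratY ratG8 ratG5
  simp only [← H.eq_b, ← H'.eq_b]
  simp only [← H.eq_u₁, ← H.eq_v₁, ← H.eq_u₂, ← H.eq_v₂, ← H'.eq_u₁, ← H'.eq_v₁, ← H'.eq_u₂,
    ← H'.eq_v₂]
  have := H.s_ne
  have := H.b_ne
  have := H.u₁_ne
  have := H.v₁_ne
  have := H.u₂_ne
  have := H.v₂_ne
  field_simp
  rw [H.eq_u₁, H.eq_v₁, H.eq_u₂, H.eq_v₂, H.eq_b]
  unfold ratQ
  ring

end Identities

/-- The right hand side of the equation for the Gauss map, as a function of the first derivatives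
`p = g_z`, `q = g_z̄`, `p' = ḡ_z`, `q' = ḡ_z̄`, `k = (√K)_z`, `k' = (√K)_z̄`. -/
def ratRHS (n₁ n₃ g h s p q p' q' k k' : ℂ) : ℂ :=
  ratG1 n₁ n₃ g h s * p * q + ratG2 n₁ n₃ g h s * p * q' + ratG3 n₁ n₃ g h s * p' * q +
    ratG4 n₁ n₃ g h s * p' * q' + ratG5 n₁ n₃ g h s * (2 * s * k) * q +
    ratG6 n₁ n₃ g h s * (2 * s * k) * q' + ratG7 n₁ n₃ g h s * (2 * s * k') * p +
    ratG8 n₁ n₃ g h s * (2 * s * k') * p'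

/-- Here t = a₃, α and β are the coefficients of a, and S = g_{zz̄}, S' = ḡ_{zz̄}. A suffix c marks
a conjugate, a final b a z̄-derivative and a final z a z-derivative. The hypotheses are the solved
structure equation, its conjugate, and those derivatives of both that enter the torsion. -/
theorem torsion_eq_residual {n₁ n₃ g h s b u₁ v₁ u₂ v₂ : ℂ}
    (H : Denoms n₁ n₃ g h s b u₁ v₁ u₂ v₂)
    {p q p' q' k k' S S' t tb tc tcz α αb αc β βc βcz : ℂ}
    (ht : u₂ * t = 2 * (h * p - g * p'))
    (hα : u₁ * α = p + (n₃ - n₁) * g * t)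
    (hβ : u₁ * β = -p' + (n₃ - n₁) * h * t)
    (htc : v₂ * tc = 2 * (g * q' - h * q))
    (hαc : v₁ * αc = q' - (n₃ - n₁) * h * tc)
    (hβc : v₁ * βc = -q - (n₃ - n₁) * g * tc)
    (htb : u₂ * tb + (b ^ 2 * k' + (2 * b * (s - n₁) - 4 * (n₃ - n₁)) * (q * h + g * q')) * t =
      2 * (q' * p + h * S - q * p' - g * S'))
    (hαb : u₁ * αb + k' * α = S + (n₃ - n₁) * (q * t + g * tb))
    (htcz : v₂ * tcz + (b ^ 2 * k + (2 * b * (s + n₁) + 4 * (n₃ - n₁)) * (p * h + g * p')) * tc =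
      2 * (p * q' + g * S' - p' * q - h * S))
    (hβcz : v₁ * βcz + k * βc = -S - (n₃ - n₁) * (p * tc + g * tcz)) :
    αb - βcz - 2 * h * b⁻¹ * (q * α - p * βc) +
        2 * (n₃ - n₁) * g * (b - 2) * b⁻¹ ^ 3 * (β * βc - α * αc) =
      ratX n₁ n₃ g h s * (S - ratRHS n₁ n₃ g h s p q p' q' k k') +
        ratY n₁ n₃ g h s * (S' - ratRHS (-n₁) (-n₃) h g s q' p' q p k' k) := by
  have hu₁ := mul_inv_cancel₀ H.u₁_ne
  have hv₁ := mul_inv_cancel₀ H.v₁_ne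
  have hu₂ := mul_inv_cancel₀ H.u₂_ne
  have hv₂ := mul_inv_cancel₀ H.v₂_ne
  have solve {u w x y : ℂ} (huw : u * w = 1) (h : u * x = y) : x = w * y := by
    linear_combination (-x) * huw + w * h
  have c₁ := coef_second H
  have c₂ := coef_second_conj H
  have c₃ := coef_pq H
  have c₄ := coef_pq_bar H
  have c₅ := coef_p_bar_q H
  have c₆ := coef_p_bar_q_bar H
  have c₇ := coef_kq H
  have c₈ := coef_kq_bar H
  have c₉ := coef_k_bar_p H
  have c₁₀ := coef_k_bar_p_bar H
  generalize ratX n₁ n₃ g h s = X at *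
  generalize ratY n₁ n₃ g h s = Y at *
  unfold ratRHS
  obtain rfl := solve hu₂ ht
  obtain rfl := solve hv₂ htc
  obtain rfl := solve hu₂ (eq_sub_of_add_eq htb)
  obtain rfl := solve hv₂ (eq_sub_of_add_eq htcz)
  obtain rfl := solve hu₁ hα
  obtain rfl := solve hu₁ hβ
  obtain rfl := solve hv₁ hαc
  obtain rfl := solve hv₁ hβc
  obtain rfl := solve hu₁ (eq_sub_of_add_eq hαb)
  obtain rfl := solve hv₁ (eq_sub_of_add_eq hβcz)
  clear ht htc htb htcz hα hβ hαc hβc hαb hβcz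
  -- With every unknown eliminated and the inverses treated as free variables, both sides are
  -- polynomials in S, S' and the first derivatives, so the ten coefficient identities are summed
  -- with their monomials as weights.
  generalize u₁⁻¹ = i₁ at *
  generalize v₁⁻¹ = j₁ at *
  generalize u₂⁻¹ = i₂ at *
  generalize v₂⁻¹ = j₂ at *
  generalize b⁻¹ = b' at *
  linear_combination S * c₁ + S' * c₂ + p * q * c₃ + p * q' * c₄ + p' * q * c₅ + p' * q' * c₆ +
    k * q * c₇ + k * q' * c₈ + k' * p * c₉ + k' * p' * c₁₀

/-- The determinant of the system for the residual and its conjugate. The numerators combine to a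
multiple of u₁v₁u₂v₂, which cancels one of its two copies in the denominator. -/
theorem normSq_ratX_sub_normSq_ratY {n₁ n₃ g h s b u₁ v₁ u₂ v₂ : ℂ}
    (H : Denoms n₁ n₃ g h s b u₁ v₁ u₂ v₂) :
    ratX n₁ n₃ g h s * ratX (-n₁) (-n₃) h g s - ratY n₁ n₃ g h s * ratY (-n₁) (-n₃) h g s =
      4 * s ^ 2 * b ^ 4 / (u₁ * v₁ * u₂ * v₂) := by
  have H' := H.conj
  unfold ratX ratY
  simp only [← H.eq_b, ← H'.eq_b]
  simp only [← H.eq_u₁, ← H.eq_v₁, ← H.eq_u₂, ← H.eq_v₂, ← H'.eq_u₁, ← H'.eq_v₁, ← H'.eq_u₂,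
    ← H'.eq_v₂]
  have := H.s_ne
  have := H.b_ne
  have := H.u₁_ne
  have := H.v₁_ne
  have := H.u₂_ne
  have := H.v₂_ne
  field_simp
  rw [H.eq_u₁, H.eq_v₁, H.eq_u₂, H.eq_v₂, H.eq_b]
  unfold ratQ
  ring

/-- The system formed by the integrability condition and its conjugate is invertible. -/
theorem eq_zero_of_residual {n₁ n₃ g h s b u₁ v₁ u₂ v₂ R R' : ℂ}
    (H : Denoms n₁ n₃ g h s b u₁ v₁ u₂ v₂)
    (h₁ : ratX n₁ n₃ g h s * R + ratY n₁ n₃ g h s * R' = 0)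
    (h₂ : ratX (-n₁) (-n₃) h g s * R' + ratY (-n₁) (-n₃) h g s * R = 0) : R = 0 := by
  have hd : (ratX n₁ n₃ g h s * ratX (-n₁) (-n₃) h g s -
      ratY n₁ n₃ g h s * ratY (-n₁) (-n₃) h g s) * R = 0 := by
    linear_combination ratX (-n₁) (-n₃) h g s * h₁ - ratY n₁ n₃ g h s * h₂
  rw [normSq_ratX_sub_normSq_ratY H] at hd
  refine (mul_eq_zero.mp hd).resolve_left (div_ne_zero ?_ ?_)
  · exact mul_ne_zero (mul_ne_zero (by norm_num) (pow_ne_zero _ H.s_ne)) (pow_ne_zero _ H.b_ne)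
  · exact mul_ne_zero (mul_ne_zero (mul_ne_zero H.u₁_ne H.v₁_ne) H.u₂_ne) H.v₂_ne

/-! ## Comparison with the coefficients of the Gauss map equation -/

section Comparison

variable (m₁ m₃ : ℝ) (g : ℂ) {s : ℝ}

theorem coefB_eq : coefB g = 1 + g * star g := by
  rw [coefB, Complex.star_def, Complex.mul_conj]

theorem coefP_eq (k₀ k₁ k₂ k₃ k₄ : ℝ) :
    coefP g k₀ k₁ k₂ k₃ k₄ = ratP (g * star g) k₀ k₁ k₂ k₃ k₄ := by
  rw [coefP, ratP, Complex.star_def, Complex.mul_conj]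
  push_cast
  rfl

theorem I_mul_coefQ :
    Complex.I * coefQ m₁ m₃ g = ratQ (Complex.I * m₁) (Complex.I * m₃) (g * star g) := by
  rw [coefQ, coefP_eq, ratP, ratQ]
  push_cast
  ring

/-- As n₁, n₃ are purely imaginary and ratQ is linear in them, the divisors have real part s or B²s,
which is positive. -/
theorem denoms (hs : 0 < s) :
    Denoms (Complex.I * m₁) (Complex.I * m₃) g (star g) s (coefB g) (s - Complex.I * m₁)
      (s + Complex.I * m₁) (coefB g ^ 2 * s - Complex.I * coefQ m₁ m₃ g)
      (coefB g ^ 2 * s + Complex.I * coefQ m₁ m₃ g) := by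
  have hB : coefB g = ((1 + Complex.normSq g : ℝ) : ℂ) := by rw [coefB]; push_cast; rfl
  have hB0 : 0 < 1 + Complex.normSq g := by linarith [Complex.normSq_nonneg g]
  have key (x y : ℝ) (hx : 0 < x) (z : ℂ) (hz : z = x + Complex.I * y) : z ≠ 0 := by
    rintro rfl
    have := congrArg Complex.re hz
    simp at this
    linarith
  exact
    { eq_b := coefB_eq g
      eq_u₁ := rfl
      eq_v₁ := rfl
      eq_u₂ := by rw [I_mul_coefQ]
      eq_v₂ := by rw [I_mul_coefQ]
      s_ne := by exact_mod_cast hs.ne'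
      b_ne := by rw [hB]; exact_mod_cast hB0.ne'
      u₁_ne := key s (-m₁) hs _ (by push_cast; ring)
      v₁_ne := key s m₁ hs _ rfl
      u₂_ne := key ((1 + Complex.normSq g) ^ 2 * s) (-(m₁ * (1 - Complex.normSq g) ^ 2 +
          4 * m₃ * Complex.normSq g)) (by positivity) _ (by
        rw [I_mul_coefQ, hB, ratQ, Complex.star_def, Complex.mul_conj]; push_cast; ring)
      v₂_ne := key ((1 + Complex.normSq g) ^ 2 * s) (m₁ * (1 - Complex.normSq g) ^ 2 +
          4 * m₃ * Complex.normSq g) (by positivity) _ (by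
        rw [I_mul_coefQ, hB, ratQ, Complex.star_def, Complex.mul_conj]; push_cast; ring) }

end Comparison

section Comparison

set_option linter.unusedSimpArgs false

open Complex in
theorem I_pow_reduce : I ^ 5 = I ∧ I ^ 6 = -1 ∧ I ^ 7 = -I ∧ I ^ 8 = 1 := by
  refine ⟨?_, ?_, ?_, ?_⟩ <;> rw [I_pow_eq_pow_mod] <;> norm_num [I_sq, I_pow_three]

variable (m₁ m₃ : ℝ) (g : ℂ) {x : ℝ}

/-- The denominator Δ is the expanded form of B³(x + μ₁²)(B⁴x + Q²), which splits over ℂ into B³(s -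
n₁)(s + n₁)(B²s - iQ)(B²s + iQ). -/
theorem coefG1_eq (hx : 0 ≤ x) :
    coefG1 m₁ m₃ g x = ratG1 (Complex.I * m₁) (Complex.I * m₃) g (star g) (√x : ℝ) := by
  have hs : (x : ℂ) = ((√x : ℝ) : ℂ) ^ 2 := by rw [← Complex.ofReal_pow, Real.sq_sqrt hx]
  simp only [coefG1, coefP_eq, coefB_eq]
  rw [← Complex.mul_conj, ← Complex.star_def, hs, ratG1, ← sub_div]
  generalize ((√x : ℝ) : ℂ) = s
  generalize star g = h
  obtain ⟨h5, h6, h7, h8⟩ := I_pow_reduce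
  congr 1
  · unfold ratP
    push_cast
    ring_nf
    simp only [Complex.I_sq, Complex.I_pow_three, Complex.I_pow_four, h5, h6, h7, h8]
    ring
  · unfold ratQ ratP
    push_cast
    ring_nf
    simp only [Complex.I_sq, Complex.I_pow_three, Complex.I_pow_four, h5, h6, h7, h8]
    ring

theorem coefG2_eq (hx : 0 ≤ x) :
    coefG2 m₁ m₃ g x = ratG2 (Complex.I * m₁) (Complex.I * m₃) g (star g) (√x : ℝ) := by
  have hs : (x : ℂ) = ((√x : ℝ) : ℂ) ^ 2 := by rw [← Complex.ofReal_pow, Real.sq_sqrt hx]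
  simp only [coefG2, coefP_eq, coefB_eq, coefQ]
  rw [hs, ratG2]
  generalize ((√x : ℝ) : ℂ) = s
  generalize star g = h
  obtain ⟨h5, h6, h7, h8⟩ := I_pow_reduce
  congr 1
  · unfold ratQ ratP
    push_cast
    ring_nf
    simp only [Complex.I_sq, Complex.I_pow_three, Complex.I_pow_four, h5, h6, h7, h8]
    ring
  · unfold ratQ ratP
    push_cast
    ring_nf
    simp only [Complex.I_sq, Complex.I_pow_three, Complex.I_pow_four, h5, h6, h7, h8]
    ring

theorem coefG3_eq (hx : 0 ≤ x) :
    coefG3 m₁ m₃ g x = ratG3 (Complex.I * m₁) (Complex.I * m₃) g (star g) (√x : ℝ) := by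
  have hs : (x : ℂ) = ((√x : ℝ) : ℂ) ^ 2 := by rw [← Complex.ofReal_pow, Real.sq_sqrt hx]
  simp only [coefG3, coefP_eq, coefB_eq, coefQ]
  rw [hs, ratG3]
  generalize ((√x : ℝ) : ℂ) = s
  generalize star g = h
  obtain ⟨h5, h6, h7, h8⟩ := I_pow_reduce
  congr 1
  · unfold ratQ ratP
    push_cast
    ring_nf
    simp only [Complex.I_sq, Complex.I_pow_three, Complex.I_pow_four, h5, h6, h7, h8]
    ring
  · unfold ratQ ratP
    push_cast
    ring_nf
    simp only [Complex.I_sq, Complex.I_pow_three, Complex.I_pow_four, h5, h6, h7, h8]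
    ring

theorem coefG4_eq (hx : 0 ≤ x) :
    coefG4 m₁ m₃ g x = ratG4 (Complex.I * m₁) (Complex.I * m₃) g (star g) (√x : ℝ) := by
  have hs : (x : ℂ) = ((√x : ℝ) : ℂ) ^ 2 := by rw [← Complex.ofReal_pow, Real.sq_sqrt hx]
  simp only [coefG4, coefP_eq, coefB_eq, coefQ]
  rw [hs, ratG4]
  generalize ((√x : ℝ) : ℂ) = s
  generalize star g = h
  obtain ⟨h5, h6, h7, h8⟩ := I_pow_reduce
  congr 1
  · unfold ratP
    push_cast
    ring_nf
    simp only [Complex.I_sq, Complex.I_pow_three, Complex.I_pow_four, h5, h6, h7, h8]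
    ring
  · unfold ratQ ratP
    push_cast
    ring_nf
    simp only [Complex.I_sq, Complex.I_pow_three, Complex.I_pow_four, h5, h6, h7, h8]
    ring

theorem coefG5_eq (hx : 0 ≤ x) :
    coefG5 m₁ m₃ g x = ratG5 (Complex.I * m₁) (Complex.I * m₃) g (star g) (√x : ℝ) := by
  have hs : (x : ℂ) = ((√x : ℝ) : ℂ) ^ 2 := by rw [← Complex.ofReal_pow, Real.sq_sqrt hx]
  simp only [coefG5, I_mul_coefQ, ratG5]
  rw [hs, coefB_eq]
  congr 1
  rw [← I_mul_coefQ]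
  linear_combination (m₁ : ℂ) * coefQ m₁ m₃ g * Complex.I_sq

theorem coefG6_eq :
    coefG6 m₁ m₃ g x = ratG6 (Complex.I * m₁) (Complex.I * m₃) g (star g) (√x : ℝ) := by
  simp only [coefG6, I_mul_coefQ, ratG6]
  rw [coefB_eq]
  congr 1
  ring

theorem coefG8_eq :
    coefG8 m₁ m₃ g x = ratG8 (Complex.I * m₁) (Complex.I * m₃) g (star g) (√x : ℝ) := by
  simp only [coefG8, I_mul_coefQ, ratG8]
  rw [coefB_eq]
  congr 1
  ring

theorem star_I_mul (m : ℝ) : star (Complex.I * m) = -(Complex.I * m) := by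
  simp [Complex.star_def]

variable (n₁ n₃ h s : ℂ)

/-- The coefficients of these rational functions are rational numbers, so conjugation passes to the
arguments. -/
theorem star_ratG1 :
    star (ratG1 n₁ n₃ g h s) = ratG1 (star n₁) (star n₃) (star g) (star h) (star s) := by
  simp [ratG1, ratP, ratQ, Complex.star_def]

theorem star_ratG2 :
    star (ratG2 n₁ n₃ g h s) = ratG2 (star n₁) (star n₃) (star g) (star h) (star s) := by
  simp [ratG2, ratQ, Complex.star_def]

theorem star_ratG3 :
    star (ratG3 n₁ n₃ g h s) = ratG3 (star n₁) (star n₃) (star g) (star h) (star s) := by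
  simp [ratG3, ratQ, Complex.star_def]

theorem star_ratG4 :
    star (ratG4 n₁ n₃ g h s) = ratG4 (star n₁) (star n₃) (star g) (star h) (star s) := by
  simp [ratG4, ratQ, Complex.star_def]

theorem star_ratG5 :
    star (ratG5 n₁ n₃ g h s) = ratG5 (star n₁) (star n₃) (star g) (star h) (star s) := by
  simp [ratG5, ratQ, Complex.star_def]

theorem star_ratG6 :
    star (ratG6 n₁ n₃ g h s) = ratG6 (star n₁) (star n₃) (star g) (star h) (star s) := by
  simp [ratG6, ratQ, Complex.star_def]

theorem star_ratG7 :
    star (ratG7 n₁ n₃ g h s) = ratG7 (star n₁) (star n₃) (star g) (star h) (star s) := by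
  simp [ratG7, ratQ, Complex.star_def]

theorem star_ratG8 :
    star (ratG8 n₁ n₃ g h s) = ratG8 (star n₁) (star n₃) (star g) (star h) (star s) := by
  simp [ratG8, ratQ, Complex.star_def]

theorem star_ratX :
    star (ratX n₁ n₃ g h s) = ratX (star n₁) (star n₃) (star g) (star h) (star s) := by
  simp [ratX, ratQ, Complex.star_def]

theorem star_ratY :
    star (ratY n₁ n₃ g h s) = ratY (star n₁) (star n₃) (star g) (star h) (star s) := by
  simp [ratY, ratQ, Complex.star_def]

theorem coefG7_eq (hx : 0 ≤ x) :
    coefG7 m₁ m₃ g x = ratG7 (Complex.I * m₁) (Complex.I * m₃) g (star g) (√x : ℝ) := by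
  rw [coefG7, coefG5_eq m₁ m₃ g hx, star_ratG5, star_I_mul, star_I_mul, star_star, ratG5, ratG7,
    Complex.star_def, Complex.conj_ofReal]
  have hQ : ratQ (-(Complex.I * m₁)) (-(Complex.I * m₃)) (star g * g) =
    -ratQ (Complex.I * m₁) (Complex.I * m₃) (g * star g) := by unfold ratQ; ring
  rw [← Complex.star_def, hQ]
  congr 1 <;> ring

theorem star_ratRHS (p q p' q' k k' : ℂ) :
    star (ratRHS n₁ n₃ g h s p q p' q' k k') =
      ratRHS (star n₁) (star n₃) (star g) (star h) (star s) (star p) (star q) (star p') (star q')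
        (star k) (star k') := by
  simp only [ratRHS, star_add, star_mul', star_ratG1, star_ratG2, star_ratG3, star_ratG4,
    star_ratG5, star_ratG6, star_ratG7, star_ratG8]
  simp [Complex.star_def]

end Comparison

/-! ## Wirtinger derivatives -/

/-- `f` is real differentiable at `w` with `f_z = p` and `f_z̄ = q`. -/
structure HasWirtinger (f : ℂ → ℂ) (p q w : ℂ) : Prop where
  diff : DifferentiableAt ℝ f w
  dz_eq : dz f w = p
  dzbar_eq : dzbar f w = q

namespace HasWirtinger

variable {f f₁ f₂ : ℂ → ℂ} {p q p₁ q₁ p₂ q₂ w c : ℂ}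

theorem of_diff (h : DifferentiableAt ℝ f w) : HasWirtinger f (dz f w) (dzbar f w) w :=
  ⟨h, rfl, rfl⟩

theorem const : HasWirtinger (fun _ ↦ c) 0 0 w := by
  refine ⟨differentiableAt_const _, ?_, ?_⟩ <;> simp [dz, dzbar]

theorem add (h₁ : HasWirtinger f₁ p₁ q₁ w) (h₂ : HasWirtinger f₂ p₂ q₂ w) :
    HasWirtinger (fun ζ ↦ f₁ ζ + f₂ ζ) (p₁ + p₂) (q₁ + q₂) w := by
  refine ⟨h₁.diff.add h₂.diff, ?_, ?_⟩
  · rw [← h₁.dz_eq, ← h₂.dz_eq]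
    simp only [dz, fderiv_fun_add h₁.diff h₂.diff, add_apply]
    ring
  · rw [← h₁.dzbar_eq, ← h₂.dzbar_eq]
    simp only [dzbar, fderiv_fun_add h₁.diff h₂.diff, add_apply]
    ring

theorem mul (h₁ : HasWirtinger f₁ p₁ q₁ w) (h₂ : HasWirtinger f₂ p₂ q₂ w) :
    HasWirtinger (fun ζ ↦ f₁ ζ * f₂ ζ) (p₁ * f₂ w + f₁ w * p₂) (q₁ * f₂ w + f₁ w * q₂) w := by
  refine ⟨h₁.diff.mul h₂.diff, ?_, ?_⟩
  · rw [← h₁.dz_eq, ← h₂.dz_eq]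
    simp only [dz, fderiv_fun_mul h₁.diff h₂.diff, add_apply, smul_apply, smul_eq_mul]
    ring
  · rw [← h₁.dzbar_eq, ← h₂.dzbar_eq]
    simp only [dzbar, fderiv_fun_mul h₁.diff h₂.diff, add_apply, smul_apply, smul_eq_mul]
    ring

theorem const_mul (c : ℂ) (h : HasWirtinger f p q w) :
    HasWirtinger (fun ζ ↦ c * f ζ) (c * p) (c * q) w := by
  simpa using (const (c := c)).mul h

theorem sub (h₁ : HasWirtinger f₁ p₁ q₁ w) (h₂ : HasWirtinger f₂ p₂ q₂ w) :
    HasWirtinger (fun ζ ↦ f₁ ζ - f₂ ζ) (p₁ - p₂) (q₁ - q₂) w := by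
  simpa [sub_eq_add_neg] using h₁.add (h₂.const_mul (-1))

theorem sq (h : HasWirtinger f p q w) :
    HasWirtinger (fun ζ ↦ f ζ ^ 2) (2 * f w * p) (2 * f w * q) w := by
  have := h.mul h
  simp only [← pow_two] at this
  convert this using 1 <;> ring

theorem star (h : HasWirtinger f p q w) :
    HasWirtinger (fun ζ ↦ star (f ζ)) (star q) (star p) w := by
  have hd : HasFDerivAt (fun ζ ↦ Star.star (f ζ))
      ((Complex.conjCLE : ℂ →L[ℝ] ℂ).comp (fderiv ℝ f w)) w :=
    (Complex.conjCLE : ℂ →L[ℝ] ℂ).hasFDerivAt.comp w h.diff.hasFDerivAt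
  refine ⟨hd.differentiableAt, ?_, ?_⟩
  · rw [← h.dzbar_eq, dz, hd.fderiv, dzbar]
    simp [sub_eq_add_neg]
  · rw [← h.dz_eq, dzbar, hd.fderiv, dz]
    simp [sub_eq_add_neg]

theorem congr (h : HasWirtinger f₁ p q w) (he : f₂ =ᶠ[nhds w] f₁) : HasWirtinger f₂ p q w := by
  refine ⟨h.diff.congr_of_eventuallyEq he, ?_, ?_⟩
  · rw [← h.dz_eq, dz, he.fderiv_eq, dz]
  · rw [← h.dzbar_eq, dzbar, he.fderiv_eq, dzbar]

/-- Used to differentiate an identity valid near w: each side is given its derivatives by the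
product rules, and the two results agree. -/
theorem unique (h₁ : HasWirtinger f₁ p₁ q₁ w) (h₂ : HasWirtinger f₂ p₂ q₂ w)
    (he : f₁ =ᶠ[nhds w] f₂) : p₁ = p₂ ∧ q₁ = q₂ := by
  have := h₁.congr he.symm
  exact ⟨this.dz_eq.symm.trans h₂.dz_eq, this.dzbar_eq.symm.trans h₂.dzbar_eq⟩

end HasWirtinger

theorem differentiableAt_dz {f : ℂ → ℂ} {w : ℂ} (h : ContDiffAt ℝ 2 f w) :
    DifferentiableAt ℝ (dz f) w := by
  have h1 : DifferentiableAt ℝ (fderiv ℝ f) w :=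
    (h.fderiv_right (m := 1) (by norm_num)).differentiableAt (by norm_num)
  unfold dz
  fun_prop

theorem differentiableAt_dzbar {f : ℂ → ℂ} {w : ℂ} (h : ContDiffAt ℝ 2 f w) :
    DifferentiableAt ℝ (dzbar f) w := by
  have h1 : DifferentiableAt ℝ (fderiv ℝ f) w :=
    (h.fderiv_right (m := 1) (by norm_num)).differentiableAt (by norm_num)
  unfold dzbar
  fun_prop

theorem dz_dzbar {f : ℂ → ℂ} {w : ℂ} (h : ContDiffAt ℝ 2 f w) :
    dz (dzbar f) w = dzbar (dz f) w := by
  have h1 : DifferentiableAt ℝ (fderiv ℝ f) w :=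
    (h.fderiv_right (m := 1) (by norm_num)).differentiableAt (by norm_num)
  have hsymm : IsSymmSndFDerivAt ℝ f w :=
    h.isSymmSndFDerivAt (by simp)
  have e (v : ℂ) : HasFDerivAt (fun ζ ↦ fderiv ℝ f ζ v)
      ((ContinuousLinearMap.apply ℝ ℂ v).comp (fderiv ℝ (fderiv ℝ f) w)) w :=
    (ContinuousLinearMap.apply ℝ ℂ v).hasFDerivAt.comp w h1.hasFDerivAt
  have hz : HasFDerivAt (dz f) _ w :=
    ((e 1).sub ((e Complex.I).const_mul Complex.I)).mul_const (2⁻¹ : ℂ)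
  have hzb : HasFDerivAt (dzbar f) _ w :=
    ((e 1).add ((e Complex.I).const_mul Complex.I)).mul_const (2⁻¹ : ℂ)
  rw [dz, dzbar, hz.fderiv, hzb.fderiv]
  simp only [smul_apply, add_apply, sub_apply, ContinuousLinearMap.comp_apply,
    ContinuousLinearMap.apply_apply, smul_eq_mul]
  rw [hsymm.eq Complex.I 1]
  ring

/-! ## Vectors in the complex basis adapted to the stereographic projection -/

def plus (x : Fin 3 → ℂ) : ℂ := x 0 + Complex.I * x 1

def minus (x : Fin 3 → ℂ) : ℂ := x 0 - Complex.I * x 1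

/-- The coefficient of `∂N/∂g` in the tangential part of `x`. -/
def holPart (g : ℂ) (x : Fin 3 → ℂ) : ℂ := (plus x - g ^ 2 * minus x + 2 * g * x 2) / 2

/-- The coefficient of `∂N/∂ḡ` in the tangential part of `x`. -/
def antiPart (g : ℂ) (x : Fin 3 → ℂ) : ℂ :=
  (minus x - star g ^ 2 * plus x + 2 * star g * x 2) / 2

/-- The connection term `(μ x) × y`. -/
def levi (m₁ m₃ : ℝ) (x y : Fin 3 → ℂ) : Fin 3 → ℂ :=
  ![(m₁ : ℂ) * x 0, (m₁ : ℂ) * x 1, (m₃ : ℂ) * x 2] ⨯₃ y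

/-- The symbols `Γ` are those of a unimodular frame with `μ₁ = μ₂ = m₁` and `μ₃ = m₃`. -/
def IsMilnor (Γ : Fin 3 → Fin 3 → Fin 3 → ℝ) (m₁ m₃ : ℝ) : Prop :=
  ∀ (x y : Fin 3 → ℂ) (k : Fin 3), ∑ i, ∑ j, x i * y j * (Γ i j k : ℂ) = levi m₁ m₃ x y k

/-- In the coordinates x₁ ± ix₂, x₃ the rotations about the third axis are diagonal, which is the
symmetry left by μ₁ = μ₂. -/
theorem plus_cross (x y : Fin 3 → ℂ) :
    plus (x ⨯₃ y) = Complex.I * (x 2 * plus y - y 2 * plus x) := by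
  simp only [plus, cross_apply, Matrix.cons_val_zero, Matrix.cons_val_one]
  linear_combination (x 1 * y 2 - x 2 * y 1) * Complex.I_sq

theorem minus_cross (x y : Fin 3 → ℂ) :
    minus (x ⨯₃ y) = -Complex.I * (x 2 * minus y - y 2 * minus x) := by
  simp only [minus, cross_apply, Matrix.cons_val_zero, Matrix.cons_val_one]
  linear_combination (x 1 * y 2 - x 2 * y 1) * Complex.I_sq

theorem cross_two (x y : Fin 3 → ℂ) :
    (x ⨯₃ y) 2 = Complex.I / 2 * (plus x * minus y - minus x * plus y) := by
  simp only [plus, minus, cross_apply, Matrix.cons_val]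
  linear_combination (x 0 * y 1 - x 1 * y 0) * Complex.I_sq

section Levi

variable (m₁ m₃ : ℝ)

/-- Both coordinates x₁ ± ix₂ are scaled by the same m₁ under μ; this is where μ₁ = μ₂ enters. -/
theorem plus_levi (x y : Fin 3 → ℂ) :
    plus (levi m₁ m₃ x y) =
      Complex.I * m₃ * x 2 * plus y - Complex.I * m₁ * y 2 * plus x := by
  rw [levi, plus_cross]
  simp [plus]
  ring

theorem minus_levi (x y : Fin 3 → ℂ) :
    minus (levi m₁ m₃ x y) =
      -(Complex.I * m₃ * x 2 * minus y - Complex.I * m₁ * y 2 * minus x) := by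
  rw [levi, minus_cross]
  simp [minus]
  ring

theorem levi_two (x y : Fin 3 → ℂ) :
    levi m₁ m₃ x y 2 =
      Complex.I * m₁ / 2 * (plus x * minus y - minus x * plus y) := by
  rw [levi, cross_two]
  simp [minus, plus]
  ring

end Levi

theorem plus_add (x y : Fin 3 → ℂ) : plus (x + y) = plus x + plus y := by
  simp [plus]; ring

theorem minus_add (x y : Fin 3 → ℂ) : minus (x + y) = minus x + minus y := by
  simp [minus]; ring

theorem plus_smul (c : ℂ) (x : Fin 3 → ℂ) : plus (c • x) = c * plus x := by
  simp [plus]; ring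

theorem minus_smul (c : ℂ) (x : Fin 3 → ℂ) : minus (c • x) = c * minus x := by
  simp [minus]; ring

theorem plus_star (x : Fin 3 → ℂ) : plus (star x) = star (minus x) := by
  simp [plus, minus]

theorem minus_star (x : Fin 3 → ℂ) : minus (star x) = star (plus x) := by
  simp [plus, minus, sub_eq_add_neg]

theorem holPart_star (g : ℂ) (x : Fin 3 → ℂ) : holPart g (star x) = star (antiPart g x) := by
  simp [holPart, antiPart, plus_star, minus_star]

theorem antiPart_star (g : ℂ) (x : Fin 3 → ℂ) : antiPart g (star x) = star (holPart g x) := by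
  simp [holPart, antiPart, plus_star, minus_star]

theorem nablaZ_eq {Γ : Fin 3 → Fin 3 → Fin 3 → ℝ} {m₁ m₃ : ℝ} (hΓ : IsMilnor Γ m₁ m₃)
    (a W : ℂ → Fin 3 → ℂ) (w : ℂ) :
    nablaZ Γ a W w = (fun k ↦ dz (fun ζ ↦ W ζ k) w) + levi m₁ m₃ (a w) (W w) := by
  ext k
  rw [nablaZ, hΓ]
  rfl

theorem nablaZbar_eq {Γ : Fin 3 → Fin 3 → Fin 3 → ℝ} {m₁ m₃ : ℝ} (hΓ : IsMilnor Γ m₁ m₃)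
    (a W : ℂ → Fin 3 → ℂ) (w : ℂ) :
    nablaZbar Γ a W w =
      (fun k ↦ dzbar (fun ζ ↦ W ζ k) w) + levi m₁ m₃ (star (a w)) (W w) := by
  ext k
  rw [nablaZbar]
  simp only [← Pi.star_apply]
  rw [hΓ]
  rfl

/-- A unit vector in terms of its stereographic projection. -/
theorem stereo_param {n : Fin 3 → ℝ} (h1 : ∑ k, n k ^ 2 = 1) (h2 : n 2 ≠ 1) :
    (n 0 + Complex.I * n 1) = 2 * stereo n / (1 + stereo n * star (stereo n)) ∧
    (n 0 - Complex.I * n 1) = 2 * star (stereo n) / (1 + stereo n * star (stereo n)) ∧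
    (n 2 : ℂ) = (stereo n * star (stereo n) - 1) / (1 + stereo n * star (stereo n)) := by
  have hne : (1 - n 2 : ℂ) ≠ 0 := by
    rw [sub_ne_zero]; exact_mod_cast h2.symm
  have hs : star (stereo n) = (n 0 - Complex.I * n 1) / (1 - n 2) := by
    simp [stereo, sub_eq_add_neg]
  have hsum : (n 0 : ℂ) ^ 2 + n 1 ^ 2 + n 2 ^ 2 = 1 := by
    rw [Fin.sum_univ_three] at h1; exact_mod_cast h1
  have hr : stereo n * star (stereo n) = (1 + n 2) / (1 - n 2) := by
    rw [hs, stereo, div_mul_div_comm, div_eq_div_iff (mul_ne_zero hne hne) hne]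
    linear_combination (1 - (n 2 : ℂ)) * hsum - (1 - (n 2 : ℂ)) * n 1 ^ 2 * Complex.I_sq
  have hB : 1 + stereo n * star (stereo n) = 2 / (1 - n 2) := by
    rw [hr]; field_simp; ring
  rw [hB, hr, hs, stereo]
  refine ⟨?_, ?_, ?_⟩ <;> field_simp
  ring

/-- The solution of the structure equation, algebraically. -/
theorem structure_solve {n₁ n₃ g h s b p p' A C E W₁ W₂ W₃ N₁ N₂ N₃ : ℂ}
    (hs : s ≠ 0) (hb0 : b ≠ 0) (hb : b = 1 + g * h)
    (hN₁ : N₁ = 2 * g / b) (hN₂ : N₂ = 2 * h / b) (hN₃ : N₃ = (g * h - 1) / b)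
    (hW₁ : W₁ = 2 * (p - g ^ 2 * p') / b ^ 2 + (n₃ * E * N₁ - n₁ * N₃ * A))
    (hW₂ : W₂ = 2 * (p' - h ^ 2 * p) / b ^ 2 - (n₃ * E * N₂ - n₁ * N₃ * C))
    (hW₃ : W₃ = 2 * (p * h + g * p') / b ^ 2 + n₁ / 2 * (A * N₂ - C * N₁))
    (hA : s * A = N₁ * W₃ - N₃ * W₁) (hC : s * C = N₃ * W₂ - N₂ * W₃)
    (hE : s * E = -(N₁ * W₂ - N₂ * W₁) / 2) :
    h * A + g * C + (g * h - 1) * E = 0 ∧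
    (b ^ 2 * s - ratQ n₁ n₃ (g * h)) * E = 2 * (h * p - g * p') ∧
    (s - n₁) * ((A - g ^ 2 * C + 2 * g * E) / 2) = p + (n₃ - n₁) * g * E ∧
    (s - n₁) * ((C - h ^ 2 * A + 2 * h * E) / 2) = -p' + (n₃ - n₁) * h * E ∧
    h * W₁ + g * W₂ + (g * h - 1) * W₃ = 0 ∧
    (W₁ - g ^ 2 * W₂ + 2 * g * W₃) / 2 = s * ((A - g ^ 2 * C + 2 * g * E) / 2) ∧
    (W₂ - h ^ 2 * W₁ + 2 * h * W₃) / 2 = -(s * ((C - h ^ 2 * A + 2 * h * E) / 2)) := by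
  -- The expression is b times the bilinear product of N and a. It vanishes because sa is a cross
  -- product with N.
  have ht : h * A + g * C + (g * h - 1) * E = 0 := by
    have : s * (h * A + g * C + (g * h - 1) * E) = 0 := by
      have e : s * (h * A + g * C + (g * h - 1) * E) =
        b / 2 * (N₂ * (s * A) + N₁ * (s * C) + 2 * N₃ * (s * E)) := by
        rw [hN₁, hN₂, hN₃]; field_simp
      rw [e, hA, hC, hE]; ring
    exact (mul_eq_zero.mp this).resolve_left hs
  refine ⟨ht, ?_, ?_, ?_, ?_, ?_, ?_⟩
  · have e : (b ^ 2 * s - ratQ n₁ n₃ (g * h)) * E = b ^ 2 * (s * E) - ratQ n₁ n₃ (g * h) * E := by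
      ring
    rw [e, hE, hW₁, hW₂, hN₁, hN₂, hN₃, ratQ]
    field_simp
    rw [hb]
    linear_combination (-n₁ * (g * h - 1) * (1 + g * h)) * ht
  · have e : (s - n₁) * ((A - g ^ 2 * C + 2 * g * E) / 2) =
      (s * A - g ^ 2 * (s * C) + 2 * g * (s * E)) / 2 - n₁ * ((A - g ^ 2 * C + 2 * g * E) / 2) := by
      ring
    rw [e, hA, hC, hE, hW₁, hW₂, hW₃, hN₁, hN₂, hN₃]
    field_simp
    rw [hb]
    ring
  · have e : (s - n₁) * ((C - h ^ 2 * A + 2 * h * E) / 2) =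
      (s * C - h ^ 2 * (s * A) + 2 * h * (s * E)) / 2 - n₁ * ((C - h ^ 2 * A + 2 * h * E) / 2) := by
      ring
    rw [e, hA, hC, hE, hW₁, hW₂, hW₃, hN₁, hN₂, hN₃]
    field_simp
    rw [hb]
    ring

  -- The field W = ∇_z N is also tangential: N_z is orthogonal to N since |N| = 1, and the
  -- connection term is a cross product with N.
  · rw [hW₁, hW₂, hW₃, hN₁, hN₂, hN₃]
    field_simp
    ring
  · have e : s * ((A - g ^ 2 * C + 2 * g * E) / 2) =
      (s * A - g ^ 2 * (s * C) + 2 * g * (s * E)) / 2 := by ring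
    rw [e, hA, hC, hE, hN₁, hN₂, hN₃]
    field_simp
    rw [hb]
    ring
  · have e : s * ((C - h ^ 2 * A + 2 * h * E) / 2) =
      (s * C - h ^ 2 * (s * A) + 2 * h * (s * E)) / 2 := by ring
    rw [e, hA, hC, hE, hN₁, hN₂, hN₃]
    field_simp
    rw [hb]
    ring

/-- A tangential vector in terms of its two coefficients. -/
theorem tangent_eq {g h b A C E : ℂ} (hb0 : b ≠ 0) (hb : b = 1 + g * h)
    (ht : h * A + g * C + (g * h - 1) * E = 0) {α β : ℂ}
    (hα : α = (A - g ^ 2 * C + 2 * g * E) / 2) (hβ : β = (C - h ^ 2 * A + 2 * h * E) / 2) :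
    A = 2 / b ^ 2 * (α - g ^ 2 * β) ∧ C = 2 / b ^ 2 * (β - h ^ 2 * α) ∧
      E = 2 / b ^ 2 * (h * α + g * β) := by
  subst hα hβ
  refine ⟨?_, ?_, ?_⟩
  · field_simp
    rw [hb]
    linear_combination (2 * g) * ht
  · field_simp
    rw [hb]
    linear_combination (2 * h) * ht
  · field_simp
    rw [hb]
    linear_combination (g * h - 1) * ht

/-! ## The structure equation in terms of the Gauss map -/

/-- On the open set `V` the sphere-valued map `N` avoids the pole, `K` is positive, and the
structure equation holds. -/
structure StructureOn (m₁ m₃ : ℝ) (Γ : Fin 3 → Fin 3 → Fin 3 → ℝ) (V : Set ℂ)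
    (N : ℂ → Fin 3 → ℝ) (K : ℂ → ℝ) (a : ℂ → Fin 3 → ℂ) : Prop where
  milnor : IsMilnor Γ m₁ m₃
  isOpen : IsOpen V
  smooth_N : ContDiffOn ℝ 2 N V
  smooth_K : ContDiffOn ℝ 1 K V
  unit : ∀ w ∈ V, ∑ k, N w k ^ 2 = 1
  ne_pole : ∀ w ∈ V, N w 2 ≠ 1
  pos : ∀ w ∈ V, 0 < K w
  eq : ∀ w ∈ V, StructureEq Γ N K a w

theorem HasWirtinger.plus {X : ℂ → Fin 3 → ℂ} {P Q : Fin 3 → ℂ} {w : ℂ}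
    (h : ∀ k, HasWirtinger (fun ζ ↦ X ζ k) (P k) (Q k) w) :
    HasWirtinger (fun ζ ↦ LieGauss.plus (X ζ)) (LieGauss.plus P) (LieGauss.plus Q) w :=
  (h 0).add ((h 1).const_mul Complex.I)

theorem HasWirtinger.minus {X : ℂ → Fin 3 → ℂ} {P Q : Fin 3 → ℂ} {w : ℂ}
    (h : ∀ k, HasWirtinger (fun ζ ↦ X ζ k) (P k) (Q k) w) :
    HasWirtinger (fun ζ ↦ LieGauss.minus (X ζ)) (LieGauss.minus P) (LieGauss.minus Q) w :=
  (h 0).sub ((h 1).const_mul Complex.I)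

/-- The correction is the derivative of `holPart` in its first argument. For tangential X it amounts
to 2ḡ/B times g_z or g_z̄ times the coefficient of X, the Christoffel symbol of the sphere in the
coordinate g. -/
theorem HasWirtinger.holPart {X : ℂ → Fin 3 → ℂ} {P Q : Fin 3 → ℂ} {g : ℂ → ℂ} {p q w : ℂ}
    (h : ∀ k, HasWirtinger (fun ζ ↦ X ζ k) (P k) (Q k) w) (hg : HasWirtinger g p q w) :
    HasWirtinger (fun ζ ↦ LieGauss.holPart (g ζ) (X ζ))
      (LieGauss.holPart (g w) P - p * (g w * LieGauss.minus (X w) - X w 2))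
      (LieGauss.holPart (g w) Q - q * (g w * LieGauss.minus (X w) - X w 2)) w := by
  have h1 := ((((HasWirtinger.plus h).sub (hg.sq.mul (HasWirtinger.minus h))).add
    ((hg.const_mul 2).mul (h 2))).const_mul 2⁻¹)
  have e : (fun ζ ↦ LieGauss.holPart (g ζ) (X ζ)) = fun ζ ↦ 2⁻¹ * (LieGauss.plus (X ζ) -
      g ζ ^ 2 * LieGauss.minus (X ζ) + 2 * g ζ * X ζ 2) := by
    ext ζ; unfold LieGauss.holPart; ring
  rw [e]
  convert h1 using 1 <;> · unfold LieGauss.holPart; ring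

/-- A vector field is differentiable if its components in the complex basis are. -/
theorem differentiableAt_of_plus_minus {X : ℂ → Fin 3 → ℂ} {w : ℂ}
    (h1 : DifferentiableAt ℝ (fun ζ ↦ plus (X ζ)) w)
    (h2 : DifferentiableAt ℝ (fun ζ ↦ minus (X ζ)) w)
    (h3 : DifferentiableAt ℝ (fun ζ ↦ X ζ 2) w) (k : Fin 3) :
    DifferentiableAt ℝ (fun ζ ↦ X ζ k) w := by
  fin_cases k
  · have e : (fun ζ ↦ X ζ 0) = fun ζ ↦ 2⁻¹ * (plus (X ζ) + minus (X ζ)) := by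
      ext ζ; unfold plus minus; ring
    change DifferentiableAt ℝ (fun ζ ↦ X ζ 0) w
    rw [e]
    exact (h1.add h2).const_mul _
  · have e : (fun ζ ↦ X ζ 1) = fun ζ ↦ (-Complex.I / 2) * (plus (X ζ) - minus (X ζ)) := by
      ext ζ; unfold plus minus; linear_combination X ζ 1 * Complex.I_sq
    change DifferentiableAt ℝ (fun ζ ↦ X ζ 1) w
    rw [e]
    exact (h1.sub h2).const_mul _
  · exact h3

theorem star_levi (m₁ m₃ : ℝ) (x y : Fin 3 → ℂ) :
    star (levi m₁ m₃ x y) = levi m₁ m₃ (star x) (star y) := by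
  ext k
  fin_cases k <;> simp [levi, cross_apply]

/-- The connection is real, so conjugation exchanges the covariant derivatives along ∂_z and ∂_z̄.
-/
theorem star_nablaZ {Γ : Fin 3 → Fin 3 → Fin 3 → ℝ} {m₁ m₃ : ℝ} (hΓ : IsMilnor Γ m₁ m₃)
    (a : ℂ → Fin 3 → ℂ) {X Y : ℂ → Fin 3 → ℂ} {w : ℂ}
    (hX : ∀ k, DifferentiableAt ℝ (fun ζ ↦ X ζ k) w) (hY : Y =ᶠ[nhds w] fun ζ ↦ star (X ζ)) :
    star (nablaZ Γ a X w) = nablaZbar Γ a Y w := by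
  rw [nablaZ_eq hΓ, nablaZbar_eq hΓ, star_add, star_levi, hY.eq_of_nhds]
  congr 1
  ext k
  have := ((HasWirtinger.of_diff (hX k)).star.congr (f₂ := fun ζ ↦ Y ζ k)
    (hY.mono fun ζ hζ ↦ congrFun hζ k)).dzbar_eq
  rw [this]
  rfl

namespace StructureOn

variable {m₁ m₃ : ℝ} {Γ : Fin 3 → Fin 3 → Fin 3 → ℝ} {V : Set ℂ}
    {N : ℂ → Fin 3 → ℝ} {K : ℂ → ℝ} {a : ℂ → Fin 3 → ℂ} {w : ℂ}

theorem mem_nhds (H : StructureOn m₁ m₃ Γ V N K a) (hw : w ∈ V) : V ∈ nhds w :=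
  H.isOpen.mem_nhds hw

theorem contDiffAt_N (H : StructureOn m₁ m₃ Γ V N K a) (hw : w ∈ V) (k : Fin 3) :
    ContDiffAt ℝ 2 (fun ζ ↦ toC N ζ k) w := by
  have h1 : ContDiffAt ℝ 2 (fun ζ ↦ N ζ k) w :=
    contDiffAt_pi.mp (H.smooth_N.contDiffAt (H.mem_nhds hw)) k
  exact Complex.ofRealCLM.contDiff.contDiffAt.comp w h1

theorem contDiffAt_stereo (H : StructureOn m₁ m₃ Γ V N K a) (hw : w ∈ V) :
    ContDiffAt ℝ 2 (fun ζ ↦ stereo (N ζ)) w := by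
  have h0 := H.contDiffAt_N hw 0
  have h1 := H.contDiffAt_N hw 1
  have h2 := H.contDiffAt_N hw 2
  have hne : (1 : ℂ) - toC N w 2 ≠ 0 := by
    rw [sub_ne_zero, toC]; exact_mod_cast (H.ne_pole w hw).symm
  have e : (fun ζ ↦ stereo (N ζ)) =
      fun ζ ↦ (toC N ζ 0 + Complex.I * toC N ζ 1) * (1 - toC N ζ 2)⁻¹ := by
    ext ζ
    exact div_eq_mul_inv _ _
  rw [e]
  exact (h0.add (contDiffAt_const.mul h1)).mul ((contDiffAt_const.sub h2).inv hne)

theorem contDiffAt_sqrt (H : StructureOn m₁ m₃ Γ V N K a) (hw : w ∈ V) :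
    ContDiffAt ℝ 1 (fun ζ ↦ ((√(K ζ) : ℝ) : ℂ)) w :=
  Complex.ofRealCLM.contDiff.contDiffAt.comp w
    ((H.smooth_K.contDiffAt (H.mem_nhds hw)).sqrt (H.pos w hw).ne')

theorem denoms (H : StructureOn m₁ m₃ Γ V N K a) (hw : w ∈ V) :
    Denoms (Complex.I * m₁) (Complex.I * m₃) (stereo (N w)) (star (stereo (N w)))
      (√(K w) : ℝ) (coefB (stereo (N w))) ((√(K w) : ℝ) - Complex.I * m₁)
      ((√(K w) : ℝ) + Complex.I * m₁)
      (coefB (stereo (N w)) ^ 2 * (√(K w) : ℝ) - Complex.I * coefQ m₁ m₃ (stereo (N w)))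
      (coefB (stereo (N w)) ^ 2 * (√(K w) : ℝ) + Complex.I * coefQ m₁ m₃ (stereo (N w))) :=
  LieGauss.denoms m₁ m₃ (stereo (N w)) (Real.sqrt_pos.mpr (H.pos w hw))

/-- The `z`-derivative of `N` in terms of the Gauss map. -/
theorem dz_normal (H : StructureOn m₁ m₃ Γ V N K a) (hw : w ∈ V) :
    let g := stereo (N w)
    let b := 1 + g * star g
    let p := dz (fun ζ ↦ stereo (N ζ)) w
    let p' := star (dzbar (fun ζ ↦ stereo (N ζ)) w)
    let D : Fin 3 → ℂ := fun k ↦ dz (fun ζ ↦ toC N ζ k) w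
    plus D = 2 * (p - g ^ 2 * p') / b ^ 2 ∧ minus D = 2 * (p' - star g ^ 2 * p) / b ^ 2 ∧
      D 2 = 2 * (p * star g + g * p') / b ^ 2 := by
  intro g b p p' D
  have hN (k) := HasWirtinger.of_diff ((H.contDiffAt_N hw k).differentiableAt (by norm_num))
  have hg := HasWirtinger.of_diff ((H.contDiffAt_stereo hw).differentiableAt (by norm_num))
  have hb0 : b ≠ 0 := by
    have := (H.denoms hw).b_ne
    rwa [coefB_eq] at this
  have hb : HasWirtinger (fun ζ ↦ 1 + stereo (N ζ) * star (stereo (N ζ))) _ _ w :=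
    (HasWirtinger.const (c := 1)).add (hg.mul hg.star)
  have hb' {ζ : ℂ} (hζ : ζ ∈ V) : 1 + stereo (N ζ) * star (stereo (N ζ)) ≠ 0 := by
    have := (H.denoms hζ).b_ne
    rwa [coefB_eq] at this
  -- The parametrization of N by g is multiplied by b = 1 + gḡ before differentiating, so that only
  -- product rules are needed.
  have h1 := (((HasWirtinger.plus hN).mul hb).unique (hg.const_mul 2) (by
    filter_upwards [H.mem_nhds hw] with ζ hζ
    have := (stereo_param (H.unit ζ hζ) (H.ne_pole ζ hζ)).1
    simp only [plus, toC]
    rw [this, div_mul_cancel₀ _ (hb' hζ)])).1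
  have h2 := (((HasWirtinger.minus hN).mul hb).unique (hg.star.const_mul 2) (by
    filter_upwards [H.mem_nhds hw] with ζ hζ
    have := (stereo_param (H.unit ζ hζ) (H.ne_pole ζ hζ)).2.1
    simp only [minus, toC]
    rw [this, div_mul_cancel₀ _ (hb' hζ)])).1
  have h3 := (((hN 2).mul hb).unique
      ((hg.mul hg.star).sub (HasWirtinger.const (c := 1))) (by
    filter_upwards [H.mem_nhds hw] with ζ hζ
    have := (stereo_param (H.unit ζ hζ) (H.ne_pole ζ hζ)).2.2
    simp only [toC]
    rw [this, div_mul_cancel₀ _ (hb' hζ)])).1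
  obtain ⟨e1, e2, e3⟩ := stereo_param (H.unit w hw) (H.ne_pole w hw)
  have f1 : plus (toC N w) = 2 * g / b := e1
  have f2 : minus (toC N w) = 2 * star g / b := e2
  have f3 : toC N w 2 = (g * star g - 1) / b := e3
  rw [f1] at h1
  rw [f2] at h2
  rw [f3] at h3
  change plus D * b + 2 * g / b * (0 + (p * star g + g * p')) = 2 * p at h1
  change minus D * b + 2 * star g / b * (0 + (p * star g + g * p')) = 2 * p' at h2
  change D 2 * b + (g * star g - 1) / b * (0 + (p * star g + g * p')) =
    p * star g + g * p' - 0 at h3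
  have hbd : b = 1 + g * star g := rfl
  clear_value b p p' D g
  refine ⟨?_, ?_, ?_⟩
  · rw [eq_div_iff (pow_ne_zero 2 hb0)]
    field_simp at h1
    rw [hbd] at h1 ⊢
    linear_combination h1
  · rw [eq_div_iff (pow_ne_zero 2 hb0)]
    field_simp at h2
    rw [hbd] at h2 ⊢
    linear_combination h2
  · rw [eq_div_iff (pow_ne_zero 2 hb0)]
    field_simp at h3
    rw [hbd] at h3 ⊢
    linear_combination h3

/-- The solution of the structure equation, and the resulting formula for `∇_{∂_z} N`. -/
theorem solve (H : StructureOn m₁ m₃ Γ V N K a) (hw : w ∈ V) :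
    let g := stereo (N w)
    let h := star g
    let s : ℂ := (√(K w) : ℝ)
    let p := dz (fun ζ ↦ stereo (N ζ)) w
    let p' := star (dzbar (fun ζ ↦ stereo (N ζ)) w)
    let n₁ := Complex.I * m₁
    let n₃ := Complex.I * m₃
    let W := nablaZ Γ a (toC N) w
    h * plus (a w) + g * minus (a w) + (g * h - 1) * a w 2 = 0 ∧
    ((1 + g * h) ^ 2 * s - ratQ n₁ n₃ (g * h)) * a w 2 = 2 * (h * p - g * p') ∧
    (s - n₁) * holPart g (a w) = p + (n₃ - n₁) * g * a w 2 ∧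
    (s - n₁) * antiPart g (a w) = -p' + (n₃ - n₁) * h * a w 2 ∧
    h * plus W + g * minus W + (g * h - 1) * W 2 = 0 ∧
    holPart g W = s * holPart g (a w) ∧ antiPart g W = -(s * antiPart g (a w)) := by
  intro g h s p p' n₁ n₃ W
  have hden := H.denoms hw
  have hb0 := hden.b_ne
  rw [coefB_eq] at hb0
  obtain ⟨d1, d2, d3⟩ := H.dz_normal hw
  obtain ⟨e1, e2, e3⟩ := stereo_param (H.unit w hw) (H.ne_pole w hw)
  have f1 : plus (toC N w) = 2 * g / (1 + g * h) := e1
  have f2 : minus (toC N w) = 2 * h / (1 + g * h) := e2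
  have f3 : toC N w 2 = (g * h - 1) / (1 + g * h) := e3
  have hs : s ≠ 0 := hden.s_ne
  have ha : s • a w = Complex.I • (toC N w ⨯₃ W) := by
    rw [H.eq w hw, smul_smul]
    congr 1
    exact mul_div_cancel₀ _ hs
  have hA := congrArg plus ha
  have hC := congrArg minus ha
  have hE := congrFun ha 2
  rw [plus_smul, plus_smul, plus_cross] at hA
  rw [minus_smul, minus_smul, minus_cross] at hC
  rw [Pi.smul_apply, Pi.smul_apply, smul_eq_mul, smul_eq_mul, cross_two] at hE
  refine structure_solve (n₁ := n₁) (n₃ := n₃) (s := s) (g := g) (h := h) (p := p) (p' := p')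
    hs hb0 rfl f1 f2 f3 ?_ ?_ ?_ ?_ ?_ ?_
  · change plus (nablaZ Γ a (toC N) w) = _
    rw [nablaZ_eq H.milnor, plus_add, d1, plus_levi]
  · change minus (nablaZ Γ a (toC N) w) = _
    rw [nablaZ_eq H.milnor, minus_add, d2, minus_levi]
    ring
  · change nablaZ Γ a (toC N) w 2 = _
    rw [nablaZ_eq H.milnor, Pi.add_apply, levi_two]
    linear_combination d3
  · rw [hA]
    linear_combination (toC N w 2 * plus W - W 2 * plus (toC N w)) * Complex.I_sq
  · rw [hC]
    linear_combination (-(toC N w 2 * minus W - W 2 * minus (toC N w))) * Complex.I_sq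
  · rw [hE]
    linear_combination
      (plus (toC N w) * minus W - minus (toC N w) * plus W) / 2 * Complex.I_sq

end StructureOn

/-! ### The torsion and the residual of the Gauss map equation. -/

/-- The coefficient of `∂N/∂g` in the torsion `∇_{∂_z̄} a - ∇_{∂_z} ā`. -/
def torsion (m₁ m₃ : ℝ) (g : ℂ → ℂ) (a : ℂ → Fin 3 → ℂ) (w : ℂ) : ℂ :=
  dzbar (fun ζ ↦ holPart (g ζ) (a ζ)) w - dz (fun ζ ↦ star (antiPart (g ζ) (a ζ))) w -
    2 * star (g w) * (coefB (g w))⁻¹ *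
      (dzbar g w * holPart (g w) (a w) - dz g w * star (antiPart (g w) (a w))) +
    2 * (Complex.I * m₃ - Complex.I * m₁) * g w * (coefB (g w) - 2) * (coefB (g w))⁻¹ ^ 3 *
      (antiPart (g w) (a w) * star (antiPart (g w) (a w)) -
        holPart (g w) (a w) * star (holPart (g w) (a w)))

/-- `g_{z z̄}` minus the right hand side of the equation for the Gauss map. -/
def residual (m₁ m₃ : ℝ) (g : ℂ → ℂ) (K : ℂ → ℝ) (w : ℂ) : ℂ :=
  dzbar (dz g) w - ratRHS (Complex.I * m₁) (Complex.I * m₃) (g w) (star (g w)) (√(K w) : ℝ)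
    (dz g w) (dzbar g w) (star (dzbar g w)) (star (dz g w))
    (dz (fun ζ ↦ ((√(K ζ) : ℝ) : ℂ)) w) (dzbar (fun ζ ↦ ((√(K ζ) : ℝ) : ℂ)) w)

namespace StructureOn

variable {m₁ m₃ : ℝ} {Γ : Fin 3 → Fin 3 → Fin 3 → ℝ} {V : Set ℂ}
    {N : ℂ → Fin 3 → ℝ} {K : ℂ → ℝ} {a : ℂ → Fin 3 → ℂ} {w : ℂ}

theorem gaussMapEq_iff (H : StructureOn m₁ m₃ Γ V N K a) (hw : w ∈ V) :
    GaussMapEq m₁ m₃ (fun ζ ↦ stereo (N ζ)) K w ↔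
      residual m₁ m₃ (fun ζ ↦ stereo (N ζ)) K w = 0 := by
  have hg := HasWirtinger.of_diff ((H.contDiffAt_stereo hw).differentiableAt (by norm_num))
  have hs := HasWirtinger.of_diff ((H.contDiffAt_sqrt hw).differentiableAt (by norm_num))
  -- Since K = (√K)² near w, K_z = 2√K (√K)_z; this matches the factors 2 * s * k in `ratRHS`.
  have hK : HasWirtinger (fun ζ ↦ (K ζ : ℂ)) _ _ w := hs.sq.congr (by
    filter_upwards [H.mem_nhds hw] with ζ hζ
    rw [← Complex.ofReal_pow, Real.sq_sqrt (H.pos ζ hζ).le])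
  have hx := (H.pos w hw).le
  rw [GaussMapEq, residual, sub_eq_zero, ratRHS]
  simp only [hK.dz_eq, hK.dzbar_eq, hg.star.dz_eq, hg.star.dzbar_eq, coefG1_eq _ _ _ hx,
    coefG2_eq _ _ _ hx, coefG3_eq _ _ _ hx, coefG4_eq _ _ _ hx, coefG5_eq _ _ _ hx, coefG6_eq,
    coefG7_eq _ _ _ hx, coefG8_eq]

/-- No regularity of a is assumed. It follows from the solved structure equation, which expresses a₃
through g, its first derivatives and √K with a nonvanishing divisor. -/
theorem differentiableAt_a_two (H : StructureOn m₁ m₃ Γ V N K a) (hw : w ∈ V) :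
    DifferentiableAt ℝ (fun ζ ↦ a ζ 2) w := by
  have hg := (H.contDiffAt_stereo hw).differentiableAt (by norm_num)
  have hs := (H.contDiffAt_sqrt hw).differentiableAt (by norm_num)
  have hz := differentiableAt_dz (H.contDiffAt_stereo hw)
  have hzb := differentiableAt_dzbar (H.contDiffAt_stereo hw)
  have hu {ζ : ℂ} (hζ : ζ ∈ V) : (1 + stereo (N ζ) * star (stereo (N ζ))) ^ 2 * (√(K ζ) : ℝ) -
      ratQ (Complex.I * m₁) (Complex.I * m₃) (stereo (N ζ) * star (stereo (N ζ))) ≠ 0 := by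
    have := (H.denoms hζ).u₂_ne
    rwa [I_mul_coefQ, coefB_eq] at this
  have e : (fun ζ ↦ a ζ 2) =ᶠ[nhds w] fun ζ ↦ 2 * (star (stereo (N ζ)) *
      dz (fun ζ ↦ stereo (N ζ)) ζ - stereo (N ζ) * star (dzbar (fun ζ ↦ stereo (N ζ)) ζ)) *
      ((1 + stereo (N ζ) * star (stereo (N ζ))) ^ 2 * (√(K ζ) : ℝ) -
      ratQ (Complex.I * m₁) (Complex.I * m₃) (stereo (N ζ) * star (stereo (N ζ))))⁻¹ := by
    filter_upwards [H.mem_nhds hw] with ζ hζ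
    have := (H.solve hζ).2.1
    rw [← this, mul_comm, inv_mul_cancel_left₀ (hu hζ)]
  refine DifferentiableAt.congr_of_eventuallyEq (DifferentiableAt.mul ?_
    (DifferentiableAt.inv ?_ (hu hw))) e
  · exact ((hg.star.mul hz).sub (hg.mul hzb.star)).const_mul 2
  · have hr := hg.mul hg.star
    refine DifferentiableAt.sub (((hr.const_add 1).pow 2).mul hs) ?_
    unfold ratQ
    exact (((hr.const_sub 1).pow 2).const_mul _).add (hr.const_mul _)

theorem differentiableAt_holPart (H : StructureOn m₁ m₃ Γ V N K a) (hw : w ∈ V) :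
    DifferentiableAt ℝ (fun ζ ↦ holPart (stereo (N ζ)) (a ζ)) w := by
  have hg := (H.contDiffAt_stereo hw).differentiableAt (by norm_num)
  have hs := (H.contDiffAt_sqrt hw).differentiableAt (by norm_num)
  have hz := differentiableAt_dz (H.contDiffAt_stereo hw)
  have ht := H.differentiableAt_a_two hw
  have e : (fun ζ ↦ holPart (stereo (N ζ)) (a ζ)) =ᶠ[nhds w] fun ζ ↦
      (dz (fun ζ ↦ stereo (N ζ)) ζ + (Complex.I * m₃ - Complex.I * m₁) * stereo (N ζ) * a ζ 2) *
        ((√(K ζ) : ℝ) - Complex.I * m₁)⁻¹ := by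
    filter_upwards [H.mem_nhds hw] with ζ hζ
    have := (H.solve hζ).2.2.1
    rw [← this, mul_comm, inv_mul_cancel_left₀ (H.denoms hζ).u₁_ne]
  refine DifferentiableAt.congr_of_eventuallyEq (DifferentiableAt.mul ?_
    (DifferentiableAt.inv ?_ (H.denoms hw).u₁_ne)) e
  · exact hz.add ((hg.const_mul _).mul ht)
  · exact hs.sub_const _

theorem differentiableAt_antiPart (H : StructureOn m₁ m₃ Γ V N K a) (hw : w ∈ V) :
    DifferentiableAt ℝ (fun ζ ↦ antiPart (stereo (N ζ)) (a ζ)) w := by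
  have hg := (H.contDiffAt_stereo hw).differentiableAt (by norm_num)
  have hs := (H.contDiffAt_sqrt hw).differentiableAt (by norm_num)
  have hzb := differentiableAt_dzbar (H.contDiffAt_stereo hw)
  have ht := H.differentiableAt_a_two hw
  have e : (fun ζ ↦ antiPart (stereo (N ζ)) (a ζ)) =ᶠ[nhds w] fun ζ ↦
      (-star (dzbar (fun ζ ↦ stereo (N ζ)) ζ) +
        (Complex.I * m₃ - Complex.I * m₁) * star (stereo (N ζ)) * a ζ 2) *
        ((√(K ζ) : ℝ) - Complex.I * m₁)⁻¹ := by
    filter_upwards [H.mem_nhds hw] with ζ hζ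
    have := (H.solve hζ).2.2.2.1
    rw [← this, mul_comm, inv_mul_cancel_left₀ (H.denoms hζ).u₁_ne]
  refine DifferentiableAt.congr_of_eventuallyEq (DifferentiableAt.mul ?_
    (DifferentiableAt.inv ?_ (H.denoms hw).u₁_ne)) e
  · exact hzb.star.neg.add ((hg.star.const_mul _).mul ht)
  · exact hs.sub_const _

theorem torsion_eq (H : StructureOn m₁ m₃ Γ V N K a) (hw : w ∈ V) :
    let g := stereo (N w)
    let s : ℂ := (√(K w) : ℝ)
    let R := residual m₁ m₃ (fun ζ ↦ stereo (N ζ)) K w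
    torsion m₁ m₃ (fun ζ ↦ stereo (N ζ)) a w =
      ratX (Complex.I * m₁) (Complex.I * m₃) g (star g) s * R +
        ratY (Complex.I * m₁) (Complex.I * m₃) g (star g) s * star R := by
  intro g s R
  have hgd := H.contDiffAt_stereo hw
  have hg := HasWirtinger.of_diff (hgd.differentiableAt (by norm_num))
  have hs := HasWirtinger.of_diff ((H.contDiffAt_sqrt hw).differentiableAt (by norm_num))
  have hp := HasWirtinger.of_diff (differentiableAt_dz hgd)
  have hq := HasWirtinger.of_diff (differentiableAt_dzbar hgd)
  -- By symmetry of second derivatives g_{zz̄} is the only second derivative left in the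
  -- z̄-derivatives of the solved equations, up to conjugation.
  rw [dz_dzbar hgd] at hq
  have ht := HasWirtinger.of_diff (H.differentiableAt_a_two hw)
  have hα := HasWirtinger.of_diff (H.differentiableAt_holPart hw)
  have hβ := HasWirtinger.of_diff (H.differentiableAt_antiPart hw)
  have hs_star : star (fun ζ ↦ ((√(K ζ) : ℝ) : ℂ)) = fun ζ ↦ ((√(K ζ) : ℝ) : ℂ) := by
    ext ζ; simp [Complex.star_def]
  have hss : star s = s := by simp [s, Complex.star_def]
  have hks : star (dz (fun ζ ↦ ((√(K ζ) : ℝ) : ℂ)) w) = dzbar (fun ζ ↦ ((√(K ζ) : ℝ) : ℂ)) w := by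
    have := hs.star.dzbar_eq
    rw [← this]
    congr 1
  have hks' : star (dzbar (fun ζ ↦ ((√(K ζ) : ℝ) : ℂ)) w) = dz (fun ζ ↦ ((√(K ζ) : ℝ) : ℂ)) w := by
    rw [← hks, star_star]
  obtain ⟨-, s2, s3, s4, -⟩ := H.solve hw
  set n₁ := Complex.I * (m₁ : ℂ) with hn₁
  set n₃ := Complex.I * (m₃ : ℂ) with hn₃
  have hn₁s : star n₁ = -n₁ := star_I_mul m₁
  have hn₃s : star n₃ = -n₃ := star_I_mul m₃
  have hr := hg.mul hg.star
  have hb := (HasWirtinger.const (c := 1) (w := w)).add hr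
  -- The solved equations for t, α and β hold near w and are differentiated in z̄, without dividing
  -- first.
  have d2 := (((((hb.sq.mul hs).sub
    (((((HasWirtinger.const (c := 1)).sub hr).sq.const_mul n₁).add
      (hr.const_mul (4 * n₃))))).mul ht).unique
    (((hg.star.mul hp).sub (hg.mul hq.star)).const_mul 2)
    (by
      filter_upwards [H.mem_nhds hw] with ζ hζ
      exact (H.solve hζ).2.1)).2)
  have d3 := ((((hs.sub (HasWirtinger.const (c := n₁))).mul hα).unique
    (hp.add ((hg.const_mul (n₃ - n₁)).mul ht)) (by
      filter_upwards [H.mem_nhds hw] with ζ hζ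
      exact (H.solve hζ).2.2.1)).2)
  have d4 := ((((hs.sub (HasWirtinger.const (c := n₁))).mul hβ).unique
    ((hq.star.const_mul (-1)).add ((hg.star.const_mul (n₃ - n₁)).mul ht)) (by
      filter_upwards [H.mem_nhds hw] with ζ hζ
      have := (H.solve hζ).2.2.2.1
      rw [neg_one_mul]
      exact this)).2)
  have hstar : star R = star (dzbar (dz fun ζ ↦ stereo (N ζ)) w) -
      ratRHS (-n₁) (-n₃) (star g) g s
        (star (dz (fun ζ ↦ stereo (N ζ)) w)) (star (dzbar (fun ζ ↦ stereo (N ζ)) w))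
        (dzbar (fun ζ ↦ stereo (N ζ)) w) (dz (fun ζ ↦ stereo (N ζ)) w)
        (dzbar (fun ζ ↦ ((√(K ζ) : ℝ) : ℂ)) w) (dz (fun ζ ↦ ((√(K ζ) : ℝ) : ℂ)) w) := by
    simp only [R, residual, star_sub, star_ratRHS, star_star, hks, hks', star_I_mul]
    rw [show star ((√(K w) : ℝ) : ℂ) = s from hss]
  rw [hstar, torsion, hβ.star.dz_eq]
  -- Conjugation turns the z̄-derivatives of t and β into the z-derivatives of t̄ and β̄. The
  -- torsion does not contain (ᾱ)_z, so d3 needs no conjugate.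
  have c2 := congrArg star s2
  have c3 := congrArg star s3
  have c4 := congrArg star s4
  have e2 := congrArg star d2
  have e4 := congrArg star d4
  have hden := H.denoms hw
  simp only [ratQ, star_mul', star_sub, star_add, star_pow, star_star, star_neg, star_one,
    star_zero, star_ofNat, hn₁s, hn₃s, hks', Complex.star_def, Complex.conj_ofReal] at c2 c3 c4 e2 e4
  simp only [← Complex.star_def, star_star] at c2 c3 c4 e2 e4
  have hbg : coefB g = 1 + g * star g := coefB_eq g
  simp only [← hn₁, ← hn₃, I_mul_coefQ] at hden
  refine torsion_eq_residual hden (t := a w 2) (tc := star (a w 2)) (αc := star (holPart g (a w)))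
    (tb := dzbar (fun ζ ↦ a ζ 2) w) (tcz := star (dzbar (fun ζ ↦ a ζ 2) w))
    ?_ s3 s4 ?_ ?_ ?_ ?_ ?_ ?_ ?_
  · rw [hbg]; linear_combination s2
  · rw [hbg, ratQ]; linear_combination c2
  · linear_combination c3
  · linear_combination c4
  · rw [hbg]; linear_combination (norm := (unfold ratQ; ring)) d2
  · linear_combination d3
  · rw [hbg, ratQ]; linear_combination e2
  · linear_combination e4

end StructureOn

/-- The cross product with a point of the sphere is determined by the two coefficients of the
tangential part. -/
theorem cross_eq_zero_iff {n : Fin 3 → ℝ} (h1 : ∑ k, n k ^ 2 = 1) (h2 : n 2 ≠ 1)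
    (x : Fin 3 → ℂ) :
    ((fun k ↦ (n k : ℂ)) ⨯₃ x = 0) ↔
      holPart (stereo n) x = 0 ∧ antiPart (stereo n) x = 0 := by
  have hb0 : 1 + stereo n * star (stereo n) ≠ 0 := by
    have := (denoms 0 0 (stereo n) one_pos).b_ne
    rwa [coefB_eq] at this
  obtain ⟨e1, e2, e3⟩ := stereo_param h1 h2
  set y : Fin 3 → ℂ := fun k ↦ (n k : ℂ) with hy
  have f1 : plus y = 2 * stereo n / (1 + stereo n * star (stereo n)) := e1
  have f2 : minus y = 2 * star (stereo n) / (1 + stereo n * star (stereo n)) := e2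
  have f3 : y 2 = (stereo n * star (stereo n) - 1) / (1 + stereo n * star (stereo n)) := e3
  have cp := plus_cross y x
  have cm := minus_cross y x
  have c3 := cross_two y x
  generalize y ⨯₃ x = c at *
  rw [f1, f3] at cp
  rw [f2, f3] at cm
  rw [f1, f2] at c3
  have hI := Complex.I_ne_zero
  unfold holPart antiPart
  constructor
  · rintro rfl
    simp only [plus, minus, Pi.zero_apply, mul_zero, add_zero, sub_zero, zero_eq_mul,
      div_eq_zero_iff, hI, false_or, neg_eq_zero, OfNat.ofNat_ne_zero, or_false] at cp cm c3
    field_simp at cp cm c3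
    simp only [plus, minus] at *
    constructor
    · linear_combination (-1 / 2 : ℂ) * cp - stereo n / 4 * c3
    · linear_combination (-1 / 2 : ℂ) * cm + star (stereo n) / 4 * c3
  · rintro ⟨hh, ha⟩
    have hp : plus c = 0 := by
      rw [cp]
      field_simp
      rw [← mul_right_inj' hb0]
      linear_combination (-2 * Complex.I) * hh - 2 * Complex.I * stereo n ^ 2 * ha
    have hm : minus c = 0 := by
      rw [cm]
      field_simp
      rw [← mul_right_inj' hb0]
      linear_combination 2 * Complex.I * ha + 2 * Complex.I * star (stereo n) ^ 2 * hh
    have h3 : c 2 = 0 := by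
      rw [c3]
      field_simp
      rw [← mul_right_inj' hb0]
      linear_combination 2 * Complex.I * stereo n * ha - 2 * Complex.I * star (stereo n) * hh
    simp only [plus, minus] at hp hm
    ext k
    fin_cases k
    · change c 0 = 0
      linear_combination hp / 2 + hm / 2
    · change c 1 = 0
      rw [← mul_right_inj' hI]
      linear_combination hp / 2 - hm / 2
    · exact h3

/-! ### Torsion, integrability and the Gauss map equation are equivalent. -/

namespace StructureOn

variable {m₁ m₃ : ℝ} {Γ : Fin 3 → Fin 3 → Fin 3 → ℝ} {V : Set ℂ}
    {N : ℂ → Fin 3 → ℝ} {K : ℂ → ℝ} {a : ℂ → Fin 3 → ℂ} {w : ℂ}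

/-- The torsion is X R + Y R̄. Its vanishing and the conjugate equation form an invertible system
for R and R̄. -/
theorem torsion_eq_zero_iff (H : StructureOn m₁ m₃ Γ V N K a) (hw : w ∈ V) :
    torsion m₁ m₃ (fun ζ ↦ stereo (N ζ)) a w = 0 ↔
      GaussMapEq m₁ m₃ (fun ζ ↦ stereo (N ζ)) K w := by
  rw [H.gaussMapEq_iff hw, H.torsion_eq hw]
  constructor
  · intro h
    have h' := congrArg star h
    simp only [star_add, star_mul (ratX _ _ _ _ _), star_mul (ratY _ _ _ _ _), star_ratX, star_ratY,
      star_star, star_zero, star_I_mul] at h'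
    rw [show star ((√(K w) : ℝ) : ℂ) = (√(K w) : ℝ) by simp [Complex.star_def]] at h'
    exact eq_zero_of_residual (H.denoms hw) h (by linear_combination h')
  · intro h
    simp [h]

/-- With F = s⁻¹∇_z N = iN × a, differentiating the cross product leaves iN × (∇_z̄ a - ∇_z ā) plus
normal terms, and iN× fixes the ∂N/∂g coefficient. The computation is carried out in the
coefficients of F and a. -/
theorem integrabilityEq_iff (H : StructureOn m₁ m₃ Γ V N K a) (hw : w ∈ V) :
    IntegrabilityEq Γ N K a w ↔ torsion m₁ m₃ (fun ζ ↦ stereo (N ζ)) a w = 0 := by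
  set F : ℂ → Fin 3 → ℂ := fun ζ ↦ (1 / (√(K ζ) : ℂ)) • nablaZ Γ a (toC N) ζ with hF
  set G : ℂ → Fin 3 → ℂ := fun ζ ↦ (1 / (√(K ζ) : ℂ)) • nablaZbar Γ a (toC N) ζ with hG
  have hg := HasWirtinger.of_diff ((H.contDiffAt_stereo hw).differentiableAt (by norm_num))
  have hα := HasWirtinger.of_diff (H.differentiableAt_holPart hw)
  have hβ := HasWirtinger.of_diff (H.differentiableAt_antiPart hw)
  have hGF : ∀ ζ ∈ V, G ζ = star (F ζ) := by
    intro ζ hζ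
    have hN (k) := (H.contDiffAt_N hζ k).differentiableAt (by norm_num)
    have := star_nablaZ H.milnor a hN (Y := toC N) (by
      filter_upwards with ξ
      ext k
      simp [toC])
    simp only [hG, hF, star_smul, this]
    congr 1
    simp [Complex.star_def]
  have hb0 {ζ : ℂ} (hζ : ζ ∈ V) : 1 + stereo (N ζ) * star (stereo (N ζ)) ≠ 0 := by
    have := (H.denoms hζ).b_ne
    rwa [coefB_eq] at this
  -- These are the coordinates of F = iN × a: the coefficient of ∂N/∂g is that of a, the coefficient
  -- of ∂N/∂ḡ is its negative.
  have hsol : ∀ ζ ∈ V,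
      plus (F ζ) = 2 / (1 + stereo (N ζ) * star (stereo (N ζ))) ^ 2 *
        (holPart (stereo (N ζ)) (a ζ) + stereo (N ζ) ^ 2 * antiPart (stereo (N ζ)) (a ζ)) ∧
      minus (F ζ) = 2 / (1 + stereo (N ζ) * star (stereo (N ζ))) ^ 2 *
        (-antiPart (stereo (N ζ)) (a ζ) -
          star (stereo (N ζ)) ^ 2 * holPart (stereo (N ζ)) (a ζ)) ∧
      F ζ 2 = 2 / (1 + stereo (N ζ) * star (stereo (N ζ))) ^ 2 *
        (star (stereo (N ζ)) * holPart (stereo (N ζ)) (a ζ) -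
          stereo (N ζ) * antiPart (stereo (N ζ)) (a ζ)) ∧
      holPart (stereo (N ζ)) (F ζ) = holPart (stereo (N ζ)) (a ζ) ∧
      antiPart (stereo (N ζ)) (F ζ) = -antiPart (stereo (N ζ)) (a ζ) := by
    intro ζ hζ
    obtain ⟨-, -, -, -, s5, s6, s7⟩ := H.solve hζ
    have hs := (H.denoms hζ).s_ne
    have t1 : holPart (stereo (N ζ)) (F ζ) = holPart (stereo (N ζ)) (a ζ) := by
      rw [← mul_right_inj' hs, ← s6]
      simp only [hF, holPart, plus_smul, minus_smul, Pi.smul_apply, smul_eq_mul]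
      field_simp
    have t2 : antiPart (stereo (N ζ)) (F ζ) = -antiPart (stereo (N ζ)) (a ζ) := by
      rw [← mul_right_inj' hs, mul_neg, ← s7]
      simp only [hF, antiPart, plus_smul, minus_smul, Pi.smul_apply, smul_eq_mul]
      field_simp
    have t3 : star (stereo (N ζ)) * plus (F ζ) + stereo (N ζ) * minus (F ζ) +
        (stereo (N ζ) * star (stereo (N ζ)) - 1) * F ζ 2 = 0 := by
      simp only [hF, plus_smul, minus_smul, Pi.smul_apply, smul_eq_mul]
      linear_combination (1 / (√(K ζ) : ℂ)) * s5
    obtain ⟨e1, e2, e3⟩ := tangent_eq (hb0 hζ) rfl t3 t1.symm t2.symm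
    refine ⟨?_, ?_, ?_, t1, t2⟩
    · rw [e1]; ring
    · rw [e2]
    · rw [e3]; ring
  have hden := H.denoms hw
  have hB {ζ : ℂ} (hζ : ζ ∈ V) : (1 + stereo (N ζ) * star (stereo (N ζ))) ^ 2 ≠ 0 :=
    pow_ne_zero _ (hb0 hζ)
  have hF_diff : ∀ k, DifferentiableAt ℝ (fun ζ ↦ F ζ k) w := by
    have hb : DifferentiableAt ℝ
        (fun ζ ↦ 2 * ((1 + stereo (N ζ) * star (stereo (N ζ))) ^ 2)⁻¹) w :=
      ((((hg.diff.mul hg.star.diff).const_add 1).pow 2).inv (hB hw)).const_mul 2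
    refine differentiableAt_of_plus_minus ?_ ?_ ?_
    · refine (hb.mul (hα.diff.add ((hg.diff.pow 2).mul hβ.diff))).congr_of_eventuallyEq ?_
      filter_upwards [H.mem_nhds hw] with ζ hζ
      exact (hsol ζ hζ).1
    · refine (hb.mul (hβ.diff.neg.sub ((hg.star.diff.pow 2).mul hα.diff))).congr_of_eventuallyEq ?_
      filter_upwards [H.mem_nhds hw] with ζ hζ
      exact (hsol ζ hζ).2.1
    · refine (hb.mul ((hg.star.diff.mul hα.diff).sub (hg.diff.mul hβ.diff))).congr_of_eventuallyEq ?_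
      filter_upwards [H.mem_nhds hw] with ζ hζ
      exact (hsol ζ hζ).2.2.1
  have hFk (k) := HasWirtinger.of_diff (hF_diff k)
  have hGe : G =ᶠ[nhds w] fun ζ ↦ star (F ζ) := by
    filter_upwards [H.mem_nhds hw] with ζ hζ using hGF ζ hζ
  have hFe : F =ᶠ[nhds w] fun ζ ↦ star (G ζ) := by
    filter_upwards [H.mem_nhds hw] with ζ hζ
    rw [hGF ζ hζ, star_star]
  have hGk (k) : HasWirtinger (fun ζ ↦ G ζ k) _ _ w :=
    (hFk k).star.congr (hGe.mono fun ζ hζ ↦ congrFun hζ k)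
  have dF := ((HasWirtinger.holPart hFk hg).unique hα (by
    filter_upwards [H.mem_nhds hw] with ζ hζ
    exact (hsol ζ hζ).2.2.2.1)).2
  have dG := ((HasWirtinger.holPart hGk hg).unique (hβ.star.const_mul (-1)) (by
    filter_upwards [H.mem_nhds hw] with ζ hζ
    rw [hGF ζ hζ, holPart_star, (hsol ζ hζ).2.2.2.2]
    simp)).1
  -- The integrability expression is a real vector, its two terms being conjugate to each other.
  have hV : star (nablaZ Γ a G w + nablaZbar Γ a F w) = nablaZ Γ a G w + nablaZbar Γ a F w := by
    have e1 := star_nablaZ H.milnor a (fun k ↦ (hGk k).diff) hFe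
    rw [star_add, e1, ← e1, star_star, add_comm]
  have hmain : holPart (stereo (N w)) (nablaZ Γ a G w + nablaZbar Γ a F w) =
      torsion m₁ m₃ (fun ζ ↦ stereo (N ζ)) a w := by
    obtain ⟨F1, F2, F3, -, -⟩ := hsol w hw
    have G1 : plus (G w) = star (minus (F w)) := by rw [hGF w hw, plus_star]
    have G2 : minus (G w) = star (plus (F w)) := by rw [hGF w hw, minus_star]
    have G3 : G w 2 = star (F w 2) := by rw [hGF w hw]; rfl
    obtain ⟨s1, -⟩ := H.solve hw
    obtain ⟨a1, a2, a3⟩ := tangent_eq (hb0 hw) rfl s1 rfl rfl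
    change plus (a w) = _ * (holPart (stereo (N w)) (a w) - _ *
      antiPart (stereo (N w)) (a w)) at a1
    change minus (a w) = _ * (antiPart (stereo (N w)) (a w) - _ *
      holPart (stereo (N w)) (a w)) at a2
    change a w 2 = _ * (_ * holPart (stereo (N w)) (a w) + _ *
      antiPart (stereo (N w)) (a w)) at a3
    have b1 : plus (star (a w)) = _ := plus_star _
    have b2 : minus (star (a w)) = _ := minus_star _
    have b3 : star (a w) 2 = star (a w 2) := rfl
    have hdz : (fun k ↦ dz (fun ζ ↦ G ζ k) w) = fun k ↦ star (dzbar (fun ζ ↦ F ζ k) w) := by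
      ext k; exact (hGk k).dz_eq
    have hadd (x y : Fin 3 → ℂ) : holPart (stereo (N w)) (x + y) =
        holPart (stereo (N w)) x + holPart (stereo (N w)) y := by
      simp only [holPart, plus_add, minus_add, Pi.add_apply]; ring
    have hlevi (x y : Fin 3 → ℂ) : holPart (stereo (N w)) (levi m₁ m₃ x y) =
        (Complex.I * m₃ * x 2 * (plus y + stereo (N w) ^ 2 * minus y) -
          Complex.I * m₁ * y 2 * (plus x + stereo (N w) ^ 2 * minus x) +
          stereo (N w) * Complex.I * m₁ * (plus x * minus y - minus x * plus y)) / 2 := by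
      rw [holPart, plus_levi, minus_levi, levi_two]; ring
    rw [nablaZ_eq H.milnor, nablaZbar_eq H.milnor, torsion, hdz, hadd, hadd, hadd, hlevi, hlevi,
      b1, b2, b3]
    simp only [hβ.star.dz_eq]
    rw [← hβ.dzbar_eq] at dG
    simp only [G1, G2, G3, F1, F2, F3, a1, a2, a3] at dF dG ⊢
    rw [coefB_eq]
    have hb := hb0 hw
    simp only [star_mul', star_sub, star_add, star_neg, star_pow, star_star, star_one,
      star_div₀, star_ofNat] at dG ⊢
    have hbc : 1 + star (stereo (N w)) * stereo (N w) = 1 + stereo (N w) * star (stereo (N w)) := by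
      ring
    simp only [hbc] at dG ⊢
    generalize holPart (stereo (N w)) (fun k ↦ star (dzbar (fun ζ ↦ F ζ k) w)) = x at *
    generalize holPart (stereo (N w)) (fun k ↦ dzbar (fun ζ ↦ F ζ k) w) = y at *
    -- The remaining identity is rational, and each conjugate becomes a variable of its own, so
    -- `field_simp` and `ring` can decide it.
    linear_combination (norm := skip) dF + dG
    generalize dzbar (fun ζ ↦ holPart (stereo (N ζ)) (a ζ)) w = u1
    generalize dzbar (fun ζ ↦ antiPart (stereo (N ζ)) (a ζ)) w = u2
    generalize holPart (stereo (N w)) (a w) = α at *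
    generalize antiPart (stereo (N w)) (a w) = β at *
    generalize star α = α'
    generalize star β = β'
    generalize dz (fun ζ ↦ stereo (N ζ)) w = p
    generalize dzbar (fun ζ ↦ stereo (N ζ)) w = q
    generalize star (stereo (N w)) = h at *
    generalize stereo (N w) = g at *
    clear_value F G
    clear * - hb
    field_simp
    ring
  change toC N w ⨯₃ (nablaZ Γ a G w + nablaZbar Γ a F w) = 0 ↔ _
  refine (cross_eq_zero_iff (H.unit w hw) (H.ne_pole w hw) _).trans ?_
  -- Because the vector is real, its ∂N/∂ḡ coefficient is the conjugate of its ∂N/∂g coefficient, so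
  -- the two vanishing conditions coincide.
  rw [← hmain, ← hV, antiPart_star, hV, star_eq_zero, and_self]

end StructureOn

/-! ### Left invariant orthonormal frames and their connection. -/

section Frame

variable {M : Type*} [TopologicalSpace M] [ChartedSpace R3 M] [Group M]

theorem lie_swap (u v : GroupLieAlgebra (𝓡 3) M) : ⁅u, v⁆ = -⁅v, u⁆ := by
  rw [GroupLieAlgebra.bracket_def, GroupLieAlgebra.bracket_def, VectorField.mlieBracket_swap_apply]

theorem lie_self_eq (u : GroupLieAlgebra (𝓡 3) M) : ⁅u, u⁆ = 0 := by
  rw [GroupLieAlgebra.bracket_def, VectorField.mlieBracket_self]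
  rfl

variable [RiemannianBundle (fun q : M ↦ TangentSpace (𝓡 3) q)]

theorem lieInner_smul_left (r : ℝ) (u v : GroupLieAlgebra (𝓡 3) M) :
    lieInner (r • u) v = r * lieInner u v :=
  real_inner_smul_left (F := TangentSpace (𝓡 3) (1 : M)) u v r

theorem lieInner_neg_left (u v : GroupLieAlgebra (𝓡 3) M) :
    lieInner (-u) v = -lieInner u v :=
  inner_neg_left (E := TangentSpace (𝓡 3) (1 : M)) u v

theorem lieInner_zero_left (v : GroupLieAlgebra (𝓡 3) M) : lieInner 0 v = 0 :=
  inner_zero_left (E := TangentSpace (𝓡 3) (1 : M)) v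

theorem inner_mulInvariantVectorField (hM : IsLeftInvariantMetric M)
    (u v : GroupLieAlgebra (𝓡 3) M) (q : M) :
    (inner ℝ (mulInvariantVectorField u q : TangentSpace (𝓡 3) q)
      (mulInvariantVectorField v q) : ℝ) = lieInner u v := by
  rw [lieInner, ← hM q 1 u v]
  -- Left translation by q sends 1 to q * 1, which equals q only propositionally, so the inner
  -- product is transported between the two base points.
  have key : ∀ (x y : M) (_ : x = y) (u v : R3),
      @inner ℝ (TangentSpace (𝓡 3) x) _ u v = @inner ℝ (TangentSpace (𝓡 3) y) _ u v := by
    rintro x _ rfl u v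
    rfl
  exact key _ _ (mul_one q).symm _ _

variable {e : Fin 3 → GroupLieAlgebra (𝓡 3) M} {c : Fin 3 → ℝ}

namespace IsUnimodularFrame

/-- Milnor's formula ∇_{Eᵢ} Eⱼ = μᵢ Eᵢ × Eⱼ, from Koszul's formula and the brackets. The equality of
the first two entries of `mu` means c₁ = c₂. -/
theorem isMilnor (he : IsUnimodularFrame e c) (hμ : mu c 0 = mu c 1) :
    IsMilnor (christoffel e) (mu c 0) (mu c 2) := by
  have h21 : ⁅e 2, e 1⁆ = -(c 0 • e 0) := by rw [lie_swap, he.lie_two_three]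
  have h02 : ⁅e 0, e 2⁆ = -(c 1 • e 1) := by rw [lie_swap, he.lie_three_one]
  have h10 : ⁅e 1, e 0⁆ = -(c 2 • e 2) := by rw [lie_swap, he.lie_one_two]
  have hc : (c 0 : ℂ) = c 1 := by
    have : c 0 = c 1 := by
      simp only [mu, Matrix.cons_val_zero, Matrix.cons_val_one] at hμ; linarith
    exact_mod_cast this
  intro x y k
  have hm0 : ((mu c 0 : ℝ) : ℂ) = (-c 0 + c 1 + c 2) / 2 := by simp [mu]
  have hm2 : ((mu c 2 : ℝ) : ℂ) = (c 0 + c 1 - c 2) / 2 := by simp [mu]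
  simp only [Fin.sum_univ_three, christoffel]
  fin_cases k <;>
  · simp [lie_self_eq, h21, h02, h10, he.lie_two_three, he.lie_three_one, he.lie_one_two,
      lieInner_smul_left, lieInner_neg_left, lieInner_zero_left, he.orthonormal, levi, cross_apply,
      hm0, hm2, hc]
    try ring

theorem inner_frame (hM : IsLeftInvariantMetric M) (he : IsUnimodularFrame e c) (q : M)
    (i j : Fin 3) :
    inner ℝ (frame e i q) (frame e j q) = if i = j then (1 : ℝ) else 0 := by
  rw [← he.orthonormal i j]
  exact inner_mulInvariantVectorField hM (e i) (e j) q

theorem sum_inner_frame (hM : IsLeftInvariantMetric M) (he : IsUnimodularFrame e c) (q : M)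
    (W : TangentSpace (𝓡 3) q) :
    ∑ k, (inner ℝ W (frame e k q) : ℝ) • frame e k q = W := by
  have ho : Orthonormal ℝ (fun k ↦ frame e k q) := by
    rw [orthonormal_iff_ite]
    exact fun i j ↦ he.inner_frame hM q i j
  have hcard : Fintype.card (Fin 3) = Module.finrank ℝ (TangentSpace (𝓡 3) q) := by
    have : Module.finrank ℝ R3 = 3 := by simp
    rw [Fintype.card_fin]
    exact this.symm
  have hspan : ⊤ ≤ Submodule.span ℝ (Set.range fun k ↦ frame e k q) := by
    have : FiniteDimensional ℝ (TangentSpace (𝓡 3) q) :=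
      inferInstanceAs (FiniteDimensional ℝ R3)
    exact (ho.linearIndependent.span_eq_top_of_card_eq_finrank' hcard).ge
  have := (OrthonormalBasis.mk ho hspan).sum_repr W
  conv_rhs => rw [← this]
  refine Finset.sum_congr rfl fun k _ ↦ ?_
  rw [OrthonormalBasis.repr_apply_apply, OrthonormalBasis.coe_mk, real_inner_comm]

theorem inner_eq_sum (hM : IsLeftInvariantMetric M) (he : IsUnimodularFrame e c) (q : M)
    (v W : TangentSpace (𝓡 3) q) :
    inner ℝ v W = ∑ k, (inner ℝ v (frame e k q) : ℝ) * inner ℝ W (frame e k q) := by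
  conv_lhs => rw [← he.sum_inner_frame hM q W]
  rw [inner_sum]
  refine Finset.sum_congr rfl fun k _ ↦ ?_
  rw [real_inner_smul_right, mul_comm]

end IsUnimodularFrame

end Frame

/-- The hypotheses hold away from the pole if they hold for a map into the whole sphere. -/
theorem structureOn_of_contDiffOn {Γ : Fin 3 → Fin 3 → Fin 3 → ℝ} {m₁ m₃ : ℝ}
    (hΓ : IsMilnor Γ m₁ m₃) {U : Set ℂ} {N : ℂ → Fin 3 → ℝ} {K : ℂ → ℝ} {a : ℂ → Fin 3 → ℂ}
    (hU : IsOpen U) (hN : ContDiffOn ℝ ∞ N U) (hK : ContDiffOn ℝ ∞ K U)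
    (h1 : ∀ w ∈ U, ∑ k, N w k ^ 2 = 1) (hpos : ∀ w ∈ U, 0 < K w)
    (heq : ∀ w ∈ U, StructureEq Γ N K a w) :
    StructureOn m₁ m₃ Γ {w ∈ U | N w 2 ≠ 1} N K a where
  milnor := hΓ
  isOpen := by
    have hc : ContinuousOn (fun w ↦ N w 2) U :=
      (continuous_apply 2).comp_continuousOn hN.continuousOn
    exact hc.isOpen_inter_preimage hU isOpen_compl_singleton
  smooth_N := (hN.mono fun w hw ↦ hw.1).of_le (by norm_cast)
  smooth_K := (hK.mono fun w hw ↦ hw.1).of_le (by norm_cast)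
  unit w hw := h1 w hw.1
  ne_pole w hw := hw.2
  pos w hw := hpos w hw.1
  eq w hw := heq w hw.1

/-! ## The structure equation of Maurer and Cartan along a map -/

section MaurerCartan

open Filter Topology VectorField

/-- The derivatives of a map, expressed in a frame of vector fields, satisfy the structure
equation of the frame. -/
theorem sum_fderiv_sub_eq_lieBracket {E : Type*} [NormedAddCommGroup E] [NormedSpace ℝ E]
    {ι : Type*} [Fintype ι] {F : ℂ → E} {A B : ℂ → ι → ℝ} {X : ι → E → E} {v v' w : ℂ}
    (hF : ContDiffAt ℝ 2 F w)
    (hA : ∀ i, DifferentiableAt ℝ (fun ζ ↦ A ζ i) w)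
    (hB : ∀ i, DifferentiableAt ℝ (fun ζ ↦ B ζ i) w)
    (hX : ∀ i, DifferentiableAt ℝ (X i) (F w))
    (hv : ∀ᶠ ζ in 𝓝 w, fderiv ℝ F ζ v = ∑ i, A ζ i • X i (F ζ))
    (hv' : ∀ᶠ ζ in 𝓝 w, fderiv ℝ F ζ v' = ∑ i, B ζ i • X i (F ζ)) :
    ∑ i, (fderiv ℝ (fun ζ ↦ A ζ i) w v' - fderiv ℝ (fun ζ ↦ B ζ i) w v) • X i (F w) =
      ∑ i, ∑ j, (A w i * B w j) • lieBracket ℝ (X i) (X j) (F w) := by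
  have h1 : DifferentiableAt ℝ (fderiv ℝ F) w :=
    (hF.fderiv_right (m := 1) (by norm_num)).differentiableAt (by norm_num)
  have hFd : DifferentiableAt ℝ F w := hF.differentiableAt (by norm_num)
  have hsymm : IsSymmSndFDerivAt ℝ F w := hF.isSymmSndFDerivAt (by simp)
  have key {C : ℂ → ι → ℝ} {u u' : ℂ} (hC : ∀ i, DifferentiableAt ℝ (fun ζ ↦ C ζ i) w)
      (hu : ∀ᶠ ζ in 𝓝 w, fderiv ℝ F ζ u = ∑ i, C ζ i • X i (F ζ)) :
      fderiv ℝ (fderiv ℝ F) w u' u = ∑ i, (C w i • fderiv ℝ (X i) (F w) (fderiv ℝ F w u') +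
        fderiv ℝ (fun ζ ↦ C ζ i) w u' • X i (F w)) := by
    have d1 : HasFDerivAt (fun ζ ↦ fderiv ℝ F ζ u)
        ((ContinuousLinearMap.apply ℝ E u).comp (fderiv ℝ (fderiv ℝ F) w)) w :=
      (ContinuousLinearMap.apply ℝ E u).hasFDerivAt.comp w h1.hasFDerivAt
    have d2 : HasFDerivAt (fun ζ ↦ ∑ i, C ζ i • X i (F ζ)) _ w :=
      HasFDerivAt.fun_sum fun i _ ↦
        (hC i).hasFDerivAt.smul ((hX i).hasFDerivAt.comp w hFd.hasFDerivAt)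
    have := DFunLike.congr_fun ((d1.congr_of_eventuallyEq
      (hu.mono fun ζ hζ ↦ hζ.symm)).unique d2) u'
    simpa using this
  have e1 := key (u' := v') hA hv
  have e2 := key (u' := v) hB hv'
  -- Both expressions compute the same second derivative of F. In their difference the derivatives
  -- of the frame fields assemble into Lie brackets.
  rw [hsymm.eq v' v, e2] at e1
  rw [hv.self_of_nhds, hv'.self_of_nhds] at e1
  simp only [map_sum, map_smul, Finset.smul_sum, Finset.sum_add_distrib, smul_smul] at e1
  simp only [lieBracket, smul_sub, sub_smul, Finset.sum_sub_distrib]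
  rw [Finset.sum_comm] at e1
  have e3 : ∑ x, ∑ y, (B w y * A w x) • fderiv ℝ (X y) (F w) (X x (F w)) =
      ∑ x, ∑ y, (A w x * B w y) • fderiv ℝ (X y) (F w) (X x (F w)) := by
    simp only [mul_comm]
  rw [e3] at e1
  rw [sub_eq_sub_iff_add_eq_add, add_comm, ← e1, add_comm]

variable {M : Type*} [TopologicalSpace M] [ChartedSpace R3 M]

/-- The vector space identity is applied in the extended chart at ψ w and carried back, since
`mlieBracket` is the pullback of the bracket of the fields read in that chart. -/
theorem sum_fderiv_sub_eq_mlieBracket [IsManifold (𝓡 3) 2 M]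
    {ψ : ℂ → M} {A B : ℂ → Fin 3 → ℝ} {X : Fin 3 → ∀ q : M, TangentSpace (𝓡 3) q} {v v' w : ℂ}
    (hψ : ContMDiffAt 𝓘(ℝ, ℂ) (𝓡 3) 2 ψ w)
    (hA : ∀ i, DifferentiableAt ℝ (fun ζ ↦ A ζ i) w)
    (hB : ∀ i, DifferentiableAt ℝ (fun ζ ↦ B ζ i) w)
    (hX : ∀ i, MDifferentiableAt (𝓡 3) (𝓡 3).tangent
      (fun q ↦ (⟨q, X i q⟩ : TangentBundle (𝓡 3) M)) (ψ w))
    (hv : ∀ᶠ ζ in 𝓝 w, pushVec ψ v ζ = ∑ i, A ζ i • X i (ψ ζ))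
    (hv' : ∀ᶠ ζ in 𝓝 w, pushVec ψ v' ζ = ∑ i, B ζ i • X i (ψ ζ)) :
    ∑ i, (fderiv ℝ (fun ζ ↦ A ζ i) w v' - fderiv ℝ (fun ζ ↦ B ζ i) w v) • X i (ψ w) =
      ∑ i, ∑ j, (A w i * B w j) • mlieBracket (𝓡 3) (X i) (X j) (ψ w) := by
  have : IsManifold (𝓡 3) 1 M := IsManifold.of_le (n := 2) (by norm_num)
  set χ := extChartAt (𝓡 3) (ψ w) with hχ
  set Y : Fin 3 → R3 → R3 := fun i ↦
    mpullbackWithin 𝓘(ℝ, R3) (𝓡 3) χ.symm (X i) (Set.range (𝓡 3)) with hY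
  set F : ℂ → R3 := fun ζ ↦ χ (ψ ζ) with hFdef
  have hψc : ContinuousAt ψ w := hψ.continuousAt
  have hXY (i : Fin 3) : ∀ᶠ ζ in 𝓝 w,
      mfderiv (𝓡 3) 𝓘(ℝ, R3) χ (ψ ζ) (X i (ψ ζ)) = Y i (F ζ) := by
    have h0 := eventuallyEq_mpullback_mpullbackWithin_extChartAt (s := Set.univ) (x := ψ w) (X i)
    rw [nhdsWithin_univ] at h0
    have h1 := hψc.eventually h0
    have h2 := hψc.eventually (extChartAt_source_mem_nhds (I := 𝓡 3) (ψ w))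
    filter_upwards [h1, h2] with ζ e1 e2
    rw [e1, mpullback_apply]
    exact (isInvertible_mfderiv_extChartAt e2).self_apply_inverse _
  have hFs : ContDiffAt ℝ 2 F w := by
    have h1 : ContMDiffAt (𝓡 3) 𝓘(ℝ, R3) 2 χ (ψ w) := contMDiffAt_extChartAt
    exact (h1.comp w hψ).contDiffAt
  have hFv (u : ℂ) : ∀ᶠ ζ in 𝓝 w,
      fderiv ℝ F ζ u = mfderiv (𝓡 3) 𝓘(ℝ, R3) χ (ψ ζ) (pushVec ψ u ζ) := by
    have h1 : ∀ᶠ ζ in 𝓝 w, MDifferentiableAt 𝓘(ℝ, ℂ) (𝓡 3) ψ ζ :=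
      (contMDiffAt_iff_contMDiffAt_nhds (by simp) |>.mp hψ).mono fun ζ hζ ↦ hζ.mdifferentiableAt (by norm_num)
    have h2 := hψc.eventually (extChartAt_source_mem_nhds (I := 𝓡 3) (ψ w))
    filter_upwards [h1, h2] with ζ e1 e2
    have e2' : ψ ζ ∈ (extChartAt (𝓡 3) (ψ w)).source := e2
    rw [extChartAt_source] at e2'
    have e3 : MDifferentiableAt (𝓡 3) 𝓘(ℝ, R3) χ (ψ ζ) := mdifferentiableAt_extChartAt e2'
    rw [← mfderiv_eq_fderiv]
    have := mfderiv_comp ζ e3 e1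
    exact DFunLike.congr_fun this u
  have hpush {C : ℂ → Fin 3 → ℝ} {u : ℂ}
      (hu : ∀ᶠ ζ in 𝓝 w, pushVec ψ u ζ = ∑ i, C ζ i • X i (ψ ζ)) :
      ∀ᶠ ζ in 𝓝 w, fderiv ℝ F ζ u = ∑ i, C ζ i • Y i (F ζ) := by
    filter_upwards [hu, hFv u, eventually_all.mpr hXY] with ζ e1 e2 e3
    rw [e2, e1, map_sum]
    refine Finset.sum_congr rfl fun i _ ↦ ?_
    rw [map_smul, e3 i]
    rfl
  have hset : χ.symm ⁻¹' Set.univ ∩ Set.range (𝓡 3) = Set.univ := by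
    rw [Set.preimage_univ, Set.univ_inter, ModelWithCorners.range_eq_univ]
  have hYd (i : Fin 3) : DifferentiableAt ℝ (Y i) (F w) := by
    have h1 : MDifferentiableWithinAt (𝓡 3) (𝓡 3).tangent
      (fun q ↦ (⟨q, X i q⟩ : TangentBundle (𝓡 3) M)) Set.univ (ψ w) := (hX i).mdifferentiableWithinAt
    have h2 := h1.differentiableWithinAt_mpullbackWithin_vectorField
    rw [← hχ, hset] at h2
    exact differentiableWithinAt_univ.mp h2
  have hmain := sum_fderiv_sub_eq_lieBracket hFs hA hB hYd (hpush hv) (hpush hv')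
  have hinv := isInvertible_mfderiv_extChartAt (I := 𝓡 3) (mem_extChartAt_source (I := 𝓡 3) (ψ w))
  let L : R3 →L[ℝ] R3 := (mfderiv (𝓡 3) 𝓘(ℝ, R3) χ (ψ w)).inverse
  have hXw (i : Fin 3) : X i (ψ w) = L (Y i (F w)) := by
    rw [← (hXY i).self_of_nhds]
    exact (hinv.inverse_apply_self _).symm
  have hbr (i j : Fin 3) :
      mlieBracket (𝓡 3) (X i) (X j) (ψ w) = L (lieBracket ℝ (Y i) (Y j) (F w)) := by
    rw [← mlieBracketWithin_univ, mlieBracketWithin_apply, ← hχ, hset]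
    have h : lieBracketWithin ℝ (Y i) (Y j) Set.univ (F w) = lieBracket ℝ (Y i) (Y j) (F w) := by
      rw [lieBracketWithin_univ]
    exact congrArg L h
  have := congrArg L hmain
  simp only [map_sum, map_smul] at this
  simp only [hXw, hbr]
  exact this

end MaurerCartan

/-! ## Immersions with positive extrinsic curvature: linear algebra at a point -/

/-- Cramer's rule: the multipliers below are the cofactors of the matrix with rows A, B, n. -/
theorem eq_zero_of_dot_eq_zero {A B n x : Fin 3 → ℝ} (hD : (Matrix.of ![A, B, n]).det ≠ 0)
    (hA : ∑ k, x k * A k = 0) (hB : ∑ k, x k * B k = 0) (hn : ∑ k, x k * n k = 0) : x = 0 := by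
  rw [Fin.sum_univ_three] at hA hB hn
  rw [Matrix.det_fin_three] at hD
  simp only [Matrix.of_apply, Matrix.cons_val] at hD
  ext k
  rw [Pi.zero_apply, ← mul_right_inj' hD, mul_zero]
  fin_cases k
  · change _ * x 0 = 0
    linear_combination (B 1 * n 2 - B 2 * n 1) * hA + (n 1 * A 2 - n 2 * A 1) * hB +
      (A 1 * B 2 - A 2 * B 1) * hn
  · change _ * x 1 = 0
    linear_combination (B 2 * n 0 - B 0 * n 2) * hA + (n 2 * A 0 - n 0 * A 2) * hB +
      (A 2 * B 0 - A 0 * B 2) * hn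
  · change _ * x 2 = 0
    linear_combination (B 0 * n 1 - B 1 * n 0) * hA + (n 0 * A 1 - n 1 * A 0) * hB +
      (A 0 * B 1 - A 1 * B 0) * hn

/-- The Gram determinant of A, B, n is the squared determinant, and it reduces to that of A, B
because n is a unit vector orthogonal to both. -/
theorem gram_eq_det_sq {A B n : Fin 3 → ℝ} (hn : ∑ k, n k * n k = 1) (hA : ∑ k, n k * A k = 0)
    (hB : ∑ k, n k * B k = 0) :
    (∑ k, A k * A k) * (∑ k, B k * B k) - (∑ k, A k * B k) * (∑ k, B k * A k) =
      (Matrix.of ![A, B, n]).det ^ 2 := by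
  rw [Fin.sum_univ_three] at *
  rw [Matrix.det_fin_three]
  simp only [Matrix.of_apply, Matrix.cons_val, Fin.sum_univ_three]
  linear_combination (-((A 0 * A 0 + A 1 * A 1 + A 2 * A 2) * (B 0 * B 0 + B 1 * B 1 + B 2 * B 2) -
      (A 0 * B 0 + A 1 * B 1 + A 2 * B 2) ^ 2)) * hn +
    ((B 0 * B 0 + B 1 * B 1 + B 2 * B 2) * (n 0 * A 0 + n 1 * A 1 + n 2 * A 2) -
      2 * (A 0 * B 0 + A 1 * B 1 + A 2 * B 2) * (n 0 * B 0 + n 1 * B 1 + n 2 * B 2)) * hA +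
    (A 0 * A 0 + A 1 * A 1 + A 2 * A 2) * (n 0 * B 0 + n 1 * B 1 + n 2 * B 2) * hB

/-- In a positively oriented parameter conformal for the second fundamental form, the derivatives
`P, Q` of the normal determine the derivatives `A, B` of the immersion. -/
theorem derivative_eq_cross {A B n P Q : Fin 3 → ℝ} {ρ K : ℝ} (hρ : 0 < ρ)
    (hn : ∑ k, n k * n k = 1) (hA : ∑ k, n k * A k = 0) (hB : ∑ k, n k * B k = 0)
    (hP : ∑ k, P k * n k = 0) (hQ : ∑ k, Q k * n k = 0)
    (hPA : ∑ k, P k * A k = -(2 * ρ)) (hPB : ∑ k, P k * B k = 0)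
    (hQA : ∑ k, Q k * A k = 0) (hQB : ∑ k, Q k * B k = -(2 * ρ))
    (hD : 0 < (Matrix.of ![A, B, n]).det)
    (hK : K = (2 * ρ * (2 * ρ) - 0 * 0) / ((∑ k, A k * A k) * (∑ k, B k * B k) -
      (∑ k, A k * B k) * (∑ k, B k * A k))) :
    0 < √K ∧ √K • A = n ⨯₃ Q ∧ √K • B = -(n ⨯₃ P) := by
  -- As det I is the square of det(A, B, n), the positive orientation selects the sign of the square
  -- root.
  have hs : √K = 2 * ρ / (Matrix.of ![A, B, n]).det := by
    rw [hK, gram_eq_det_sq hn hA hB, zero_mul, sub_zero, ← pow_two, ← div_pow,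
      Real.sqrt_sq (by positivity)]
  have hspos : 0 < √K := by rw [hs]; positivity
  have hsD : √K * (Matrix.of ![A, B, n]).det = 2 * ρ := by
    rw [hs, div_mul_cancel₀ _ hD.ne']
  rw [Matrix.det_fin_three] at hsD
  simp only [Matrix.of_apply, Matrix.cons_val] at hsD
  -- The vectors P and √K n × B have equal products with A, B and n. Applying n× and using n × (n ×
  -- B) = -B then recovers B.
  have hPe : P - √K • (n ⨯₃ B) = 0 := by
    refine eq_zero_of_dot_eq_zero hD.ne' ?_ ?_ ?_ <;>
      simp only [Fin.sum_univ_three, cross_apply, Pi.sub_apply, Pi.smul_apply, smul_eq_mul,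
        Matrix.cons_val] at *
    · linear_combination hPA + hsD
    · linear_combination hPB
    · linear_combination hP
  have hQe : Q + √K • (n ⨯₃ A) = 0 := by
    refine eq_zero_of_dot_eq_zero hD.ne' ?_ ?_ ?_ <;>
      simp only [Fin.sum_univ_three, cross_apply, Pi.add_apply, Pi.smul_apply, smul_eq_mul,
        Matrix.cons_val] at *
    · linear_combination hQA
    · linear_combination hQB + hsD
    · linear_combination hQ
  refine ⟨hspos, ?_, ?_⟩
  · rw [eq_neg_of_add_eq_zero_left hQe]
    simp only [Fin.sum_univ_three] at hn hA
    ext k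
    fin_cases k <;> simp [cross_apply]
    · linear_combination √K * n 0 * hA - √K * A 0 * hn
    · linear_combination √K * n 1 * hA - √K * A 1 * hn
    · linear_combination √K * n 2 * hA - √K * A 2 * hn
  · rw [sub_eq_zero.mp hPe]
    simp only [Fin.sum_univ_three] at hn hB
    ext k
    fin_cases k <;> simp [cross_apply]
    · linear_combination √K * n 0 * hB - √K * B 0 * hn
    · linear_combination √K * n 1 * hB - √K * B 1 * hn
    · linear_combination √K * n 2 * hB - √K * B 2 * hn

/-! ## Immersions with positive extrinsic curvature: the complex equations -/

/-- The torsion is the tangential part of the Maurer-Cartan expression of `a`. -/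
theorem StructureOn.torsion_eq_holPart {m₁ m₃ : ℝ} {Γ : Fin 3 → Fin 3 → Fin 3 → ℝ} {V : Set ℂ}
    {N : ℂ → Fin 3 → ℝ} {K : ℂ → ℝ} {a : ℂ → Fin 3 → ℂ} {w : ℂ}
    (H : StructureOn m₁ m₃ Γ V N K a) (hw : w ∈ V)
    (ha : ∀ k, DifferentiableAt ℝ (fun ζ ↦ a ζ k) w) :
    torsion m₁ m₃ (fun ζ ↦ stereo (N ζ)) a w =
      holPart (stereo (N w)) ((fun k ↦ dzbar (fun ζ ↦ a ζ k) w - dz (fun ζ ↦ star (a ζ k)) w) +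
        levi m₁ m₃ (star (a w)) (a w) - levi m₁ m₃ (a w) (star (a w))) := by
  have hg := HasWirtinger.of_diff ((H.contDiffAt_stereo hw).differentiableAt (by norm_num))
  have hak (k) := HasWirtinger.of_diff (ha k)
  have hsk (k) : HasWirtinger (fun ζ ↦ star (a ζ) k) _ _ w := (hak k).star
  have hb0 : 1 + stereo (N w) * star (stereo (N w)) ≠ 0 := by
    have := (H.denoms hw).b_ne
    rwa [coefB_eq] at this
  have dα := (HasWirtinger.holPart hak hg).dzbar_eq
  have dβ := (HasWirtinger.holPart hsk hg).dz_eq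
  have hdz : (fun k ↦ dzbar (fun ζ ↦ a ζ k) w - dz (fun ζ ↦ star (a ζ k)) w) =
      (fun k ↦ dzbar (fun ζ ↦ a ζ k) w) - fun k ↦ star (dzbar (fun ζ ↦ a ζ k) w) := by
    ext k
    simp only [Pi.sub_apply, (hak k).star.dz_eq]
  simp only [holPart_star] at dβ
  obtain ⟨s1, -⟩ := H.solve hw
  obtain ⟨a1, a2, a3⟩ := tangent_eq hb0 rfl s1 rfl rfl
  change plus (a w) = _ * (holPart (stereo (N w)) (a w) - _ *
    antiPart (stereo (N w)) (a w)) at a1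
  change minus (a w) = _ * (antiPart (stereo (N w)) (a w) - _ *
    holPart (stereo (N w)) (a w)) at a2
  change a w 2 = _ * (_ * holPart (stereo (N w)) (a w) + _ *
    antiPart (stereo (N w)) (a w)) at a3
  have b1 : plus (star (a w)) = _ := plus_star _
  have b2 : minus (star (a w)) = _ := minus_star _
  have b3 : star (a w) 2 = star (a w 2) := rfl
  have hadd (x y : Fin 3 → ℂ) : holPart (stereo (N w)) (x + y) =
      holPart (stereo (N w)) x + holPart (stereo (N w)) y := by
    simp only [holPart, plus_add, minus_add, Pi.add_apply]; ring
  have hsub (x y : Fin 3 → ℂ) : holPart (stereo (N w)) (x - y) =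
      holPart (stereo (N w)) x - holPart (stereo (N w)) y := by
    simp only [holPart, plus, minus, Pi.sub_apply]; ring
  have hlevi (x y : Fin 3 → ℂ) : holPart (stereo (N w)) (levi m₁ m₃ x y) =
      (Complex.I * m₃ * x 2 * (plus y + stereo (N w) ^ 2 * minus y) -
        Complex.I * m₁ * y 2 * (plus x + stereo (N w) ^ 2 * minus x) +
        stereo (N w) * Complex.I * m₁ * (plus x * minus y - minus x * plus y)) / 2 := by
    rw [holPart, plus_levi, minus_levi, levi_two]; ring
  rw [torsion, hdz, hsub, hadd, hsub, hlevi, hlevi, b1, b2, b3, dα, dβ, coefB_eq, b2, b3]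
  simp only [a1, a2, a3]
  simp only [star_mul', star_sub, star_add, star_pow, star_star, star_one, star_div₀, star_ofNat]
  have hbc : 1 + star (stereo (N w)) * stereo (N w) = 1 + stereo (N w) * star (stereo (N w)) := by
    ring
  simp only [hbc]
  generalize holPart (stereo (N w)) (fun k ↦ star (dzbar (fun ζ ↦ a ζ k) w)) = x at *
  generalize holPart (stereo (N w)) (fun k ↦ dzbar (fun ζ ↦ a ζ k) w) = y at *
  generalize holPart (stereo (N w)) (a w) = α at *
  generalize antiPart (stereo (N w)) (a w) = β at *
  generalize star α = α'
  generalize star β = β'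
  generalize dz (fun ζ ↦ stereo (N ζ)) w = p
  generalize dzbar (fun ζ ↦ stereo (N ζ)) w = q
  generalize star (stereo (N w)) = h at *
  generalize stereo (N w) = g at *
  clear * - hb0
  field_simp
  ring

theorem dz_ofReal {f : ℂ → ℝ} {w : ℂ} (hf : DifferentiableAt ℝ f w) :
    dz (fun ζ ↦ (f ζ : ℂ)) w = (fderiv ℝ f w 1 - Complex.I * fderiv ℝ f w Complex.I) / 2 := by
  have : HasFDerivAt (fun ζ ↦ (f ζ : ℂ)) (Complex.ofRealCLM.comp (fderiv ℝ f w)) w :=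
    Complex.ofRealCLM.hasFDerivAt.comp w hf.hasFDerivAt
  rw [dz, this.fderiv]
  rfl

theorem dzbar_ofReal {f : ℂ → ℝ} {w : ℂ} (hf : DifferentiableAt ℝ f w) :
    dzbar (fun ζ ↦ (f ζ : ℂ)) w = (fderiv ℝ f w 1 + Complex.I * fderiv ℝ f w Complex.I) / 2 := by
  have : HasFDerivAt (fun ζ ↦ (f ζ : ℂ)) (Complex.ofRealCLM.comp (fderiv ℝ f w)) w :=
    Complex.ofRealCLM.hasFDerivAt.comp w hf.hasFDerivAt
  rw [dzbar, this.fderiv]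
  rfl

/-- The complex vector field `(A - i B) / 2`. -/
def complexField (A B : ℂ → Fin 3 → ℝ) (w : ℂ) (k : Fin 3) : ℂ := (A w k - Complex.I * B w k) / 2

/-- The complex equation combines the real ones: √K (A - iB)/2 = (n × Q + i n × P)/2 = i n × (P -
iQ)/2. -/
theorem structureEq_complexField {Γ : Fin 3 → Fin 3 → Fin 3 → ℝ} {n A B : ℂ → Fin 3 → ℝ}
    {K : ℂ → ℝ} {w : ℂ} {P Q : Fin 3 → ℝ} (hn : ∀ k, DifferentiableAt ℝ (fun ζ ↦ n ζ k) w)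
    (hP : ∀ k, P k = fderiv ℝ (fun ζ ↦ n ζ k) w 1 + ∑ i, ∑ j, A w i * n w j * Γ i j k)
    (hQ : ∀ k, Q k = fderiv ℝ (fun ζ ↦ n ζ k) w Complex.I + ∑ i, ∑ j, B w i * n w j * Γ i j k)
    (hK : 0 < √(K w)) (hA : √(K w) • A w = n w ⨯₃ Q) (hB : √(K w) • B w = -(n w ⨯₃ P)) :
    StructureEq Γ n K (complexField A B) w := by
  have hW (k) : nablaZ Γ (complexField A B) (toC n) w k = (P k - Complex.I * Q k) / 2 := by
    have e : dz (fun ζ ↦ toC n ζ k) w = _ := dz_ofReal (hn k)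
    rw [nablaZ, e, hP, hQ]
    push_cast
    simp only [complexField, toC, Fin.sum_univ_three]
    ring
  have hs : (√(K w) : ℂ) ≠ 0 := by exact_mod_cast hK.ne'
  have hA' (k) : (√(K w) : ℂ) * A w k = ((n w ⨯₃ Q) k : ℝ) := by
    rw [← hA]; simp
  have hB' (k) : (√(K w) : ℂ) * B w k = -((n w ⨯₃ P) k : ℝ) := by
    rw [← Complex.ofReal_neg, ← Pi.neg_apply, ← hB]; simp
  have hW' : nablaZ Γ (complexField A B) (toC n) w = fun k ↦ (P k - Complex.I * Q k) / 2 :=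
    funext hW
  rw [StructureEq, hW']
  ext k
  have h1 := hA' k
  have h2 := hB' k
  rw [Pi.smul_apply, smul_eq_mul, ← mul_right_inj' hs, ← mul_assoc, mul_div_cancel₀ _ hs,
    complexField]
  fin_cases k <;>
  · simp only [cross_apply, toC, Fin.zero_eta, Fin.mk_one, Fin.reduceFinMk, Matrix.cons_val,
      Complex.ofReal_sub, Complex.ofReal_mul] at h1 h2 ⊢
    linear_combination (norm := ring_nf) h1 / 2 - Complex.I / 2 * h2
    simp only [Complex.I_sq]
    ring

/-- For a = (A - iB)/2 one has a_z̄ - ā_z = (i/2)(A_y - B_x), so the complex equation is i/2 times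
the real one. -/
theorem maurerCartan_complexField {Γ : Fin 3 → Fin 3 → Fin 3 → ℝ} {m₁ m₃ : ℝ}
    (hΓ : IsMilnor Γ m₁ m₃) {A B : ℂ → Fin 3 → ℝ} {w : ℂ}
    (hA : ∀ k, DifferentiableAt ℝ (fun ζ ↦ A ζ k) w)
    (hB : ∀ k, DifferentiableAt ℝ (fun ζ ↦ B ζ k) w)
    (h : ∀ k, fderiv ℝ (fun ζ ↦ A ζ k) w Complex.I - fderiv ℝ (fun ζ ↦ B ζ k) w 1 =
      ∑ i, ∑ j, A w i * B w j * (Γ i j k - Γ j i k)) :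
    (∀ k, DifferentiableAt ℝ (fun ζ ↦ complexField A B ζ k) w) ∧
    (fun k ↦ dzbar (fun ζ ↦ complexField A B ζ k) w -
        dz (fun ζ ↦ star (complexField A B ζ k)) w) +
      levi m₁ m₃ (star (complexField A B w)) (complexField A B w) -
      levi m₁ m₃ (complexField A B w) (star (complexField A B w)) = 0 := by
  have hAW (k) : HasWirtinger (fun ζ ↦ (A ζ k : ℂ)) _ _ w :=
    HasWirtinger.of_diff (Complex.ofRealCLM.differentiableAt.comp w (hA k))
  have hBW (k) : HasWirtinger (fun ζ ↦ (B ζ k : ℂ)) _ _ w :=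
    HasWirtinger.of_diff (Complex.ofRealCLM.differentiableAt.comp w (hB k))
  have hW (k) := ((hAW k).sub ((hBW k).const_mul Complex.I)).const_mul 2⁻¹
  have e (k) : (fun ζ ↦ complexField A B ζ k) =
      fun ζ ↦ 2⁻¹ * ((A ζ k : ℂ) - Complex.I * (B ζ k : ℂ)) := by
    ext ζ; rw [complexField]; ring
  simp only [← e] at hW
  refine ⟨fun k ↦ (hW k).diff, ?_⟩
  ext k
  simp only [Pi.add_apply, Pi.sub_apply, Pi.zero_apply, ← hΓ _ _ k]
  have hk : (fderiv ℝ (fun ζ ↦ A ζ k) w Complex.I : ℂ) - fderiv ℝ (fun ζ ↦ B ζ k) w 1 =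
      ∑ i, ∑ j, (A w i : ℂ) * B w j * (Γ i j k - Γ j i k) := by
    exact_mod_cast h k
  rw [(hW k).star.dz_eq, (hW k).dzbar_eq, dzbar_ofReal (hA k), dzbar_ofReal (hB k)]
  simp only [Fin.sum_univ_three] at hk
  simp only [Fin.sum_univ_three, complexField, Pi.star_apply, Complex.star_def, map_sub, map_mul,
    map_div₀, map_add, map_inv₀, Complex.conj_ofReal, Complex.conj_I, map_ofNat]
  linear_combination (norm := ring_nf) Complex.I / 2 * hk

theorem StructureOn.gaussMapEq_of_maurerCartan {Γ : Fin 3 → Fin 3 → Fin 3 → ℝ} {m₁ m₃ : ℝ}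
    {V : Set ℂ} {n A B : ℂ → Fin 3 → ℝ} {K : ℂ → ℝ} {w : ℂ}
    (H : StructureOn m₁ m₃ Γ V n K (complexField A B)) (hw : w ∈ V)
    (hA : ∀ k, DifferentiableAt ℝ (fun ζ ↦ A ζ k) w)
    (hB : ∀ k, DifferentiableAt ℝ (fun ζ ↦ B ζ k) w)
    (h : ∀ k, fderiv ℝ (fun ζ ↦ A ζ k) w Complex.I - fderiv ℝ (fun ζ ↦ B ζ k) w 1 =
      ∑ i, ∑ j, A w i * B w j * (Γ i j k - Γ j i k)) :
    GaussMapEq m₁ m₃ (fun ζ ↦ stereo (n ζ)) K w := by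
  obtain ⟨h1, h2⟩ := maurerCartan_complexField H.milnor hA hB h
  rw [← H.torsion_eq_zero_iff hw, H.torsion_eq_holPart hw h1, h2]
  simp [holPart, plus, minus]

section Immersion

variable {M : Type*} [TopologicalSpace M] [ChartedSpace R3 M]

/-! ## Regularity of the frame coordinates -/

theorem contMDiffOn_pushVec [IsManifold (𝓡 3) ∞ M] {ψ : ℂ → M} {T : Set ℂ} (hT : IsOpen T)
    (hψ : ContMDiffOn 𝓘(ℝ, ℂ) (𝓡 3) ∞ ψ T) (v : ℂ) :
    ContMDiffOn 𝓘(ℝ, ℂ) (𝓡 3).tangent ∞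
      (fun ζ ↦ (⟨ψ ζ, pushVec ψ v ζ⟩ : TangentBundle (𝓡 3) M)) T := by
  have h1 := hψ.contMDiffOn_tangentMapWithin (m := ∞) (by simp) hT.uniqueMDiffOn
  have h2 : ContMDiffOn 𝓘(ℝ, ℂ) 𝓘(ℝ, ℂ).tangent ∞
      (fun ζ ↦ (⟨ζ, v⟩ : TangentBundle 𝓘(ℝ, ℂ) ℂ)) T :=
    contMDiffOn_vectorSpace_iff_contDiffOn (V := fun _ ↦ v) |>.mpr contDiffOn_const
  refine (h1.comp h2 fun ζ hζ ↦ hζ).congr fun ζ hζ ↦ ?_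
  simp only [Function.comp_apply, tangentMapWithin, mfderivWithin_of_isOpen hT hζ]
  rfl

variable [Group M] [RiemannianBundle (fun q : M ↦ TangentSpace (𝓡 3) q)]

/-- Class C² is enough: the Gauss map equation takes two derivatives of the normal and one of K. -/
theorem contDiffOn_frameCoord [LieGroup (𝓡 3) ∞ M]
    [IsContMDiffRiemannianBundle (𝓡 3) ∞ R3 (fun q : M ↦ TangentSpace (𝓡 3) q)]
    (e : Fin 3 → GroupLieAlgebra (𝓡 3) M) {ψ : ℂ → M} {T : Set ℂ}
    (hψ : ContMDiffOn 𝓘(ℝ, ℂ) (𝓡 3) ∞ ψ T) {W : ∀ w : ℂ, TangentSpace (𝓡 3) (ψ w)}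
    (hW : ContMDiffOn 𝓘(ℝ, ℂ) (𝓡 3).tangent ∞
      (fun ζ ↦ (⟨ψ ζ, W ζ⟩ : TangentBundle (𝓡 3) M)) T) (k : Fin 3) :
    ContDiffOn ℝ 2 (fun ζ ↦ frameCoord e ψ W ζ k) T := by
  have : LieGroup (𝓡 3) (minSmoothness ℝ 3) M := LieGroup.of_le (n := ∞) (by
    rw [minSmoothness_of_isRCLikeNormedField]; norm_cast)
  have h1 : ContMDiff (𝓡 3) (𝓡 3).tangent 2
      (fun q : M ↦ (⟨q, frame e k q⟩ : TangentBundle (𝓡 3) M)) := by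
    exact (contMDiff_mulInvariantVectorField (I := 𝓡 3) (e k)).of_le
      (by rw [minSmoothness_of_isRCLikeNormedField])
  have h2 : ContMDiffOn 𝓘(ℝ, ℂ) (𝓡 3).tangent 2
      (fun ζ ↦ (⟨ψ ζ, frame e k (ψ ζ)⟩ : TangentBundle (𝓡 3) M)) T :=
    h1.comp_contMDiffOn (hψ.of_le (by norm_cast))
  have : IsContMDiffRiemannianBundle (𝓡 3) 2 R3 (fun q : M ↦ TangentSpace (𝓡 3) q) :=
    IsContMDiffRiemannianBundle.of_le (n := ∞) (by norm_cast)
  exact ((hW.of_le (by norm_cast)).inner_bundle h2).contDiffOn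

/-! ## The Christoffel symbols -/

/-- Compatibility of the connection with the metric. -/
theorem christoffel_antisymm (e : Fin 3 → GroupLieAlgebra (𝓡 3) M) (i j k : Fin 3) :
    christoffel e i j k = -christoffel e i k j := by
  rw [christoffel, christoffel, lie_swap (e k) (e j), lie_swap (e j) (e i), lie_swap (e i) (e k)]
  simp only [lieInner_neg_left]
  ring

/-- Vanishing torsion of the Levi-Civita connection. -/
theorem christoffel_sub (e : Fin 3 → GroupLieAlgebra (𝓡 3) M) (i j k : Fin 3) :
    christoffel e i j k - christoffel e j i k = lieInner ⁅e i, e j⁆ (e k) := by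
  rw [christoffel, christoffel, lie_swap (e j) (e i), lie_swap (e k) (e j), lie_swap (e i) (e k)]
  simp only [lieInner_neg_left]
  ring

variable {e : Fin 3 → GroupLieAlgebra (𝓡 3) M} {c : Fin 3 → ℝ}

namespace IsUnimodularFrame

theorem frameCoord_sum (hM : IsLeftInvariantMetric M) (he : IsUnimodularFrame e c) (q : M)
    (x : Fin 3 → ℝ) (k : Fin 3) : inner ℝ (∑ i, x i • frame e i q) (frame e k q) = x k := by
  simp [sum_inner, real_inner_smul_left, he.inner_frame hM]

/-- The second fundamental form in the coordinates of the frame. -/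
theorem secondForm_eq (hM : IsLeftInvariantMetric M) (he : IsUnimodularFrame e c) (ψ : ℂ → M)
    (W : ∀ w : ℂ, TangentSpace (𝓡 3) (ψ w)) (w v v' : ℂ) :
    secondForm e ψ W w v v' = -∑ k, (fderiv ℝ (fun ζ ↦ frameCoord e ψ W ζ k) w v +
      ∑ i, ∑ j, frameCoord e ψ (pushVec ψ v) w i * frameCoord e ψ W w j * christoffel e i j k) *
        frameCoord e ψ (pushVec ψ v') w k := by
  rw [secondForm, inner_neg_left, he.inner_eq_sum hM]
  congr 1
  refine Finset.sum_congr rfl fun k _ ↦ ?_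
  rw [covDerivAlong, he.frameCoord_sum hM (ψ w) _ k]
  rfl

theorem firstForm_eq (hM : IsLeftInvariantMetric M) (he : IsUnimodularFrame e c) (ψ : ℂ → M)
    (w v v' : ℂ) : firstForm ψ w v v' =
      ∑ k, frameCoord e ψ (pushVec ψ v) w k * frameCoord e ψ (pushVec ψ v') w k :=
  he.inner_eq_sum hM _ _ _

theorem extrinsicCurvature_eq (hM : IsLeftInvariantMetric M) (he : IsUnimodularFrame e c)
    (ψ : ℂ → M) (W : ∀ w : ℂ, TangentSpace (𝓡 3) (ψ w)) (w : ℂ) :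
    extrinsicCurvature e ψ W w =
      (secondForm e ψ W w 1 1 * secondForm e ψ W w Complex.I Complex.I -
        secondForm e ψ W w 1 Complex.I * secondForm e ψ W w Complex.I 1) /
      ((∑ k, frameCoord e ψ (pushVec ψ 1) w k * frameCoord e ψ (pushVec ψ 1) w k) *
        (∑ k, frameCoord e ψ (pushVec ψ Complex.I) w k *
          frameCoord e ψ (pushVec ψ Complex.I) w k) -
        (∑ k, frameCoord e ψ (pushVec ψ 1) w k * frameCoord e ψ (pushVec ψ Complex.I) w k) *
        (∑ k, frameCoord e ψ (pushVec ψ Complex.I) w k * frameCoord e ψ (pushVec ψ 1) w k)) := by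
  simp only [extrinsicCurvature, he.firstForm_eq hM]

theorem maurerCartan [LieGroup (𝓡 3) ∞ M]
    (hM : IsLeftInvariantMetric M) (he : IsUnimodularFrame e c) {ψ : ℂ → M} {w v v' : ℂ}
    (hψ : ContMDiffAt 𝓘(ℝ, ℂ) (𝓡 3) 2 ψ w)
    (hA : ∀ k, DifferentiableAt ℝ (fun ζ ↦ frameCoord e ψ (pushVec ψ v) ζ k) w)
    (hB : ∀ k, DifferentiableAt ℝ (fun ζ ↦ frameCoord e ψ (pushVec ψ v') ζ k) w) (k : Fin 3) :
    fderiv ℝ (fun ζ ↦ frameCoord e ψ (pushVec ψ v) ζ k) w v' -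
      fderiv ℝ (fun ζ ↦ frameCoord e ψ (pushVec ψ v') ζ k) w v =
      ∑ i, ∑ j, frameCoord e ψ (pushVec ψ v) w i * frameCoord e ψ (pushVec ψ v') w j *
        (christoffel e i j k - christoffel e j i k) := by
  have : LieGroup (𝓡 3) (minSmoothness ℝ 3) M := LieGroup.of_le (n := ∞) (by
    rw [minSmoothness_of_isRCLikeNormedField]; norm_cast)
  have : IsManifold (𝓡 3) 2 M := IsManifold.of_le (n := ∞) (by norm_cast)
  have h1 := sum_fderiv_sub_eq_mlieBracket (X := fun i q ↦ frame e i q) hψ hA hB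
    (fun i ↦ mdifferentiableAt_mulInvariantVectorField (I := 𝓡 3) (e i))
    (.of_forall fun ζ ↦ (he.sum_inner_frame hM (ψ ζ) (pushVec ψ v ζ)).symm)
    (.of_forall fun ζ ↦ (he.sum_inner_frame hM (ψ ζ) (pushVec ψ v' ζ)).symm)
  have h2 := congrArg (fun x : TangentSpace (𝓡 3) (ψ w) ↦ (inner ℝ x (frame e k (ψ w)) : ℝ)) h1
  rw [he.frameCoord_sum hM (ψ w) _ k] at h2
  rw [h2, sum_inner]
  refine Finset.sum_congr rfl fun i _ ↦ ?_
  rw [sum_inner]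
  refine Finset.sum_congr rfl fun j _ ↦ ?_
  rw [real_inner_smul_left, christoffel_sub]
  congr 1
  -- The bracket of left invariant fields is left invariant, so its products with the frame at ψ w
  -- equal those at the identity.
  have h3 := congrFun (mulInvariantVector_mlieBracket (I := 𝓡 3) (e i) (e j)) (ψ w)
  have h4 := inner_mulInvariantVectorField hM ⁅e i, e j⁆ (e k) (ψ w)
  rw [GroupLieAlgebra.bracket_def] at h4
  rw [h3] at h4
  exact h4

end IsUnimodularFrame

end Immersion

section Immersion

variable {M : Type*} [TopologicalSpace M] [ChartedSpace R3 M] [Group M]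
  [RiemannianBundle (fun q : M ↦ TangentSpace (𝓡 3) q)]

/-! ## The structure equation of an immersion -/

theorem sum_christoffel_mul_self (e : Fin 3 → GroupLieAlgebra (𝓡 3) M) (x y : Fin 3 → ℝ) :
    ∑ k, (∑ i, ∑ j, x i * y j * christoffel e i j k) * y k = 0 := by
  have h (i j k) := christoffel_antisymm e i j k
  have h0 (i j) : christoffel e i j j = 0 := by linarith [h i j j]
  simp only [Fin.sum_univ_three, h0, h _ 1 0, h _ 2 0, h _ 2 1]
  ring

theorem sum_fderiv_mul_self {n : ℂ → Fin 3 → ℝ} {w : ℂ}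
    (hn : ∀ k, DifferentiableAt ℝ (fun ζ ↦ n ζ k) w)
    (h1 : ∀ᶠ ζ in nhds w, ∑ k, n ζ k * n ζ k = 1) (v : ℂ) :
    ∑ k, fderiv ℝ (fun ζ ↦ n ζ k) w v * n w k = 0 := by
  have d : HasFDerivAt (fun ζ ↦ ∑ k, n ζ k * n ζ k) _ w :=
    HasFDerivAt.fun_sum fun k _ ↦ (hn k).hasFDerivAt.mul (hn k).hasFDerivAt
  have := DFunLike.congr_fun (d.unique ((hasFDerivAt_const (1 : ℝ) w).congr_of_eventuallyEq h1)) v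
  simp only [add_apply, smul_apply, smul_eq_mul, zero_apply, Fin.sum_univ_three] at this ⊢
  linarith

variable {e : Fin 3 → GroupLieAlgebra (𝓡 3) M} {c : Fin 3 → ℝ}

/-- The coordinates of the covariant derivative of a vector field along a map. -/
def covCoord (e : Fin 3 → GroupLieAlgebra (𝓡 3) M) (ψ : ℂ → M)
    (W : ∀ w : ℂ, TangentSpace (𝓡 3) (ψ w)) (v w : ℂ) (k : Fin 3) : ℝ :=
  fderiv ℝ (fun ζ ↦ frameCoord e ψ W ζ k) w v +
    ∑ i, ∑ j, frameCoord e ψ (pushVec ψ v) w i * frameCoord e ψ W w j * christoffel e i j k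

variable [LieGroup (𝓡 3) ∞ M]

/-- A smooth map `ψ` into the group, with a smooth unit normal field `W`, in a positively oriented
parameter conformal for the second fundamental form. -/
structure IsConformalImmersionOn (e : Fin 3 → GroupLieAlgebra (𝓡 3) M) (ψ : ℂ → M)
    (W : ∀ w : ℂ, TangentSpace (𝓡 3) (ψ w)) (T : Set ℂ) : Prop where
  isOpen : IsOpen T
  smooth : ContMDiffOn 𝓘(ℝ, ℂ) (𝓡 3) ∞ ψ T
  smooth_normal : ContMDiffOn 𝓘(ℝ, ℂ) (𝓡 3).tangent ∞
    (fun ζ ↦ (⟨ψ ζ, W ζ⟩ : TangentBundle (𝓡 3) M)) T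
  unit : ∀ w ∈ T, inner ℝ (W w) (W w) = (1 : ℝ)
  normal : ∀ w ∈ T, ∀ v : ℂ, inner ℝ (W w) (pushVec ψ v w) = (0 : ℝ)
  pos : ∀ w ∈ T, 0 < extrinsicCurvature e ψ W w
  conformal : ∀ w ∈ T, IsConformalAt e ψ W w
  positive : ∀ w ∈ T, IsPositiveAt e ψ W w

namespace IsConformalImmersionOn

variable {ψ : ℂ → M} {W : ∀ w : ℂ, TangentSpace (𝓡 3) (ψ w)} {T : Set ℂ}

theorem sum_normal (hM : IsLeftInvariantMetric M) (he : IsUnimodularFrame e c)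
    (H : IsConformalImmersionOn e ψ W T) {w : ℂ} (hw : w ∈ T) :
    ∑ k, frameCoord e ψ W w k * frameCoord e ψ W w k = 1 := by
  rw [← H.unit w hw]
  exact (he.inner_eq_sum hM _ _ _).symm

theorem sum_normal_pushVec (hM : IsLeftInvariantMetric M) (he : IsUnimodularFrame e c)
    (H : IsConformalImmersionOn e ψ W T) {w : ℂ} (hw : w ∈ T) (v : ℂ) :
    ∑ k, frameCoord e ψ W w k * frameCoord e ψ (pushVec ψ v) w k = 0 := by
  rw [← H.normal w hw v]
  exact (he.inner_eq_sum hM _ _ _).symm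

variable [IsContMDiffRiemannianBundle (𝓡 3) ∞ R3 (fun q : M ↦ TangentSpace (𝓡 3) q)]

theorem contDiffOn_normal (H : IsConformalImmersionOn e ψ W T) (k : Fin 3) :
    ContDiffOn ℝ 2 (fun ζ ↦ frameCoord e ψ W ζ k) T :=
  contDiffOn_frameCoord e H.smooth H.smooth_normal k

theorem contDiffOn_pushVec (H : IsConformalImmersionOn e ψ W T) (v : ℂ) (k : Fin 3) :
    ContDiffOn ℝ 2 (fun ζ ↦ frameCoord e ψ (pushVec ψ v) ζ k) T :=
  contDiffOn_frameCoord e H.smooth (contMDiffOn_pushVec H.isOpen H.smooth v) k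

theorem contDiffOn_covCoord (H : IsConformalImmersionOn e ψ W T) (v : ℂ) (k : Fin 3) :
    ContDiffOn ℝ 1 (fun ζ ↦ covCoord e ψ W v ζ k) T := by
  refine ContDiffOn.add (((H.contDiffOn_normal k).fderiv_of_isOpen H.isOpen
    (by norm_num)).clm_apply contDiffOn_const) ?_
  refine ContDiffOn.sum fun i _ ↦ ContDiffOn.sum fun j _ ↦ ?_
  exact (((H.contDiffOn_pushVec v i).mul (H.contDiffOn_normal j)).mul contDiffOn_const).of_le
    (by norm_num)

theorem contDiffOn_extrinsicCurvature (hM : IsLeftInvariantMetric M)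
    (he : IsUnimodularFrame e c) (H : IsConformalImmersionOn e ψ W T) :
    ContDiffOn ℝ 1 (extrinsicCurvature e ψ W) T := by
  have hII (v v' : ℂ) : ContDiffOn ℝ 1 (fun w ↦ secondForm e ψ W w v v') T := by
    simp only [he.secondForm_eq hM]
    exact (ContDiffOn.sum fun k _ ↦ (H.contDiffOn_covCoord v k).mul
      ((H.contDiffOn_pushVec v' k).of_le (by norm_num))).neg
  have hI (v v' : ℂ) : ContDiffOn ℝ 1 (fun w ↦
      ∑ k, frameCoord e ψ (pushVec ψ v) w k * frameCoord e ψ (pushVec ψ v') w k) T :=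
    (ContDiffOn.sum fun k _ ↦
      (H.contDiffOn_pushVec v k).mul (H.contDiffOn_pushVec v' k)).of_le (by norm_num)
  rw [funext (he.extrinsicCurvature_eq hM ψ W)]
  refine ContDiffOn.div (((hII _ _).mul (hII _ _)).sub ((hII _ _).mul (hII _ _)))
    (((hI _ _).mul (hI _ _)).sub ((hI _ _).mul (hI _ _))) fun w hw ↦ ?_
  -- The denominator det I is the square of det(A, B, N), which is positive by orientation; hence
  -- the quotient is smooth enough.
  rw [gram_eq_det_sq (H.sum_normal hM he hw) (H.sum_normal_pushVec hM he hw _)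
    (H.sum_normal_pushVec hM he hw _)]
  exact pow_ne_zero 2 (H.positive w hw).ne'

theorem structureEq (hM : IsLeftInvariantMetric M) (he : IsUnimodularFrame e c)
    (H : IsConformalImmersionOn e ψ W T) {w : ℂ} (hw : w ∈ T) :
    StructureEq (christoffel e) (frameCoord e ψ W) (extrinsicCurvature e ψ W)
      (complexField (frameCoord e ψ (pushVec ψ 1)) (frameCoord e ψ (pushVec ψ Complex.I))) w := by
  have hn (k) : DifferentiableAt ℝ (fun ζ ↦ frameCoord e ψ W ζ k) w :=
    ((H.contDiffOn_normal k).contDiffAt (H.isOpen.mem_nhds hw)).differentiableAt (by norm_num)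
  -- The covariant derivative of the unit normal is tangential: its derivative part by |N| = 1, its
  -- connection part by antisymmetry of the Christoffel symbols.
  have hP (v : ℂ) : ∑ k, covCoord e ψ W v w k * frameCoord e ψ W w k = 0 := by
    simp only [covCoord, add_mul, Finset.sum_add_distrib]
    rw [sum_christoffel_mul_self, sum_fderiv_mul_self hn ?_ v, add_zero]
    filter_upwards [H.isOpen.mem_nhds hw] with ζ hζ using H.sum_normal hM he hζ
  obtain ⟨ρ, hρ, hII⟩ := H.conformal w hw
  have hPA (v v' : ℂ) : ∑ k, covCoord e ψ W v w k * frameCoord e ψ (pushVec ψ v') w k =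
      -(2 * ρ * (v * star v').re) := by
    rw [← hII, he.secondForm_eq hM, neg_neg]
    rfl
  obtain ⟨h1, h2, h3⟩ := derivative_eq_cross (K := extrinsicCurvature e ψ W w) hρ
    (H.sum_normal hM he hw) (H.sum_normal_pushVec hM he hw 1)
    (H.sum_normal_pushVec hM he hw Complex.I) (hP 1) (hP Complex.I)
    ((hPA _ _).trans (by simp)) ((hPA _ _).trans (by simp))
    ((hPA _ _).trans (by simp)) ((hPA _ _).trans (by simp)) (H.positive w hw) (by
      rw [he.extrinsicCurvature_eq hM]
      congr 1
      simp [hII])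
  exact structureEq_complexField hn (fun _ ↦ rfl) (fun _ ↦ rfl) h1 h2 h3

/-- The Gauss map equation for an immersion with positive extrinsic curvature. -/
theorem gaussMapEq (hM : IsLeftInvariantMetric M) (he : IsUnimodularFrame e c)
    (hμ : mu c 0 = mu c 1) (H : IsConformalImmersionOn e ψ W T) {w : ℂ} (hw : w ∈ T)
    (hne : frameCoord e ψ W w 2 ≠ 1) :
    GaussMapEq (mu c 0) (mu c 2) (fun ζ ↦ stereo (frameCoord e ψ W ζ))
      (extrinsicCurvature e ψ W) w := by
  have hN : ContDiffOn ℝ 2 (frameCoord e ψ W) T := contDiffOn_pi.mpr H.contDiffOn_normal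
  have hS : StructureOn (mu c 0) (mu c 2) (christoffel e) {w ∈ T | frameCoord e ψ W w 2 ≠ 1}
      (frameCoord e ψ W) (extrinsicCurvature e ψ W)
      (complexField (frameCoord e ψ (pushVec ψ 1)) (frameCoord e ψ (pushVec ψ Complex.I))) :=
    { milnor := he.isMilnor hμ
      isOpen := (H.contDiffOn_normal 2).continuousOn.isOpen_inter_preimage H.isOpen
        isOpen_compl_singleton
      smooth_N := hN.mono fun w hw ↦ hw.1
      smooth_K := (H.contDiffOn_extrinsicCurvature hM he).mono fun w hw ↦ hw.1
      unit := fun w hw ↦ by simpa only [pow_two] using H.sum_normal hM he hw.1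
      ne_pole := fun w hw ↦ hw.2
      pos := fun w hw ↦ H.pos w hw.1
      eq := fun w hw ↦ H.structureEq hM he hw.1 }
  have hd (v : ℂ) (k) : DifferentiableAt ℝ (fun ζ ↦ frameCoord e ψ (pushVec ψ v) ζ k) w :=
    ((H.contDiffOn_pushVec v k).contDiffAt (H.isOpen.mem_nhds hw)).differentiableAt (by norm_num)
  exact hS.gaussMapEq_of_maurerCartan ⟨hw, hne⟩ (hd 1) (hd Complex.I) (he.maurerCartan hM
    ((H.smooth.contMDiffAt (H.isOpen.mem_nhds hw)).of_le (by norm_cast)) (hd 1) (hd Complex.I))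

end IsConformalImmersionOn

end Immersion

end LieGauss

end

theorem theorem3p3 {M : Type*} [TopologicalSpace M] [ChartedSpace LieGauss.R3 M] [Group M]
    [LieGroup (𝓡 3) ∞ M]
    [RiemannianBundle (fun q : M ↦ TangentSpace (𝓡 3) q)]
    [IsContMDiffRiemannianBundle (𝓡 3) ∞ LieGauss.R3 (fun q : M ↦ TangentSpace (𝓡 3) q)]
    (hM : LieGauss.IsLeftInvariantMetric M)
    (e : Fin 3 → GroupLieAlgebra (𝓡 3) M) (c : Fin 3 → ℝ)
    (he : LieGauss.IsUnimodularFrame e c)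
    (hμ : LieGauss.mu c 0 = LieGauss.mu c 1) :
    -- the Gauss map of an isometric immersion satisfies the equation
    (∀ (S : Type*) [TopologicalSpace S] [ChartedSpace ℂ S] [IsManifold 𝓘(ℝ, ℂ) ∞ S]
      [RiemannianBundle (fun p : S ↦ TangentSpace 𝓘(ℝ, ℂ) p)]
      (φ : S → M) (N : ∀ p : S, TangentSpace (𝓡 3) (φ p)) (z : OpenPartialHomeomorph S ℂ),
      ContMDiff 𝓘(ℝ, ℂ) (𝓡 3) ∞ φ →
      (∀ (p : S) (v v' : TangentSpace 𝓘(ℝ, ℂ) p),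
        inner ℝ (mfderiv 𝓘(ℝ, ℂ) (𝓡 3) φ p v) (mfderiv 𝓘(ℝ, ℂ) (𝓡 3) φ p v') =
          inner ℝ v v') →
      ContMDiff 𝓘(ℝ, ℂ) (𝓡 3).tangent ∞ (fun p ↦ (⟨φ p, N p⟩ : TangentBundle (𝓡 3) M)) →
      (∀ p : S, inner ℝ (N p) (N p) = (1 : ℝ)) →
      (∀ (p : S) (v : TangentSpace 𝓘(ℝ, ℂ) p),
        inner ℝ (N p) (mfderiv 𝓘(ℝ, ℂ) (𝓡 3) φ p v) = (0 : ℝ)) →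
      z ∈ IsManifold.maximalAtlas 𝓘(ℝ, ℂ) ∞ S →
      (∀ w ∈ z.target,
        0 < LieGauss.extrinsicCurvature e (fun ζ ↦ φ (z.symm ζ)) (fun ζ ↦ N (z.symm ζ)) w ∧
        LieGauss.IsConformalAt e (fun ζ ↦ φ (z.symm ζ)) (fun ζ ↦ N (z.symm ζ)) w ∧
        LieGauss.IsPositiveAt e (fun ζ ↦ φ (z.symm ζ)) (fun ζ ↦ N (z.symm ζ)) w) →
      ∀ w ∈ z.target,
        LieGauss.frameCoord e (fun ζ ↦ φ (z.symm ζ)) (fun ζ ↦ N (z.symm ζ)) w 2 ≠ 1 →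
        LieGauss.GaussMapEq (LieGauss.mu c 0) (LieGauss.mu c 2)
          (fun ζ ↦ LieGauss.stereo
            (LieGauss.frameCoord e (fun ξ ↦ φ (z.symm ξ)) (fun ξ ↦ N (z.symm ξ)) ζ))
          (LieGauss.extrinsicCurvature e (fun ζ ↦ φ (z.symm ζ)) (fun ζ ↦ N (z.symm ζ))) w) ∧
    -- the equation is equivalent to the integrability equation
    (∀ (U : Set ℂ) (N : ℂ → Fin 3 → ℝ) (K : ℂ → ℝ) (a : ℂ → Fin 3 → ℂ),
      IsOpen U → ContDiffOn ℝ ∞ N U → ContDiffOn ℝ ∞ K U →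
      (∀ w ∈ U, ∑ k, N w k ^ 2 = 1) → (∀ w ∈ U, 0 < K w) →
      (∀ w ∈ U, LieGauss.StructureEq (LieGauss.christoffel e) N K a w) →
      ∀ w ∈ U, N w 2 ≠ 1 →
        (LieGauss.IntegrabilityEq (LieGauss.christoffel e) N K a w ↔
          LieGauss.GaussMapEq (LieGauss.mu c 0) (LieGauss.mu c 2)
            (fun ζ ↦ LieGauss.stereo (N ζ)) K w)) := by
  refine ⟨?_, ?_⟩
  · intro S _ _ _ _ φ N z hφ _ hN h1 h0 hz hK w hw hne
    have hzs : ContMDiffOn 𝓘(ℝ, ℂ) 𝓘(ℝ, ℂ) ∞ z.symm z.target :=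
      contMDiffOn_symm_of_mem_maximalAtlas hz
    refine LieGauss.IsConformalImmersionOn.gaussMapEq (T := z.target)
      (ψ := fun ζ ↦ φ (z.symm ζ)) (W := fun ζ ↦ N (z.symm ζ)) hM he hμ
      ⟨z.open_target, hφ.comp_contMDiffOn hzs, hN.comp_contMDiffOn hzs, fun w _ ↦ h1 _,
        fun w hw v ↦ ?_, fun w hw ↦ (hK w hw).1, fun w hw ↦ (hK w hw).2.1,
        fun w hw ↦ (hK w hw).2.2⟩ hw hne
    have hd : MDifferentiableAt 𝓘(ℝ, ℂ) 𝓘(ℝ, ℂ) z.symm w :=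
      (hzs.contMDiffAt (z.open_target.mem_nhds hw)).mdifferentiableAt (by simp)
    -- By the chain rule the derivatives of φ ∘ z⁻¹ lie in the image of dφ, hence are orthogonal to
    -- N.
    have hc := mfderiv_comp w (hφ.mdifferentiableAt (x := z.symm w) (by simp)) hd
    have hv : LieGauss.pushVec (fun ζ ↦ φ (z.symm ζ)) v w =
        mfderiv 𝓘(ℝ, ℂ) (𝓡 3) φ (z.symm w) (mfderiv 𝓘(ℝ, ℂ) 𝓘(ℝ, ℂ) z.symm w v) :=
      DFunLike.congr_fun hc v
    rw [hv]
    exact h0 _ _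
  · intro U N K a hU hN hK h1 hpos heq w hw hne
    -- The stereographic coordinate needs N₃ ≠ 1, so U is replaced by its open subset away from the
    -- pole.
    have H := LieGauss.structureOn_of_contDiffOn (he.isMilnor hμ) hU hN hK h1 hpos heq
    exact (H.integrabilityEq_iff ⟨hw, hne⟩).trans (H.torsion_eq_zero_iff ⟨hw, hne⟩)
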